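/- **Setting.** Let $\varepsilon>0$, write $v^\perp=(-v_2,v_1)$ for $v\in\mathbb R^2$, and let $\|\cdot\|$ be the Euclidean norm on $\mathbb R^2$ (and the corresponding operator norm on matrices). Given an electric field $E:[0,\infty)\times\mathbb R^2\to\mathbb R^2$ and $x^0_\varepsilon,v^0_\varepsilon\in\mathbb R^2$, let $(x_\varepsilon,v_\varepsilon)$ be the solution for $t\ge 0$ of $$\varepsilon x_\varepsilon'(t)=v_\varepsilon(t),\qquad \varepsilon v_\varepsilon'(t)=E(t,x_\varepsilon(t))-\tfrac1\varepsilon v_\varepsilon^\perp(t),\qquad x_\varepsilon(0)=x_\varepsilon^0,\quad v_\varepsilon(0)=v_\varepsilon^0,$$ and let $y_\varepsilon=x_\varepsilon-\varepsilon v_\varepsilon^\perp$ be the guiding center variable. Put $$F_y(t,\hat y,\tilde w)=-E^\perp(t,\hat y+\tilde w^\perp),\qquad F_v^\varepsilon(t,\hat y,\hat w,\tilde w)=E(t,\hat y+\hat w^\perp)-\frac{\tilde w^\perp}{\varepsilon^2}.$$ Let $\gamma=1-\frac1{\sqrt2}$, $\Delta t>0$, $t_n=n\Delta t$ and $\hat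 t_{n+1}=t_n+\frac{\Delta t}{2\gamma}$. The second-order scheme starts from $y^0_\varepsilon=x_\varepsilon^0-\varepsilon (v_\varepsilon^0)^\perp$ and $v^0_\varepsilon$, and for every $n\ge0$ it reads $$\varepsilon\frac{\tilde v^{n+1}_\varepsilon-v^n_\varepsilon}{\gamma\Delta t}=F_v^\varepsilon(t_n,y^n_\varepsilon,\varepsilon v_\varepsilon^n,\varepsilon\tilde v_\varepsilon^{n+1}),$$ $$\frac{\hat y^{n+1}_\varepsilon-y^n_\varepsilon}{\Delta t/(2\gamma)}=F_y(t_n,y_\varepsilon^n,\varepsilon\tilde v_\varepsilon^{n+1}),\qquad \varepsilon\frac{\hat v^{n+1}_\varepsilon-v^n_\varepsilon}{\Delta t/(2\gamma)}=F_v^\varepsilon(t_n,y_\varepsilon^n,\varepsilon v_\varepsilon^n,\varepsilon\tilde v_\varepsilon^{n+1}),$$ $$\frac{y^{n+1}_\varepsilon-y^n_\varepsilon}{\Delta t}=(1-\gamma)F_y(t_n,y_\varepsilon^n,\varepsilon\tilde v_\varepsilon^{n+1})+\gamma F_y(\hat t_{n+1},\hat y_\varepsilon^{n+1},\varepsilon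 v_\varepsilon^{n+1}),$$ $$\varepsilon\frac{v^{n+1}_\varepsilon-v^n_\varepsilon}{\Delta t}=(1-\gamma)F_v^\varepsilon(t_n,y_\varepsilon^n,\varepsilon v_\varepsilon^n,\varepsilon\tilde v_\varepsilon^{n+1})+\gamma F_v^\varepsilon(\hat t_{n+1},\hat y_\varepsilon^{n+1},\varepsilon\hat v_\varepsilon^{n+1},\varepsilon v_\varepsilon^{n+1}),$$ with $x_\varepsilon^n=y_\varepsilon^n+\varepsilon (v_\varepsilon^n)^\perp$. For $E\in W^{2,\infty}((0,\infty)\times\mathbb R^2)$, identified with its continuous representative on $[0,\infty)\times\mathbb R^2$, let $K_x=\|D_xE\|_{L^\infty((0,\infty)\times\mathbb R^2)}$. **Theorem.** The scheme has a unique solution: for all $\varepsilon,\Delta t>0$ and all $x_\varepsilon^0,v_\varepsilon^0$ there is exactly one family $(y_\varepsilon^n,v_\varepsilon^n,\tilde v_\varepsilon^{n+1},\hat y_\varepsilon^{n+1},\hat v_\varepsilon^{n+1})_{n\ge0}$ satisfying it. Moreover: (i) There is a universal constant $C_0$ such that for every $E\in W^{2,\infty}$ there is a constant $C$ depending only on $E$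 such that, for all $n\ge 0$, $\Delta t>0$, $\varepsilon>0$, $x_\varepsilon^0,v_\varepsilon^0\in\mathbb R^2$, $$\|x_\varepsilon^n-x_\varepsilon(t_n)\|\le C\,e^{C_0K_xt_n}(1+t_n)^3(1+\varepsilon^2+\|v_\varepsilon^0\|^2)\,\min\Big(\frac{\Delta t^2}{\varepsilon^5}(1+\varepsilon^3),\ \varepsilon+\Delta t^2\Big).$$ (ii) There is a universal constant $C_0$ such that for every $E\in W^{2,\infty}$ there is a constant $C$ depending only on $E$ such that, for all $n\ge 0$, $\Delta t>0$, $\varepsilon>0$, $x_\varepsilon^0,v_\varepsilon^0\in\mathbb R^2$, $$\|y_\varepsilon^n-y_\varepsilon(t_n)\|\le C\,e^{C_0K_xt_n}(1+t_n)^4(1+\varepsilon^2+\|v_\varepsilon^0\|^2)\,\min\Big(\frac{\Delta t^2}{\varepsilon^5}(1+\varepsilon^3),\ \varepsilon^2+\Delta t^2\Big).$$ -/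

import Mathlib

open MeasureTheory
open scoped ContDiff

/-! ### Weak derivatives and the Sobolev space of order two with bounded derivatives -/

/-- `f'` is a weak (distributional) derivative of `f` on the open set `Ω`, seen as a map with
values in linear maps: `f` and `f'` are locally integrable on `Ω` and, for every direction `w` and
every smooth `φ` with compact support inside `Ω`, `∫_Ω (∂_w φ) f = - ∫_Ω φ (f' w)`. -/
def HasWeakFDerivOn {X F : Type*} [NormedAddCommGroup X] [NormedSpace ℝ X] [MeasureSpace X]
    [NormedAddCommGroup F] [NormedSpace ℝ F] (Ω : Set X) (f : X → F) (f' : X → X →L[ℝ] F) : Prop :=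
  LocallyIntegrableOn f Ω ∧ LocallyIntegrableOn f' Ω ∧
    ∀ φ : X → ℝ, ContDiff ℝ ∞ φ → HasCompactSupport φ → tsupport φ ⊆ Ω → ∀ w : X,
      ∫ z in Ω, (fderiv ℝ φ z w) • f z = - ∫ z in Ω, φ z • f' z w

/-- `f` belongs to `W^{2,∞}(Ω)`: it is essentially bounded on `Ω`, together with its weak
derivatives of orders one and two. -/
def MemW2Infty {X F : Type*} [NormedAddCommGroup X] [NormedSpace ℝ X] [MeasureSpace X]
    [NormedAddCommGroup F] [NormedSpace ℝ F] (Ω : Set X) (f : X → F) : Prop :=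
  MemLp f ⊤ (volume.restrict Ω) ∧
    ∃ (f' : X → X →L[ℝ] F) (f'' : X → X →L[ℝ] X →L[ℝ] F),
      HasWeakFDerivOn Ω f f' ∧ MemLp f' ⊤ (volume.restrict Ω) ∧
      HasWeakFDerivOn Ω f' f'' ∧ MemLp f'' ⊤ (volume.restrict Ω)

open Classical in
/-- The weak derivative of `f` on `Ω` (determined almost everywhere in `Ω`), and `0` if there is
none. -/
noncomputable def weakFDerivOn {X F : Type*} [NormedAddCommGroup X] [NormedSpace ℝ X]
    [MeasureSpace X] [NormedAddCommGroup F] [NormedSpace ℝ F] (Ω : Set X) (f : X → F) :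
    X → X →L[ℝ] F :=
  if h : ∃ f', HasWeakFDerivOn Ω f f' then h.choose else 0

namespace GuidingCenter

/-- The plane `ℝ²` with its Euclidean norm. -/
abbrev Plane : Type := EuclideanSpace ℝ (Fin 2)

/-- `v^⊥ = (-v₂, v₁)`. -/
noncomputable def perp (v : Plane) : Plane := !₂[-v 1, v 0]

/-- The open half-space `(0, ∞) × ℝ²` of times and positions. -/
def spaceTime : Set (ℝ × Plane) := {p | 0 < p.1}

/-- The electric field `E` belongs to `W^{2,∞}((0, ∞) × ℝ²)`, and `E` denotes its continuous
representative on `[0, ∞) × ℝ²`. -/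
def FieldW2Infty (E : ℝ × Plane → Plane) : Prop :=
  ContinuousOn E {p | 0 ≤ p.1} ∧ MemW2Infty spaceTime E

/-- `K_x = ‖D_x E‖_{L^∞}`: the essential supremum over `(0, ∞) × ℝ²` of the Euclidean operator norm
of the derivative of `E` in the position variable. -/
noncomputable def Kx (E : ℝ × Plane → Plane) : ℝ :=
  (eLpNorm (fun p => (weakFDerivOn spaceTime E p).comp (ContinuousLinearMap.inr ℝ ℝ Plane)) ⊤
    (volume.restrict spaceTime)).toReal

/-- `(x, v)` is the solution on `[0, ∞)` of the characteristic system
`ε x' = v`, `ε v' = E(t, x) - v^⊥ / ε` with initial datum `(x⁰, v⁰)` at time `0`. -/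
structure IsCharacteristic (E : ℝ × Plane → Plane) (ε : ℝ) (x₀ v₀ : Plane)
    (x v : ℝ → Plane) : Prop where
  x_zero : x 0 = x₀
  v_zero : v 0 = v₀
  deriv_x : ∀ t, 0 ≤ t → ∃ a : Plane, HasDerivWithinAt x a (Set.Ici 0) t ∧ ε • a = v t
  deriv_v : ∀ t, 0 ≤ t → ∃ b : Plane, HasDerivWithinAt v b (Set.Ici 0) t ∧
    ε • b = E (t, x t) - (1 / ε) • perp (v t)

/-- The guiding center variable `y = x - ε v^⊥`. -/
noncomputable def guidingCenter (ε : ℝ) (x v : Plane) : Plane := x - ε • perp v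

/-- `γ = 1 - 1/√2`, the smallest root of `γ² - 2γ + 1/2`. -/
noncomputable def gam : ℝ := 1 - 1 / Real.sqrt 2

/-- `F_y(t, ŷ, w) = -E^⊥(t, ŷ + w^⊥)`. -/
noncomputable def Fy (E : ℝ × Plane → Plane) (t : ℝ) (yh w : Plane) : Plane :=
  -perp (E (t, yh + perp w))

/-- `F_v^ε(t, ŷ, ŵ, w) = E(t, ŷ + ŵ^⊥) - w^⊥ / ε²`; `ŷ, ŵ` are the non-stiff arguments and `w` is
the stiff one. -/
noncomputable def Fv (E : ℝ × Plane → Plane) (ε t : ℝ) (yh wh w : Plane) : Plane :=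
  E (t, yh + perp wh) - (1 / ε ^ 2) • perp w

/-- The unknowns of the scheme. For the step from `t_n = n Δt` to `t_{n+1}`, `y n, v n` are the
values at `t_n`, and `vt n, yh n, vh n` are the values `ṽ^{n+1}, ŷ^{n+1}, v̂^{n+1}` of the
intermediate stages of that step. -/
@[ext]
structure Trajectory where
  y : ℕ → Plane
  v : ℕ → Plane
  vt : ℕ → Plane
  yh : ℕ → Plane
  vh : ℕ → Plane

/-- The position `x^n = y^n + ε (v^n)^⊥`. -/
noncomputable def Trajectory.x (T : Trajectory) (ε : ℝ) (n : ℕ) : Plane := T.y n + ε • perp (T.v n)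

/-- `T` solves the second-order L-stable implicit-explicit scheme with time step `Δt = dt`, started
from the position `x₀` and the velocity `v₀`. -/
structure SolvesScheme (E : ℝ × Plane → Plane) (ε dt : ℝ) (x₀ v₀ : Plane) (T : Trajectory) :
    Prop where
  y_zero : T.y 0 = guidingCenter ε x₀ v₀
  v_zero : T.v 0 = v₀
  /-- First stage (linearly implicit in `ṽ^{n+1}`, time step `γ Δt`). -/
  stage_vt : ∀ n : ℕ, (ε / (gam * dt)) • (T.vt n - T.v n) =
    Fv E ε (n * dt) (T.y n) (ε • T.v n) (ε • T.vt n)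
  /-- Second stage (explicit, time step `Δt / (2γ)`). -/
  stage_yh : ∀ n : ℕ, (1 / (dt / (2 * gam))) • (T.yh n - T.y n) =
    Fy E (n * dt) (T.y n) (ε • T.vt n)
  stage_vh : ∀ n : ℕ, (ε / (dt / (2 * gam))) • (T.vh n - T.v n) =
    Fv E ε (n * dt) (T.y n) (ε • T.v n) (ε • T.vt n)
  /-- Last stage, with `t̂_{n+1} = t_n + Δt / (2γ)` (linearly implicit in `v^{n+1}`). -/
  step_y : ∀ n : ℕ, (1 / dt) • (T.y (n + 1) - T.y n) =
    (1 - gam) • Fy E (n * dt) (T.y n) (ε • T.vt n) +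
      gam • Fy E (n * dt + dt / (2 * gam)) (T.yh n) (ε • T.v (n + 1))
  step_v : ∀ n : ℕ, (ε / dt) • (T.v (n + 1) - T.v n) =
    (1 - gam) • Fv E ε (n * dt) (T.y n) (ε • T.v n) (ε • T.vt n) +
      gam • Fv E ε (n * dt + dt / (2 * gam)) (T.yh n) (ε • T.vh n) (ε • T.v (n + 1))

end GuidingCenter

section

open Filter Topology Convolution

/-! ### Weak derivatives and their mollification -/

section

/-! Identify the plane with ℂ, so that `perp` is multiplication by i, and put w = ε v, λ = 1/ε². The
flow becomes y' = -i e(t, y + i w), w' = e(t, y + i w) - iλ w, and the scheme an implicit-explicit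
step for it (`ImexStep`). Its implicit equations are affine with the invertible factor 1 + iγλΔt,
which gives existence and uniqueness. Mollification shows that E is differentiable up to time 0,
with a Lipschitz derivative whose position part is bounded by K_x (`FieldW2Infty.exists_deriv`).
Only K = K_x multiplies quantities that are fed back through a Gronwall argument; the other bounds
on E, gathered in B, enter source terms. This is why the exponential rate is a universal multiple of
K_x.

The two members of each minimum come from two independent arguments. The one with negative powers of
ε is consistency plus stability. The amplification factor of the stiff rotation has modulus at most
one, so a step expands distances by at most e^{35KΔt} whatever λ is (`ImexStep.stability`). Taylor
expansion along the flow gives a defect of order Δt³ Q, where Q is polynomial in λ and in the bound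
on w (`ImexStep.local_error`).

The other bound has to use the gyration. First, w has size ε(‖v⁰‖ + ε) up to factors depending on
time and E, along the flow and along the scheme, because the deviation w + i e(t, y)/λ from the
local equilibrium is rotated or damped, with a slow forcing of order 1/λ. Next, expand e in w: up to
terms quadratic in (Δt, w), y follows the explicit scheme `limitStep` for y' = -i e(t, y), plus the
linear map `drift` applied to the time integral of w over the step (for the scheme, to its
quadrature). The equation for w turns this integral into 1/λ times an increment of i w plus a term
of order Δt/λ. The increment is absorbed by replacing y with y - λ⁻¹ `drift` (i w). By
`corrected_step`, applied to the flow and to the scheme alike, both corrected guiding centers follow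
the same scheme with a defect Δt · O(Δt² + ε²), and a discrete Gronwall argument compares them
(`uniform_error`).

The position x = y + i w adds the error on w, bounded by the sizes of the two terms; this gives ε
instead of ε². -/

theorem MeasureTheory.MemLp.locallyIntegrable_indicator {X F : Type*} [TopologicalSpace X]
    [MeasureSpace X] [IsLocallyFiniteMeasure (volume : Measure X)] [NormedAddCommGroup F]
    {Ω : Set X} {f : X → F} (hf : MemLp f ⊤ (volume.restrict Ω)) (hΩ : MeasurableSet Ω) :
    LocallyIntegrable (Ω.indicator f) volume :=
  ((memLp_indicator_iff_restrict hΩ).2 hf).locallyIntegrable le_top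

/-- Weak derivatives are unique almost everywhere. -/
theorem HasWeakFDerivOn.ae_eq {X F : Type*} [NormedAddCommGroup X] [NormedSpace ℝ X]
    [MeasureSpace X] [NormedAddCommGroup F] [NormedSpace ℝ F] [FiniteDimensional ℝ X]
    [BorelSpace X] [CompleteSpace F] {Ω : Set X} (hΩ : IsOpen Ω)
    {f : X → F} {f' g' : X → X →L[ℝ] F} (h1 : HasWeakFDerivOn Ω f f')
    (h2 : HasWeakFDerivOn Ω f g') : f' =ᵐ[volume.restrict Ω] g' := by
  have hli : LocallyIntegrableOn (f' - g') Ω volume := h1.2.1.sub h2.2.1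
  have h := hΩ.ae_eq_zero_of_integral_contDiff_smul_eq_zero hli ?_
  · rw [EventuallyEq, ae_restrict_iff' hΩ.measurableSet]
    filter_upwards [h] with z hz hzΩ
    exact sub_eq_zero.1 (hz hzΩ)
  · intro φ hφ hc hs
    have i1 : ∀ {g : X → X →L[ℝ] F}, LocallyIntegrableOn g Ω volume →
        Integrable (fun z => φ z • g z) volume := by
      intro g hg
      have hcomp : IsCompact (tsupport φ) := hc
      have h3 : IntegrableOn (fun z => φ z • g z) (tsupport φ) volume :=
        (hg.integrableOn_compact_subset hs hcomp).continuousOn_smul hφ.continuous.continuousOn hcomp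
      refine (integrableOn_iff_integrable_of_support_subset (f := fun z => φ z • g z)
        (s := tsupport φ) ?_).1 h3
      intro z hz
      refine subset_tsupport φ fun h0 => hz ?_
      simp [h0]
    have e : ∀ {g : X → X →L[ℝ] F}, LocallyIntegrableOn g Ω volume → ∀ w,
        (∫ z, φ z • g z) w = ∫ z in Ω, φ z • g z w := by
      intro g hg w
      rw [ContinuousLinearMap.integral_apply (i1 hg)]
      rw [setIntegral_eq_integral_of_forall_compl_eq_zero]
      · rfl
      · intro z hz
        have : φ z = 0 := by
          by_contra h0
          exact hz (hs (subset_tsupport φ h0))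
        simp [this]
    have : ∀ z, φ z • (f' - g') z = φ z • f' z - φ z • g' z := fun z => by simp [smul_sub]
    simp only [this]
    rw [integral_sub (i1 h1.2.1) (i1 h2.2.1), sub_eq_zero]
    ext w
    rw [e h1.2.1, e h2.2.1]
    have a1 := h1.2.2 φ hφ hc hs w
    have a2 := h2.2.2 φ hφ hc hs w
    rw [a1, neg_inj] at a2
    exact a2

section Mollification

variable {X F : Type*} [NormedAddCommGroup X] [NormedSpace ℝ X] [MeasureSpace X]
  [NormedAddCommGroup F] [NormedSpace ℝ F]

/-- The mollification of the restriction of `f` to `Ω` by a normed bump function. -/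
noncomputable def mollify [HasContDiffBump X] (φ : ContDiffBump (0 : X)) (Ω : Set X) (f : X → F) :
    X → F :=
  convolution (φ.normed volume) (Ω.indicator f) (ContinuousLinearMap.lsmul ℝ ℝ) volume

variable [FiniteDimensional ℝ X] [BorelSpace X] [(volume : Measure X).IsAddHaarMeasure]

theorem mollify_apply (φ : ContDiffBump (0 : X)) (Ω : Set X) (f : X → F) (p : X) :
    mollify φ Ω f p = ∫ z, φ.normed volume (p - z) • Ω.indicator f z := by
  rw [mollify, convolution_eq_swap]
  rfl

theorem integrable_mollify (φ : ContDiffBump (0 : X)) {Ω : Set X} (hΩ : MeasurableSet Ω)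
    {f : X → F} (hf : MemLp f ⊤ (volume.restrict Ω)) (p : X) :
    Integrable (fun z => φ.normed volume (p - z) • Ω.indicator f z) volume := by
  have h := (φ.hasCompactSupport_normed (μ := volume)).convolutionExists_left
    (ContinuousLinearMap.lsmul ℝ ℝ) φ.continuous_normed
    (hf.locallyIntegrable_indicator hΩ) p
  have h2 := h.integrable_swap
  exact h2

/-- A mollification is an average against a nonnegative kernel of mass one, and a linear map
commutes with the integral. Allowing a general `T` lets the position part of the derivative keep its
own bound `Kx E`, apart from that of the full derivative. -/
theorem norm_clm_mollify_le [CompleteSpace F] {G : Type*} [NormedAddCommGroup G] [NormedSpace ℝ G]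
    [CompleteSpace G]
    (φ : ContDiffBump (0 : X)) {Ω : Set X} (hΩ : MeasurableSet Ω)
    {f : X → F} (hf : MemLp f ⊤ (volume.restrict Ω)) (T : F →L[ℝ] G) {C : ℝ} (hC : 0 ≤ C)
    (hT : ∀ᵐ z ∂(volume.restrict Ω), ‖T (f z)‖ ≤ C) (p : X) : ‖T (mollify φ Ω f p)‖ ≤ C := by
  rw [mollify_apply, ← T.integral_comp_comm (integrable_mollify φ hΩ hf p)]
  have hint : Integrable (fun z => φ.normed volume (p - z)) volume :=
    φ.integrable_normed.comp_sub_left p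
  have h1 : ∫ z, φ.normed volume (p - z) * C = C := by
    rw [integral_mul_const, integral_sub_left_eq_self (φ.normed volume) volume p,
      φ.integral_normed, one_mul]
  rw [← h1]
  refine norm_integral_le_of_norm_le (hint.mul_const C) ?_
  filter_upwards [(ae_restrict_iff' hΩ).1 hT] with z hz
  rw [map_smul, norm_smul, Real.norm_of_nonneg (φ.nonneg_normed _)]
  gcongr
  · exact φ.nonneg_normed _
  · by_cases h : z ∈ Ω
    · simpa [h] using hz h
    · simpa [h] using hC

/-- Differentiating the kernel and using the translated bump z ↦ φ(p - z) as test function moves the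
derivative onto `f`. The bump is admissible precisely because the closed ball around `p` lies in
`Ω`; elsewhere the extension by zero would create boundary terms. -/
theorem hasFDerivAt_mollify [CompleteSpace F] (φ : ContDiffBump (0 : X)) {Ω : Set X}
    (hΩ : MeasurableSet Ω) {f : X → F} {f' : X → X →L[ℝ] F} (hff' : HasWeakFDerivOn Ω f f')
    (hf : MemLp f ⊤ (volume.restrict Ω)) (hf' : MemLp f' ⊤ (volume.restrict Ω)) {p : X}
    (hp : Metric.closedBall p φ.rOut ⊆ Ω) :
    HasFDerivAt (mollify φ Ω f) (mollify φ Ω f' p) p := by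
  have hsm : ContDiff ℝ ∞ (φ.normed volume) := φ.contDiff_normed
  have h := φ.hasCompactSupport_normed (μ := volume) |>.hasFDerivAt_convolution_left
    (ContinuousLinearMap.lsmul ℝ ℝ) φ.contDiff_normed
    (hf.locallyIntegrable_indicator hΩ) p
  refine h.congr_fderiv ?_
  ext w
  have hcs : HasCompactSupport (fderiv ℝ (φ.normed volume)) :=
    φ.hasCompactSupport_normed.fderiv (𝕜 := ℝ)
  have hint := (hcs.convolutionExists_left
    (ContinuousLinearMap.precompL X (ContinuousLinearMap.lsmul ℝ ℝ : ℝ →L[ℝ] F →L[ℝ] F))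
    (hsm.continuous_fderiv (by simp)) (hf.locallyIntegrable_indicator hΩ) p)
  rw [convolution_eq_swap, ContinuousLinearMap.integral_apply hint.integrable_swap, mollify_apply,
    ContinuousLinearMap.integral_apply (integrable_mollify φ hΩ hf' p)]
  have hφp : ContDiff ℝ ∞ (fun z => φ.normed volume (p - z)) :=
    hsm.comp (contDiff_const.sub contDiff_id)
  have hsupp : tsupport (fun z => φ.normed volume (p - z)) ⊆ Metric.closedBall p φ.rOut := by
    refine closure_minimal ?_ Metric.isClosed_closedBall
    intro z hz
    have h1 : p - z ∈ Function.support (φ.normed volume) := hz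
    rw [φ.support_normed_eq, mem_ball_zero_iff] at h1
    rw [Metric.mem_closedBall, dist_comm, dist_eq_norm]
    exact h1.le
  have hder : ∀ z, fderiv ℝ (fun z => φ.normed volume (p - z)) z w =
      - fderiv ℝ (φ.normed volume) (p - z) w := by
    intro z
    have h1 : HasFDerivAt (fun z => p - z) (-ContinuousLinearMap.id ℝ X) z := by
      simpa using (hasFDerivAt_id z).const_sub p
    have h2 : HasFDerivAt (φ.normed volume) (fderiv ℝ (φ.normed volume) (p - z)) (p - z) :=
      ((hsm.differentiable (by simp)) _).hasFDerivAt
    have h3 : HasFDerivAt (fun z => φ.normed volume (p - z)) _ z := h2.comp z h1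
    rw [h3.fderiv]
    simp
  have key := hff'.2.2 (fun z => φ.normed volume (p - z)) hφp
    (HasCompactSupport.of_support_subset_isCompact (isCompact_closedBall p φ.rOut)
      (subset_closure.trans hsupp)) (hsupp.trans hp) w
  simp only [hder, neg_smul, integral_neg, neg_inj] at key
  rw [← integral_indicator hΩ, ← integral_indicator hΩ] at key
  convert key using 1
  · congr 1
    ext z
    by_cases hz : z ∈ Ω <;> simp [hz, ContinuousLinearMap.precompL_apply]
  · congr 1
    ext z
    by_cases hz : z ∈ Ω <;> simp [hz]

/-- The centres `k n` need not equal `p`: a boundary point can be approached from inside `Ω`, where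
continuity within the larger set `Ω'` is enough. -/
theorem tendsto_mollify [CompleteSpace F] {Ω Ω' : Set X} (hΩ : MeasurableSet Ω) (hΩ' : Ω ⊆ Ω')
    {f : X → F} (hf : MemLp f ⊤ (volume.restrict Ω)) {φ : ℕ → ContDiffBump (0 : X)} {k : ℕ → X}
    {p : X} (hφ : Tendsto (fun n => (φ n).rOut) atTop (𝓝 0)) (hk : Tendsto k atTop (𝓝 p))
    (hball : ∀ n, Metric.ball (k n) (φ n).rOut ⊆ Ω) (hc : ContinuousWithinAt f Ω' p) :
    Tendsto (fun n => mollify (φ n) Ω f (k n)) atTop (𝓝 (f p)) := by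
  rw [Metric.tendsto_atTop']
  intro ε hε
  rw [Metric.continuousWithinAt_iff] at hc
  obtain ⟨δ, hδ, hd⟩ := hc (ε / 2) (by positivity)
  have e1 := (hφ.eventually (gt_mem_nhds (half_pos hδ)))
  have e2 := hk.eventually (Metric.ball_mem_nhds p (half_pos hδ))
  obtain ⟨N, hN⟩ := eventually_atTop.1 (e1.and e2)
  refine ⟨N, fun n hn => ?_⟩
  obtain ⟨h1, h2⟩ := hN n hn.le
  refine (dist_convolution_le (by positivity : 0 ≤ ε / 2) (φ n).support_normed_eq.subset
    (fun x => (φ n).nonneg_normed x) (φ n).integral_normed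
    (hf.locallyIntegrable_indicator hΩ).aestronglyMeasurable ?_).trans_lt
    (half_lt_self hε)
  intro x hx
  have hxΩ := hball n hx
  rw [Set.indicator_of_mem hxΩ]
  refine (hd (hΩ' hxΩ) ?_).le
  calc dist x p ≤ dist x (k n) + dist (k n) p := dist_triangle _ _ _
    _ < δ / 2 + δ / 2 := add_lt_add (lt_trans hx h1) h2
    _ = δ := by ring

end Mollification

end

/-! ### Regularity of the field up to the initial time -/

/-- A pointwise limit of functions with uniformly bounded, uniformly Lipschitz derivatives satisfies
a second order Taylor estimate, with a derivative obeying the same bounds. -/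
theorem exists_deriv_of_tendsto_of_taylor {X F H : Type*} [NormedAddCommGroup X] [NormedSpace ℝ X]
    [FiniteDimensional ℝ X] [NormedAddCommGroup F] [NormedSpace ℝ F] [FiniteDimensional ℝ F]
    [NormedAddCommGroup H] [NormedSpace ℝ H] {s : Set X} {f : X → F} {g : ℕ → X → F}
    {g' : ℕ → X → X →L[ℝ] F} (P : (X →L[ℝ] F) →L[ℝ] H) {B₁ B₂ K : ℝ}
    (hB₁ : ∀ n p, ‖g' n p‖ ≤ B₁) (hP : ∀ n p, ‖P (g' n p)‖ ≤ K)
    (taylor : ∀ n p q, p ∈ s → q ∈ s → ‖g n q - g n p - g' n p (q - p)‖ ≤ B₂ * ‖q - p‖ ^ 2)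
    (lip : ∀ n p q, p ∈ s → q ∈ s → ‖g' n q - g' n p‖ ≤ B₂ * ‖q - p‖)
    (hf : ∀ p ∈ s, Tendsto (fun n => g n p) atTop (𝓝 (f p))) :
    ∃ D : X → X →L[ℝ] F, (∀ p, ‖D p‖ ≤ B₁ ∧ ‖P (D p)‖ ≤ K) ∧ ∀ p q, p ∈ s → q ∈ s →
      ‖f q - f p - D p (q - p)‖ ≤ B₂ * ‖q - p‖ ^ 2 ∧ ‖D q - D p‖ ≤ B₂ * ‖q - p‖ := by
  -- The operators `g' n p` stay in a compact ball, so one ultrafilter gives a limit at every point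
  -- at once, without any diagonal extraction; the inequalities pass to these limits.
  let U : Ultrafilter ℕ := Ultrafilter.of atTop
  have hU : (U : Filter ℕ) ≤ atTop := Ultrafilter.of_le _
  have hlim : ∀ p, ∃ L, Tendsto (fun n => g' n p) U (𝓝 L) := by
    intro p
    have : ProperSpace (X →L[ℝ] F) := FiniteDimensional.proper ℝ _
    obtain ⟨L, -, hL⟩ := (isCompact_closedBall (0 : X →L[ℝ] F) B₁).ultrafilter_le_nhds
      (U.map fun n => g' n p) (by
        rw [Ultrafilter.coe_map, le_principal_iff, mem_map]
        exact Filter.univ_mem' fun n => by simpa using hB₁ n p)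
    exact ⟨L, hL⟩
  choose D hD using hlim
  refine ⟨D, fun p => ⟨le_of_tendsto' (hD p).norm fun n => hB₁ n _,
    le_of_tendsto' ((P.continuous.tendsto _).comp (hD p)).norm fun n => hP n _⟩,
    fun p q hp hq => ⟨?_, le_of_tendsto' ((hD q).sub (hD p)).norm fun n => lip n p q hp hq⟩⟩
  have h3 : Tendsto (fun n => g' n p (q - p)) U (𝓝 (D p (q - p))) :=
    ((ContinuousLinearMap.apply ℝ F (q - p)).continuous.tendsto _).comp (hD p)
  exact le_of_tendsto' ((((hf q hq).mono_left hU).sub ((hf p hp).mono_left hU)).sub h3).norm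
    fun n => taylor n p q hp hq

namespace GuidingCenter

theorem isOpen_spaceTime : IsOpen spaceTime := isOpen_lt continuous_const continuous_fst

/-- A continuous field of class `W^{2,∞}` on the half-space is differentiable up to the boundary,
with a bounded Lipschitz derivative, whose part in the position variable is bounded by `Kx`. -/
theorem FieldW2Infty.exists_deriv {E : ℝ × Plane → Plane} (hE : FieldW2Infty E) :
    ∃ (B : ℝ) (D : ℝ × Plane → ℝ × Plane →L[ℝ] Plane), 1 ≤ B ∧ Kx E ≤ B ∧
      (∀ p : ℝ × Plane, 0 ≤ p.1 → ‖E p‖ ≤ B ∧ ‖D p‖ ≤ B ∧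
        ‖(D p).comp (ContinuousLinearMap.inr ℝ ℝ Plane)‖ ≤ Kx E) ∧
      ∀ p q : ℝ × Plane, 0 ≤ p.1 → 0 ≤ q.1 →
        ‖E q - E p - D p (q - p)‖ ≤ B * ‖q - p‖ ^ 2 ∧ ‖D q - D p‖ ≤ B * ‖q - p‖ := by
  have : (volume : Measure (ℝ × Plane)).IsAddHaarMeasure :=
    inferInstanceAs ((volume : Measure ℝ).prod (volume : Measure Plane)).IsAddHaarMeasure
  obtain ⟨hcont, hE0, f', f'', hf', hf'b, hf'', hf''b⟩ := hE
  have hΩ := isOpen_spaceTime.measurableSet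
  have bound : ∀ {G : Type} [NormedAddCommGroup G] {g : ℝ × Plane → G},
      MemLp g ⊤ (volume.restrict spaceTime) →
      ∀ᵐ z ∂(volume.restrict spaceTime),
        ‖g z‖ ≤ (eLpNorm g ⊤ (volume.restrict spaceTime)).toReal := by
    intro G _ g hg
    have h1 := ae_le_eLpNormEssSup (f := g) (μ := volume.restrict spaceTime)
    filter_upwards [h1] with z hz
    rw [← toReal_enorm]
    exact ENNReal.toReal_mono hg.eLpNorm_lt_top.ne (by simpa using hz)
  set P : (ℝ × Plane →L[ℝ] Plane) →L[ℝ] (Plane →L[ℝ] Plane) :=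
    (ContinuousLinearMap.compL ℝ Plane (ℝ × Plane) Plane).flip
      (ContinuousLinearMap.inr ℝ ℝ Plane) with hP
  -- `Kx` is defined through a chosen weak derivative; almost everywhere uniqueness replaces it by
  -- the derivative `f'` at hand.
  have hKx : Kx E = (eLpNorm (fun p => P (f' p)) ⊤ (volume.restrict spaceTime)).toReal := by
    have hex : ∃ g', HasWeakFDerivOn spaceTime E g' := ⟨f', hf'⟩
    have hw : HasWeakFDerivOn spaceTime E (weakFDerivOn spaceTime E) := by
      rw [weakFDerivOn, dif_pos hex]
      exact hex.choose_spec
    have hae := hw.ae_eq isOpen_spaceTime hf'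
    rw [Kx]
    congr 1
    refine eLpNorm_congr_ae ?_
    filter_upwards [hae] with z hz
    rw [hz]
    rfl
  have hPb : ∀ᵐ z ∂(volume.restrict spaceTime), ‖P (f' z)‖ ≤ Kx E := by
    rw [hKx]
    exact bound (P.comp_memLp' hf'b)
  have b0 := bound hE0
  have b1 := bound hf'b
  have b2 := bound (g := f'') hf''b
  set B0 := (eLpNorm E ⊤ (volume.restrict spaceTime)).toReal
  set B1 := (eLpNorm f' ⊤ (volume.restrict spaceTime)).toReal
  set B2 := (eLpNorm f'' ⊤ (volume.restrict spaceTime)).toReal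
  have h0 : 0 ≤ B0 := ENNReal.toReal_nonneg
  have h1 : 0 ≤ B1 := ENNReal.toReal_nonneg
  have h2 : 0 ≤ B2 := ENNReal.toReal_nonneg
  have hK : 0 ≤ Kx E := ENNReal.toReal_nonneg
  have hh : ∀ n : ℕ, (0 : ℝ) < 1 / (n + 1) := fun n => by positivity
  let φ : ℕ → ContDiffBump (0 : ℝ × Plane) := fun n =>
    ⟨1 / (n + 1) / 2, 1 / (n + 1), half_pos (hh n), half_lt_self (hh n)⟩
  -- The shift in time is twice the radius of the bump, so the ball around the shifted point stays
  -- in the open half-space even when the time is 0.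
  let a : ℕ → ℝ × Plane := fun n => (2 * (1 / ((n : ℝ) + 1)), 0)
  have hball : ∀ n (p : ℝ × Plane), 0 ≤ p.1 →
      Metric.closedBall (p + a n) (φ n).rOut ⊆ spaceTime := by
    intro n p hp z hz
    rw [Metric.mem_closedBall, dist_eq_norm] at hz
    have hz1 : ‖(z - (p + a n)).1‖ ≤ 1 / ((n : ℝ) + 1) := (norm_fst_le _).trans hz
    rw [Real.norm_eq_abs, abs_le] at hz1
    have hz2 : (z - (p + a n)).1 = z.1 - (p.1 + 2 * (1 / ((n : ℝ) + 1))) := rfl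
    have := hh n
    rw [hz2] at hz1
    change 0 < z.1
    linarith [hz1.1]
  have hder : ∀ n (p : ℝ × Plane), 0 ≤ p.1 →
      HasFDerivAt (fun p => mollify (φ n) spaceTime E (p + a n))
        (mollify (φ n) spaceTime f' (p + a n)) p := fun n p hp =>
    (hasFDerivAt_comp_add_right (a n)).2 (hasFDerivAt_mollify (φ n) hΩ hf' hE0 hf'b (hball n p hp))
  have hder2 : ∀ n (p : ℝ × Plane), 0 ≤ p.1 →
      HasFDerivAt (fun p => mollify (φ n) spaceTime f' (p + a n))
        (mollify (φ n) spaceTime f'' (p + a n)) p := fun n p hp =>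
    (hasFDerivAt_comp_add_right (a n)).2 (hasFDerivAt_mollify (φ n) hΩ hf'' hf'b hf''b (hball n p hp))
  have nb0 : ∀ n p, ‖mollify (φ n) spaceTime E p‖ ≤ B0 := fun n p =>
    norm_clm_mollify_le (φ n) hΩ hE0 (ContinuousLinearMap.id ℝ _) h0 b0 p
  have nb1 : ∀ n p, ‖mollify (φ n) spaceTime f' p‖ ≤ B1 := fun n p =>
    norm_clm_mollify_le (φ n) hΩ hf'b (ContinuousLinearMap.id ℝ _) h1 b1 p
  have nb2 : ∀ n p, ‖mollify (φ n) spaceTime f'' p‖ ≤ B2 := fun n p =>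
    norm_clm_mollify_le (φ n) hΩ hf''b (ContinuousLinearMap.id ℝ _) h2 b2 p
  have nbP : ∀ n p, ‖P (mollify (φ n) spaceTime f' p)‖ ≤ Kx E := fun n p =>
    norm_clm_mollify_le (φ n) hΩ hf'b P hK hPb p
  have hconv : Convex ℝ {p : ℝ × Plane | 0 ≤ p.1} :=
    (convex_Ici (0 : ℝ)).is_linear_preimage (f := fun p : ℝ × Plane => p.1)
      (IsLinearMap.mk (fun _ _ => rfl) (fun _ _ => rfl))
  have lip : ∀ n (p q : ℝ × Plane), 0 ≤ p.1 → 0 ≤ q.1 →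
      ‖mollify (φ n) spaceTime f' (q + a n) - mollify (φ n) spaceTime f' (p + a n)‖
        ≤ B2 * ‖q - p‖ := by
    intro n p q hp hq
    exact Convex.norm_image_sub_le_of_norm_hasFDerivWithin_le
      (f := fun p => mollify (φ n) spaceTime f' (p + a n)) (s := {p : ℝ × Plane | 0 ≤ p.1})
      (fun x hx => (hder2 n x hx).hasFDerivWithinAt) (fun x _ => nb2 n _) hconv hp hq
  have taylor : ∀ n (p q : ℝ × Plane), 0 ≤ p.1 → 0 ≤ q.1 →
      ‖mollify (φ n) spaceTime E (q + a n) - mollify (φ n) spaceTime E (p + a n)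
        - mollify (φ n) spaceTime f' (p + a n) (q - p)‖ ≤ B2 * ‖q - p‖ ^ 2 := by
    intro n p q hp hq
    have hseg : segment ℝ p q ⊆ {p : ℝ × Plane | 0 ≤ p.1} := hconv.segment_subset hp hq
    have := Convex.norm_image_sub_le_of_norm_hasFDerivWithin_le'
      (f := fun p => mollify (φ n) spaceTime E (p + a n)) (s := segment ℝ p q)
      (f' := fun p => mollify (φ n) spaceTime f' (p + a n))
      (φ := mollify (φ n) spaceTime f' (p + a n)) (C := B2 * ‖q - p‖)
      (fun x hx => (hder n x (hseg hx)).hasFDerivWithinAt) (fun x hx => ?_)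
      (convex_segment p q) (left_mem_segment ℝ p q) (right_mem_segment ℝ p q)
    · rw [pow_two, ← mul_assoc]
      exact this
    · refine (lip n p x hp (hseg hx)).trans ?_
      gcongr
      exact norm_sub_le_of_mem_segment hx
  have hto : Tendsto (fun n : ℕ => 1 / ((n : ℝ) + 1)) atTop (𝓝 0) :=
    tendsto_one_div_add_atTop_nhds_zero_nat
  have hEl : ∀ p : ℝ × Plane, 0 ≤ p.1 →
      Tendsto (fun n => mollify (φ n) spaceTime E (p + a n)) atTop (𝓝 (E p)) := by
    intro p hp
    refine tendsto_mollify (Ω' := {p : ℝ × Plane | 0 ≤ p.1}) hΩ (fun z (hz : 0 < z.1) => hz.le)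
      hE0 hto ?_ (fun n => Metric.ball_subset_closedBall.trans (hball n p hp)) (hcont p hp)
    have : Tendsto a atTop (𝓝 (0 : ℝ × Plane)) := by
      have h := (hto.const_mul 2).prodMk_nhds (tendsto_const_nhds (x := (0 : Plane)))
      rw [mul_zero] at h
      exact h
    simpa using this.const_add p
  obtain ⟨D, hD1, hD2⟩ := exists_deriv_of_tendsto_of_taylor (s := {p : ℝ × Plane | 0 ≤ p.1}) P
    (fun n p => nb1 n (p + a n)) (fun n p => nbP n (p + a n)) taylor lip hEl
  obtain ⟨B, hB1, hBK, hB⟩ : ∃ B : ℝ, 1 ≤ B ∧ Kx E ≤ B ∧ B0 ≤ B ∧ B1 ≤ B ∧ B2 ≤ B :=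
    ⟨1 + Kx E + B0 + B1 + B2, by linarith, by linarith, by linarith, by linarith, by linarith⟩
  refine ⟨B, D, hB1, hBK, fun p hp => ⟨?_, (hD1 p).1.trans hB.2.1, (hD1 p).2⟩,
    fun p q hp hq => ⟨?_, ?_⟩⟩
  · exact (le_of_tendsto' (hEl p hp).norm fun n => nb0 n _).trans hB.1
  · exact ((hD2 p q hp hq).1).trans (mul_le_mul_of_nonneg_right hB.2.2 (by positivity))
  · exact ((hD2 p q hp hq).2).trans (mul_le_mul_of_nonneg_right hB.2.2 (by positivity))

/-! ### Complex notation -/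

/-- The identification of the plane with `ℂ`. -/
noncomputable def toComplex : Plane ≃ₗᵢ[ℝ] ℂ := Complex.orthonormalBasisOneI.repr.symm

theorem toComplex_apply (v : Plane) : toComplex v = v 0 + v 1 * Complex.I := by
  have h := Complex.orthonormalBasisOneI.sum_repr_symm v
  rw [Fin.sum_univ_two] at h
  simp only [Complex.coe_orthonormalBasisOneI] at h
  rw [toComplex, ← h]
  simp

theorem toComplex_perp (v : Plane) : toComplex (perp v) = Complex.I * toComplex v := by
  rw [toComplex_apply, toComplex_apply]
  simp only [perp, PiLp.toLp_apply, Matrix.cons_val_zero, Matrix.cons_val_one]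
  push_cast
  linear_combination (v 1 : ℂ) * Complex.I_mul_I.symm

/-- The field in complex notation. -/
noncomputable def complexField (E : ℝ × Plane → Plane) (p : ℝ × ℂ) : ℂ :=
  toComplex (E (p.1, toComplex.symm p.2))

theorem toComplex_field (E : ℝ × Plane → Plane) (t : ℝ) (x : Plane) :
    toComplex (E (t, x)) = complexField E (t, toComplex x) := by
  simp [complexField]

/-- Quantitative bounds on a planar field and its derivative on nonnegative times. -/
structure FieldBounds (B K : ℝ) (e : ℝ × ℂ → ℂ) (D : ℝ × ℂ → ℝ × ℂ →L[ℝ] ℂ) : Prop where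
  one_le : 1 ≤ B
  K_nonneg : 0 ≤ K
  K_le : K ≤ B
  norm_le : ∀ p : ℝ × ℂ, 0 ≤ p.1 → ‖e p‖ ≤ B
  norm_deriv_le : ∀ p : ℝ × ℂ, 0 ≤ p.1 → ‖D p‖ ≤ B
  norm_deriv_inr_le : ∀ p : ℝ × ℂ, 0 ≤ p.1 → ∀ h, ‖D p (0, h)‖ ≤ K * ‖h‖
  taylor : ∀ p q : ℝ × ℂ, 0 ≤ p.1 → 0 ≤ q.1 → ‖e q - e p - D p (q - p)‖ ≤ B * ‖q - p‖ ^ 2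
  deriv_lip : ∀ p q : ℝ × ℂ, 0 ≤ p.1 → 0 ≤ q.1 → ‖D q - D p‖ ≤ B * ‖q - p‖

theorem FieldW2Infty.exists_fieldBounds {E : ℝ × Plane → Plane} (hE : FieldW2Infty E) :
    ∃ (B : ℝ) (D : ℝ × ℂ → ℝ × ℂ →L[ℝ] ℂ), FieldBounds B (Kx E) (complexField E) D := by
  obtain ⟨B, D, hB, hKB, h1, h2⟩ := hE.exists_deriv
  let M : ℝ × ℂ →L[ℝ] ℝ × Plane :=
    (ContinuousLinearMap.id ℝ ℝ).prodMap (toComplex.symm.toContinuousLinearEquiv : ℂ →L[ℝ] Plane)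
  have hM : ∀ p, M p = (p.1, toComplex.symm p.2) := fun p => rfl
  have hMn : ∀ p, ‖M p‖ = ‖p‖ := by
    intro p
    rw [hM, Prod.norm_def, Prod.norm_def]
    simp
  let D' : ℝ × ℂ → ℝ × ℂ →L[ℝ] ℂ := fun p =>
    ((toComplex.toContinuousLinearEquiv : Plane →L[ℝ] ℂ).comp (D (M p))).comp M
  have hD' : ∀ p h, D' p h = toComplex (D (M p) (M h)) := fun p h => rfl
  refine ⟨B, D', hB, ENNReal.toReal_nonneg, hKB, fun p hp => ?_, fun p hp => ?_, fun p hp h => ?_,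
    fun p q hp hq => ?_, fun p q hp hq => ?_⟩
  · rw [complexField, LinearIsometryEquiv.norm_map]
    exact (h1 (M p) hp).1
  · refine ContinuousLinearMap.opNorm_le_bound _ (by linarith) fun h => ?_
    rw [hD', LinearIsometryEquiv.norm_map, ← hMn h]
    exact (D (M p)).le_of_opNorm_le (h1 (M p) hp).2.1 _
  · rw [hD', LinearIsometryEquiv.norm_map, ← toComplex.symm.norm_map h]
    exact ContinuousLinearMap.le_of_opNorm_le _ (h1 (M p) hp).2.2 (toComplex.symm h)
  · have := (h2 (M p) (M q) hp hq).1
    rw [← map_sub, hMn] at this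
    rw [hD', complexField, complexField, ← map_sub, ← map_sub, LinearIsometryEquiv.norm_map]
    exact this
  · have := (h2 (M p) (M q) hp hq).2
    rw [← map_sub, hMn] at this
    refine ContinuousLinearMap.opNorm_le_bound _ (by
      have := norm_nonneg (q - p); positivity) fun h => ?_
    rw [sub_apply, hD', hD', ← map_sub, LinearIsometryEquiv.norm_map,
      ← sub_apply, ← hMn h]
    exact ContinuousLinearMap.le_of_opNorm_le _ this _

section FieldBounds

variable {B K : ℝ} {e : ℝ × ℂ → ℂ} {D : ℝ × ℂ → ℝ × ℂ →L[ℝ] ℂ}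

theorem FieldBounds.hasFDerivWithinAt (h : FieldBounds B K e D) {p : ℝ × ℂ} (hp : 0 ≤ p.1) :
    HasFDerivWithinAt e (D p) {q | 0 ≤ q.1} p := by
  refine HasFDerivWithinAt.of_isLittleO ?_
  refine Asymptotics.IsBigO.trans_isLittleO (g := fun q : ℝ × ℂ => ‖q - p‖ ^ 2) ?_ ?_
  · refine Asymptotics.IsBigO.of_bound B ?_
    filter_upwards [self_mem_nhdsWithin] with q hq
    simpa using h.taylor p q hp hq
  · refine Asymptotics.IsLittleO.mono ?_ nhdsWithin_le_nhds
    exact Asymptotics.isLittleO_norm_pow_id (one_lt_two) |>.comp_tendsto (tendsto_sub_nhds_zero_iff.2 tendsto_id)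

theorem FieldBounds.lip_time (h : FieldBounds B K e D) {s t : ℝ} (hs : 0 ≤ s) (ht : 0 ≤ t)
    (x : ℂ) : ‖e (t, x) - e (s, x)‖ ≤ B * |t - s| := by
  have hd : ∀ τ ∈ Set.Ici (0 : ℝ), HasDerivWithinAt (fun τ => e (τ, x)) (D (τ, x) (1, 0))
      (Set.Ici 0) τ := fun τ hτ =>
    (h.hasFDerivWithinAt (p := (τ, x)) hτ).comp_hasDerivWithinAt τ
      ((hasDerivWithinAt_id τ _).prodMk (hasDerivWithinAt_const τ _ x)) (fun _ hq => hq)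
  have := Convex.norm_image_sub_le_of_norm_hasDerivWithin_le (C := B) hd (fun τ hτ => ?_)
    (convex_Ici 0) hs ht
  · simpa using this
  · refine ((D (τ, x)).le_of_opNorm_le (h.norm_deriv_le (τ, x) hτ) _).trans ?_
    simp [Prod.norm_def]

theorem FieldBounds.lip_space (h : FieldBounds B K e D) {t : ℝ} (ht : 0 ≤ t) (x y : ℂ) :
    ‖e (t, y) - e (t, x)‖ ≤ K * ‖y - x‖ := by
  have hd : ∀ z ∈ (Set.univ : Set ℂ), HasFDerivWithinAt (fun z => e (t, z))
      ((D (t, z)).comp (ContinuousLinearMap.inr ℝ ℝ ℂ)) Set.univ z := fun z _ =>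
    (h.hasFDerivWithinAt (p := (t, z)) ht).comp z
      (hasFDerivAt_prodMk_right t z).hasFDerivWithinAt (fun _ _ => ht)
  refine Convex.norm_image_sub_le_of_norm_hasFDerivWithin_le hd (fun z _ => ?_) convex_univ
    (Set.mem_univ _) (Set.mem_univ _)
  exact ContinuousLinearMap.opNorm_le_bound _ h.K_nonneg fun v => h.norm_deriv_inr_le (t, z) ht v

/-- Time and position keep separate constants: the `K` part feeds the exponentials of the Gronwall
estimates, the `B` part the source terms. -/
theorem FieldBounds.lip (h : FieldBounds B K e D) {s t : ℝ} (hs : 0 ≤ s) (ht : 0 ≤ t) (x y : ℂ) :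
    ‖e (t, y) - e (s, x)‖ ≤ B * |t - s| + K * ‖y - x‖ := by
  have h1 := h.lip_time hs ht x
  have h2 := h.lip_space ht x y
  calc ‖e (t, y) - e (s, x)‖ = ‖(e (t, x) - e (s, x)) + (e (t, y) - e (t, x))‖ := by ring_nf
    _ ≤ _ := (norm_add_le _ _).trans (add_le_add h1 h2)

end FieldBounds

/-! ### The scheme in complex notation -/

/-- The algebra behind the choice of γ: it says γ(2 - γ) = 1/2, the condition for order two, and
also (2γ - 1)² = 2γ², from which the stability of the stiff part follows. -/
theorem gam_sq : gam ^ 2 = 2 * gam - 1 / 2 := by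
  have h : (1 / Real.sqrt 2) ^ 2 = 1 / 2 := by
    rw [div_pow, Real.sq_sqrt (by norm_num)]; norm_num
  rw [gam]
  linear_combination h

theorem gam_bounds : 1 / 4 < gam ∧ gam < 1 / 3 := by
  have h1 : (1 / Real.sqrt 2) ^ 2 = 1 / 2 := by
    rw [div_pow, Real.sq_sqrt (by norm_num)]; norm_num
  have h2 : 0 < 1 / Real.sqrt 2 := by positivity
  rw [gam]
  constructor <;> nlinarith

theorem div_two_gam (dt : ℝ) : dt / (2 * gam) = (2 - gam) * dt := by
  have h := gam_bounds.1
  rw [div_eq_iff (by linarith)]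
  linear_combination (2 * dt) * gam_sq

/-- One step of the scheme, of size `dt` from the time `t`, in complex notation, for the unknowns
`y` and `w = ε v` and with `lam = 1 / ε ^ 2`. -/
structure ImexStep (e : ℝ × ℂ → ℂ) (lam dt t : ℝ) (y w wt yh wh y' w' : ℂ) : Prop where
  wt_eq : wt = w + gam * dt * (e (t, y + Complex.I * w) - Complex.I * lam * wt)
  yh_eq : yh = y - Complex.I * ((2 - gam) * dt * e (t, y + Complex.I * wt))
  wh_eq : wh = w + (2 - gam) * dt * (e (t, y + Complex.I * w) - Complex.I * lam * wt)
  y'_eq : y' = y - Complex.I * (dt * ((1 - gam) * e (t, y + Complex.I * wt) +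
    gam * e (t + (2 - gam) * dt, yh + Complex.I * w')))
  w'_eq : w' = w + dt * ((1 - gam) * (e (t, y + Complex.I * w) - Complex.I * lam * wt) +
    gam * (e (t + (2 - gam) * dt, yh + Complex.I * wh) - Complex.I * lam * w'))

/-- The factor `1 + i γ λ Δt` of the linearly implicit stages. -/
noncomputable def implicitFactor (lam dt : ℝ) : ℂ := 1 + Complex.I * (gam * lam * dt : ℝ)

theorem implicitFactor_ne_zero (lam dt : ℝ) : implicitFactor lam dt ≠ 0 := by
  intro h
  have := congrArg Complex.re h
  simp [implicitFactor] at this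

/-- The stages are triangular in the order `wt`, `yh`, `wh`, `w'`, `y'`. Each implicit one is affine
in its unknown with the factor `implicitFactor`, of real part one. -/
theorem exists_imexStep (e : ℝ × ℂ → ℂ) (lam dt t : ℝ) (y w : ℂ) :
    ∃ wt yh wh y' w', ImexStep e lam dt t y w wt yh wh y' w' := by
  have hd := implicitFactor_ne_zero lam dt
  have key : ∀ c : ℂ, c / implicitFactor lam dt =
      c - gam * dt * (Complex.I * lam * (c / implicitFactor lam dt)) := by
    intro c
    field_simp
    rw [implicitFactor]
    push_cast
    ring
  set wt := (w + gam * dt * e (t, y + Complex.I * w)) / implicitFactor lam dt with hwt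
  set yh := y - Complex.I * ((2 - gam) * dt * e (t, y + Complex.I * wt)) with hyh
  set wh := w + (2 - gam) * dt * (e (t, y + Complex.I * w) - Complex.I * lam * wt) with hwh
  set w' := (w + dt * ((1 - gam) * (e (t, y + Complex.I * w) - Complex.I * lam * wt) +
    gam * e (t + (2 - gam) * dt, yh + Complex.I * wh))) / implicitFactor lam dt with hw'
  refine ⟨wt, yh, wh, _, w', ?_, hyh, hwh, rfl, ?_⟩
  · have := key (w + gam * dt * e (t, y + Complex.I * w))
    rw [← hwt] at this
    linear_combination this
  · have := key (w + dt * ((1 - gam) * (e (t, y + Complex.I * w) - Complex.I * lam * wt) +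
      gam * e (t + (2 - gam) * dt, yh + Complex.I * wh)))
    rw [← hw'] at this
    linear_combination this

theorem ImexStep.unique {e : ℝ × ℂ → ℂ} {lam dt t : ℝ}
    {y w wt yh wh y' w' wt₂ yh₂ wh₂ y'₂ w'₂ : ℂ}
    (h₁ : ImexStep e lam dt t y w wt yh wh y' w')
    (h₂ : ImexStep e lam dt t y w wt₂ yh₂ wh₂ y'₂ w'₂) :
    wt = wt₂ ∧ yh = yh₂ ∧ wh = wh₂ ∧ y' = y'₂ ∧ w' = w'₂ := by
  have hd := implicitFactor_ne_zero lam dt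
  have e1 : wt = wt₂ := by
    refine mul_left_cancel₀ hd ?_
    rw [implicitFactor]
    push_cast
    linear_combination h₁.wt_eq - h₂.wt_eq
  subst e1
  have e2 : yh = yh₂ := h₁.yh_eq.trans h₂.yh_eq.symm
  have e3 : wh = wh₂ := h₁.wh_eq.trans h₂.wh_eq.symm
  subst e2 e3
  have e4 : w' = w'₂ := by
    refine mul_left_cancel₀ hd ?_
    rw [implicitFactor]
    push_cast
    linear_combination h₁.w'_eq - h₂.w'_eq
  subst e4
  exact ⟨rfl, rfl, rfl, h₁.y'_eq.trans h₂.y'_eq.symm, rfl⟩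

theorem toComplex_Fy (E : ℝ × Plane → Plane) (t : ℝ) (yh w : Plane) :
    toComplex (Fy E t yh w) =
      -(Complex.I * complexField E (t, toComplex yh + Complex.I * toComplex w)) := by
  rw [Fy, map_neg, toComplex_perp, toComplex_field, map_add, toComplex_perp]

theorem toComplex_Fv (E : ℝ × Plane → Plane) (ε t : ℝ) (yh wh w : Plane) :
    toComplex (Fv E ε t yh wh w) = complexField E (t, toComplex yh + Complex.I * toComplex wh) -
      Complex.I * (1 / ε ^ 2 : ℝ) * toComplex w := by
  rw [Fv, map_sub, map_smul, toComplex_perp, toComplex_field, map_add, toComplex_perp,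
    Complex.real_smul]
  ring

/-- Used with s = ε for the velocity equations and s = 1 for those of the guiding center. -/
theorem smul_eq_iff_toComplex {r s : ℝ} (hr : r ≠ 0) (u v F : Plane) :
    (s / r) • (u - v) = F ↔ s * toComplex u = s * toComplex v + r * toComplex F := by
  have hr' : (r : ℂ) ≠ 0 := Complex.ofReal_ne_zero.2 hr
  rw [← toComplex.injective.eq_iff, map_smul, map_sub, Complex.real_smul]
  push_cast
  constructor
  · intro h
    rw [← h]
    field_simp
    ring
  · intro h
    field_simp
    linear_combination h

theorem solvesScheme_iff {E : ℝ × Plane → Plane} {ε dt : ℝ} (hdt : 0 < dt) {x₀ v₀ : Plane}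
    {T : Trajectory} : SolvesScheme E ε dt x₀ v₀ T ↔ T.y 0 = guidingCenter ε x₀ v₀ ∧ T.v 0 = v₀ ∧
      ∀ n : ℕ, ImexStep (complexField E) (1 / ε ^ 2) dt (n * dt) (toComplex (T.y n))
        (ε * toComplex (T.v n)) (ε * toComplex (T.vt n)) (toComplex (T.yh n))
        (ε * toComplex (T.vh n)) (toComplex (T.y (n + 1))) (ε * toComplex (T.v (n + 1))) := by
  have hg : gam ≠ 0 := (lt_trans (by norm_num) gam_bounds.1).ne'
  have h2 : (2 - gam) * dt ≠ 0 := mul_ne_zero (by linarith [gam_bounds.2]) hdt.ne'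
  constructor
  · intro h
    refine ⟨h.y_zero, h.v_zero, fun n => ?_⟩
    have a1 := (smul_eq_iff_toComplex (mul_ne_zero hg hdt.ne') _ _ _).1 (h.stage_vt n)
    have a2 := h.stage_yh n
    have a3 := h.stage_vh n
    have a4 := (smul_eq_iff_toComplex hdt.ne' _ _ _).1 (h.step_y n)
    have a5 := (smul_eq_iff_toComplex hdt.ne' _ _ _).1 (h.step_v n)
    rw [div_two_gam] at a2 a3 a4 a5
    replace a2 := (smul_eq_iff_toComplex h2 _ _ _).1 a2
    replace a3 := (smul_eq_iff_toComplex h2 _ _ _).1 a3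
    simp only [map_add, map_smul, toComplex_Fy, toComplex_Fv, Complex.real_smul] at a1 a2 a3 a4 a5
    push_cast at a1 a2 a3 a4 a5
    constructor
    · push_cast
      linear_combination a1
    · linear_combination a2
    · push_cast
      linear_combination a3
    · linear_combination a4
    · push_cast
      linear_combination a5
  · rintro ⟨h0, h1, h⟩
    refine ⟨h0, h1, fun n => ?_, fun n => ?_, fun n => ?_, fun n => ?_, fun n => ?_⟩
    · refine (smul_eq_iff_toComplex (mul_ne_zero hg hdt.ne') _ _ _).2 ?_
      have a := (h n).wt_eq
      simp only [map_smul, toComplex_Fv, Complex.real_smul]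
      push_cast at a ⊢
      linear_combination a
    · rw [div_two_gam]
      refine (smul_eq_iff_toComplex h2 _ _ _).2 ?_
      have a := (h n).yh_eq
      simp only [map_smul, toComplex_Fy, Complex.real_smul]
      push_cast at a ⊢
      linear_combination a
    · rw [div_two_gam]
      refine (smul_eq_iff_toComplex h2 _ _ _).2 ?_
      have a := (h n).wh_eq
      simp only [map_smul, toComplex_Fv, Complex.real_smul]
      push_cast at a ⊢
      linear_combination a
    · rw [div_two_gam]
      refine (smul_eq_iff_toComplex hdt.ne' _ _ _).2 ?_
      have a := (h n).y'_eq
      simp only [map_add, map_smul, toComplex_Fy, Complex.real_smul]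
      push_cast at a ⊢
      linear_combination a
    · rw [div_two_gam]
      refine (smul_eq_iff_toComplex hdt.ne' _ _ _).2 ?_
      have a := (h n).w'_eq
      simp only [map_add, map_smul, toComplex_Fv, Complex.real_smul]
      push_cast at a ⊢
      linear_combination a

/-- The scheme has exactly one solution. -/
theorem existsUnique_solvesScheme (E : ℝ × Plane → Plane) {ε dt : ℝ} (hε : 0 < ε) (hdt : 0 < dt)
    (x₀ v₀ : Plane) : ∃! T : Trajectory, SolvesScheme E ε dt x₀ v₀ T := by
  have hε' : (ε : ℂ) ≠ 0 := Complex.ofReal_ne_zero.2 hε.ne'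
  choose wt yh wh y' w' hstep using fun (n : ℕ) (p : ℂ × ℂ) =>
    exists_imexStep (complexField E) (1 / ε ^ 2) dt (n * dt) p.1 p.2
  let Z : ℕ → ℂ × ℂ := fun n => Nat.rec
    (toComplex (guidingCenter ε x₀ v₀), ε * toComplex v₀) (fun n p => (y' n p, w' n p)) n
  refine ⟨⟨fun n => toComplex.symm (Z n).1, fun n => toComplex.symm ((ε : ℂ)⁻¹ * (Z n).2),
    fun n => toComplex.symm ((ε : ℂ)⁻¹ * wt n (Z n)), fun n => toComplex.symm (yh n (Z n)),
    fun n => toComplex.symm ((ε : ℂ)⁻¹ * wh n (Z n))⟩, ?_, fun T hT => ?_⟩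
  · refine (solvesScheme_iff hdt).2 ⟨?_, ?_, fun n => ?_⟩
    · simp [Z]
    · simp [Z, hε']
    · simp only [LinearIsometryEquiv.apply_symm_apply, mul_inv_cancel_left₀ hε']
      exact hstep n (Z n)
  · obtain ⟨h0, h1, h⟩ := (solvesScheme_iff hdt).1 hT
    have hZ : ∀ n, (toComplex (T.y n), ε * toComplex (T.v n)) = Z n := by
      intro n
      induction n with
      | zero =>
        rw [h0, h1]
        rfl
      | succ n ih =>
        obtain ⟨-, -, -, e4, e5⟩ := (h n).unique
          (by have := hstep n (toComplex (T.y n), ε * toComplex (T.v n)); exact this)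
        rw [e4, e5, ih]
    have hu : ∀ n, _ := fun n => (h n).unique (hstep n (toComplex (T.y n), ε * toComplex (T.v n)))
    simp only [hZ] at hu
    have hy : ∀ n, toComplex (T.y n) = (Z n).1 := fun n => congrArg Prod.fst (hZ n)
    have hv : ∀ n, ε * toComplex (T.v n) = (Z n).2 := fun n => congrArg Prod.snd (hZ n)
    have hi : ∀ (v : Plane) (z : ℂ), ε * toComplex v = z → v = toComplex.symm ((ε : ℂ)⁻¹ * z) := by
      rintro v z rfl
      rw [inv_mul_cancel_left₀ hε', LinearIsometryEquiv.symm_apply_apply]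
    have hj : ∀ (v : Plane) (z : ℂ), toComplex v = z → v = toComplex.symm z := by
      rintro v z rfl
      rw [LinearIsometryEquiv.symm_apply_apply]
    ext1
    · exact funext fun n => hj _ _ (hy n)
    · exact funext fun n => hi _ _ (hv n)
    · exact funext fun n => hi _ _ (hu n).1
    · exact funext fun n => hj _ _ (hu n).2.1
    · exact funext fun n => hi _ _ (hu n).2.2.1

/-! ### The characteristic system in complex notation -/

/-- The characteristic system for the guiding center `y` and `w = ε v`. -/
structure IsFlow (e : ℝ × ℂ → ℂ) (lam : ℝ) (y w : ℝ → ℂ) : Prop where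
  deriv_y : ∀ t, 0 ≤ t →
    HasDerivWithinAt y (-(Complex.I * e (t, y t + Complex.I * w t))) (Set.Ici 0) t
  deriv_w : ∀ t, 0 ≤ t →
    HasDerivWithinAt w (e (t, y t + Complex.I * w t) - Complex.I * lam * w t) (Set.Ici 0) t

/-- Here x' = λ w and w' = e - iλ w, so in y' = x' - i w' the fast terms ±λ w cancel and only -i e
remains: the guiding center has bounded velocity. -/
theorem IsCharacteristic.isFlow {E : ℝ × Plane → Plane} {ε : ℝ} (hε : 0 < ε) {x₀ v₀ : Plane}
    {x v : ℝ → Plane} (h : IsCharacteristic E ε x₀ v₀ x v) :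
    IsFlow (complexField E) (1 / ε ^ 2) (fun t => toComplex (guidingCenter ε (x t) (v t)))
      (fun t => ε * toComplex (v t)) := by
  have hε' : (ε : ℂ) ≠ 0 := Complex.ofReal_ne_zero.2 hε.ne'
  have hgc : ∀ t, toComplex (guidingCenter ε (x t) (v t)) =
      toComplex (x t) - ε * (Complex.I * toComplex (v t)) := fun t => by
    rw [guidingCenter, map_sub, map_smul, toComplex_perp, Complex.real_smul]
  have hpos : ∀ t, toComplex (guidingCenter ε (x t) (v t)) + Complex.I * (ε * toComplex (v t)) =
      toComplex (x t) := fun t => by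
    rw [hgc]; ring
  have hd : ∀ (u : ℝ → Plane) (a : Plane) (t : ℝ), HasDerivWithinAt u a (Set.Ici 0) t →
      HasDerivWithinAt (fun t => toComplex (u t)) (toComplex a) (Set.Ici 0) t := fun u a t hu =>
    (toComplex.toContinuousLinearEquiv : Plane →L[ℝ] ℂ).hasFDerivAt.comp_hasDerivWithinAt t hu
  have hb : ∀ t, 0 ≤ t → ∃ b : ℂ, HasDerivWithinAt (fun t => toComplex (v t)) b (Set.Ici 0) t ∧
      ε * b = complexField E (t, toComplex (x t)) - (1 / ε ^ 2 : ℝ) * Complex.I *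
        (ε * toComplex (v t)) := by
    intro t ht
    obtain ⟨b, hb, hb'⟩ := h.deriv_v t ht
    refine ⟨_, hd _ _ _ hb, ?_⟩
    have := congrArg toComplex hb'
    rw [map_smul, map_sub, map_smul, toComplex_perp, toComplex_field, Complex.real_smul,
      Complex.real_smul] at this
    rw [this]
    push_cast
    field_simp
  constructor
  · intro t ht
    obtain ⟨a, ha, ha'⟩ := h.deriv_x t ht
    obtain ⟨b, hb, hb'⟩ := hb t ht
    have ha2 := congrArg toComplex ha'
    rw [map_smul, Complex.real_smul] at ha2
    simp only [hpos]
    simp only [hgc]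
    refine ((hd _ _ _ ha).sub ((hb.const_mul Complex.I).const_mul (ε : ℂ))).congr_deriv ?_
    refine mul_left_cancel₀ hε' ?_
    have : toComplex a = (ε : ℂ)⁻¹ * toComplex (v t) := by
      rw [← ha2, inv_mul_cancel_left₀ hε']
    rw [this]
    push_cast at hb'
    have hI := Complex.I_sq
    field_simp at hb' ⊢
    linear_combination (-Complex.I) * hb' + toComplex (v t) * hI
  · intro t ht
    obtain ⟨b, hb, hb'⟩ := hb t ht
    simp only [hpos]
    refine (hb.const_mul (ε : ℂ)).congr_deriv ?_
    rw [hb']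
    ring

/-! ### Gronwall bounds -/

/-- The inequality e^s - 1 ≤ s e^s removes the division by `K`, so the bound is uniform as `K` tends
to 0 and includes K = 0. -/
theorem gronwallBound_le {δ K r x : ℝ} (hK : 0 ≤ K) (hr : 0 ≤ r) :
    gronwallBound δ K r x ≤ Real.exp (K * x) * (δ + r * x) := by
  rcases hK.eq_or_lt with rfl | hK
  · simp [gronwallBound_K0]
  · rw [gronwallBound_of_K_ne_0 hK.ne']
    have h1 : Real.exp (K * x) - 1 ≤ K * x * Real.exp (K * x) := by
      have h2 := Real.add_one_le_exp (-(K * x))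
      have h3 : Real.exp (-(K * x)) * Real.exp (K * x) = 1 := by
        rw [← Real.exp_add]; simp
      nlinarith [Real.exp_pos (K * x)]
    have h4 : r / K * (Real.exp (K * x) - 1) ≤ r / K * (K * x * Real.exp (K * x)) := by gcongr
    have h5 : r / K * (K * x * Real.exp (K * x)) = r * x * Real.exp (K * x) := by
      field_simp
    linarith

theorem discrete_gronwall {a : ℕ → ℝ} {c r : ℝ} (hc : 0 ≤ c) (hr : 0 ≤ r) {N : ℕ}
    (h : ∀ n < N, a (n + 1) ≤ Real.exp c * (a n + r)) :
    ∀ n ≤ N, a n ≤ Real.exp (c * n) * (a 0 + n * r) := by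
  intro n
  induction n with
  | zero => simp
  | succ n ih =>
    intro hn
    have h1 := h n hn
    have h2 := ih (by omega)
    have h3 : r ≤ Real.exp (c * n) * r := le_mul_of_one_le_left hr (Real.one_le_exp (by positivity))
    calc a (n + 1) ≤ Real.exp c * (a n + r) := h1
      _ ≤ Real.exp c * (Real.exp (c * n) * (a 0 + n * r) + Real.exp (c * n) * r) := by gcongr
      _ = Real.exp (c * n) * Real.exp c * (a 0 + (n + 1) * r) := by ring
      _ = Real.exp (c * (n + 1 : ℕ)) * (a 0 + (n + 1 : ℕ) * r) := by
        rw [← Real.exp_add]; push_cast; ring_nf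

/-! ### The linear part of the velocity stages -/

theorem norm_I_mul_ofReal (r : ℝ) (z : ℂ) : ‖Complex.I * (r * z)‖ = |r| * ‖z‖ := by simp

theorem norm_implicitFactor_sq (lam dt : ℝ) :
    ‖implicitFactor lam dt‖ ^ 2 = 1 + (gam * lam * dt) ^ 2 := by
  rw [implicitFactor, ← Complex.normSq_eq_norm_sq, Complex.normSq_apply]
  simp
  ring

theorem one_le_norm_implicitFactor (lam dt : ℝ) : 1 ≤ ‖implicitFactor lam dt‖ := by
  have := norm_implicitFactor_sq lam dt
  nlinarith [norm_nonneg (implicitFactor lam dt), sq_nonneg (gam * lam * dt)]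

theorem le_norm_implicitFactor (lam dt : ℝ) : gam * lam * dt ≤ ‖implicitFactor lam dt‖ :=
  le_of_sq_le_sq (by rw [norm_implicitFactor_sq]; linarith) (norm_nonneg _)

/-- The velocity stages of the scheme with frozen forces `g₀`, `g₁`. -/
structure LinearStages (lam dt : ℝ) (w wt wh w' g₀ g₁ : ℂ) : Prop where
  wt_eq : wt = w + gam * dt * (g₀ - Complex.I * lam * wt)
  wh_eq : wh = w + (2 - gam) * dt * (g₀ - Complex.I * lam * wt)
  w'_eq : w' = w + dt * ((1 - gam) * (g₀ - Complex.I * lam * wt) +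
    gam * (g₁ - Complex.I * lam * w'))

theorem ImexStep.linearStages {e : ℝ × ℂ → ℂ} {lam dt t : ℝ} {y w wt yh wh y' w' : ℂ}
    (h : ImexStep e lam dt t y w wt yh wh y' w') :
    LinearStages lam dt w wt wh w' (e (t, y + Complex.I * w))
      (e (t + (2 - gam) * dt, yh + Complex.I * wh)) :=
  ⟨h.wt_eq, h.wh_eq, h.w'_eq⟩

namespace LinearStages

variable {lam dt : ℝ} {w wt wh w' g₀ g₁ : ℂ}

theorem sub (h : LinearStages lam dt w wt wh w' g₀ g₁) {v vt vh v' f₀ f₁ : ℂ}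
    (h' : LinearStages lam dt v vt vh v' f₀ f₁) :
    LinearStages lam dt (w - v) (wt - vt) (wh - vh) (w' - v') (g₀ - f₀) (g₁ - f₁) := by
  constructor
  · linear_combination h.wt_eq - h'.wt_eq
  · linear_combination h.wh_eq - h'.wh_eq
  · linear_combination h.w'_eq - h'.w'_eq

/-- Under a constant force `c` the point -i c/λ is at rest for all stages. Measuring w from it
replaces the forces by their deviations from `c`, which are small when `c` is the current field. -/
theorem add_equilibrium (h : LinearStages lam dt w wt wh w' g₀ g₁) (hlam : lam ≠ 0) (c : ℂ) :
    LinearStages lam dt (w + Complex.I * c / lam) (wt + Complex.I * c / lam)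
      (wh + Complex.I * c / lam) (w' + Complex.I * c / lam) (g₀ - c) (g₁ - c) := by
  have hl : (lam : ℂ) ≠ 0 := Complex.ofReal_ne_zero.2 hlam
  have key : Complex.I * lam * (Complex.I * c / lam) = -c := by
    field_simp
    linear_combination c * Complex.I_sq
  constructor
  · linear_combination h.wt_eq + gam * dt * key
  · linear_combination h.wh_eq + (2 - gam) * dt * key
  · linear_combination h.w'_eq + dt * key

theorem factor_mul_wt (h : LinearStages lam dt w wt wh w' g₀ g₁) :
    implicitFactor lam dt * wt = w + gam * dt * g₀ := by
  rw [implicitFactor]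
  push_cast
  linear_combination h.wt_eq

theorem norm_wt_le (h : LinearStages lam dt w wt wh w' g₀ g₁) (hdt : 0 ≤ dt) :
    ‖wt‖ ≤ ‖w‖ + dt * ‖g₀‖ := by
  have h1 := congrArg norm h.factor_mul_wt
  rw [norm_mul] at h1
  have h2 : ‖w + gam * dt * g₀‖ ≤ ‖w‖ + gam * dt * ‖g₀‖ := by
    refine (norm_add_le _ _).trans_eq ?_
    rw [norm_mul, norm_mul, Complex.norm_of_nonneg hdt,
      Complex.norm_of_nonneg (by linarith [gam_bounds.1])]
  have h3 := one_le_norm_implicitFactor lam dt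
  have h4 : gam * dt * ‖g₀‖ ≤ 1 * dt * ‖g₀‖ := by
    gcongr
    linarith [gam_bounds.2]
  nlinarith [norm_nonneg wt]

/-- The explicit stage contains the stiff term λ `wt`, with no damping. The first stage has the same
slope, equal to (wt - w)/(γ dt), so the slope can be eliminated and λ disappears; γ > 1/4 makes the
ratio (2 - γ)/γ at most 7. -/
theorem norm_wh_le (h : LinearStages lam dt w wt wh w' g₀ g₁) (hdt : 0 ≤ dt) :
    ‖wh‖ ≤ 15 * ‖w‖ + 7 * (dt * ‖g₀‖) := by
  have hg := gam_bounds
  have hg0 : (gam : ℂ) ≠ 0 := Complex.ofReal_ne_zero.2 (by linarith)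
  have h1 : wh = w + ((2 - gam) / gam : ℝ) * (wt - w) := by
    push_cast
    field_simp
    linear_combination gam * h.wh_eq - (2 - gam) * h.wt_eq
  have h2 : |(2 - gam) / gam| ≤ 7 := by
    rw [abs_of_nonneg (div_nonneg (by linarith) (by linarith)), div_le_iff₀ (by linarith)]
    linarith
  have h3 : ‖wt - w‖ ≤ ‖w‖ + dt * ‖g₀‖ + ‖w‖ :=
    (norm_sub_le _ _).trans (by linarith [h.norm_wt_le hdt])
  rw [h1]
  refine (norm_add_le _ _).trans ?_
  rw [norm_mul, Complex.norm_real, Real.norm_eq_abs]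
  have := mul_le_mul h2 h3 (norm_nonneg _) (by norm_num)
  linarith

/-- The stability of the velocity step: the amplification factor is at most one in modulus, and a
part `dt * c₁` of the second force is damped by the stiff term. -/
theorem norm_w'_le (h : LinearStages lam dt w wt wh w' g₀ g₁) (hlam : 0 < lam) (hdt : 0 ≤ dt)
    {c₀ c₁ : ℝ} (hc₀ : 0 ≤ c₀) (hc₁ : 0 ≤ c₁) (hg : ‖g₁‖ ≤ c₀ + dt * c₁) :
    ‖w'‖ ≤ ‖w‖ + dt * ‖g₀‖ + dt * c₀ + dt * (c₁ / lam) := by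
  set d := implicitFactor lam dt with hd
  have hgam := gam_bounds
  -- Eliminating `wt` exhibits the amplification factor (1 + i(2γ - 1)λ dt)/d² of `w`.
  have h1 : d * (d * w') = (1 + Complex.I * ((2 * gam - 1) * lam * dt : ℝ)) * w +
      ((1 - gam) * dt : ℝ) * g₀ + d * ((gam * dt : ℝ) * g₁) := by
    have e1 : d * w' = w + (1 - gam) * dt * (g₀ - Complex.I * lam * wt) + gam * dt * g₁ := by
      rw [hd, implicitFactor]
      push_cast
      linear_combination h.w'_eq
    have e2 := h.factor_mul_wt
    rw [← hd] at e2
    rw [e1]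
    push_cast
    have e3 : d = 1 + Complex.I * (gam * lam * dt : ℝ) := rfl
    push_cast at e3
    linear_combination (-(1 - gam) * dt * Complex.I * lam) * e2 + (w + (1 - gam) * dt * g₀) * e3
  -- With θ = γλ dt and (2γ - 1)² = 2γ², the squared modulus is 1 + 2θ² ≤ (1 + θ²)² = ‖d‖⁴.
  have h2 : ‖(1 + Complex.I * ((2 * gam - 1) * lam * dt : ℝ) : ℂ)‖ ≤ ‖d‖ ^ 2 := by
    refine le_of_sq_le_sq ?_ (by positivity)
    rw [hd, norm_implicitFactor_sq, ← Complex.normSq_eq_norm_sq, Complex.normSq_apply]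
    simp only [Complex.add_re, Complex.one_re, Complex.mul_re, Complex.I_re, Complex.ofReal_re,
      Complex.I_im, Complex.ofReal_im, Complex.add_im, Complex.one_im, Complex.mul_im]
    have e : (2 * gam - 1) ^ 2 = 2 * gam ^ 2 := by linarith [gam_sq]
    have e' : ((2 * gam - 1) * lam * dt) ^ 2 = 2 * (gam * lam * dt) ^ 2 := by
      calc ((2 * gam - 1) * lam * dt) ^ 2 = (2 * gam - 1) ^ 2 * (lam * dt) ^ 2 := by ring
        _ = _ := by rw [e]; ring
    nlinarith [sq_nonneg ((gam * lam * dt) ^ 2)]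
  have hd1 : 1 ≤ ‖d‖ := one_le_norm_implicitFactor lam dt
  have hd2 : gam * lam * dt ≤ ‖d‖ := le_norm_implicitFactor lam dt
  have h3 := congrArg norm h1
  rw [norm_mul, norm_mul] at h3
  have h4 : ‖d‖ * (‖d‖ * ‖w'‖) ≤ ‖d‖ ^ 2 * ‖w‖ + (1 - gam) * dt * ‖g₀‖ +
      ‖d‖ * (gam * dt * ‖g₁‖) := by
    rw [h3]
    refine (norm_add_le _ _).trans (add_le_add ((norm_add_le _ _).trans (add_le_add ?_ ?_)) ?_)
    · rw [norm_mul]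
      gcongr
    · rw [norm_mul, Complex.norm_of_nonneg (mul_nonneg (by linarith) hdt)]
    · rw [norm_mul, norm_mul, Complex.norm_of_nonneg (mul_nonneg (by linarith) hdt)]
  have h5 : (1 - gam) * dt * ‖g₀‖ ≤ ‖d‖ ^ 2 * (dt * ‖g₀‖) := by
    have : (1 - gam) * (dt * ‖g₀‖) ≤ ‖d‖ ^ 2 * (dt * ‖g₀‖) := by
      gcongr
      nlinarith
    linarith
  -- The implicit solve divides the second force by `d`, and ‖d‖ ≥ γλ dt: one power of `dt` is
  -- traded for 1/λ.
  have h6 : gam * dt * ‖g₁‖ ≤ ‖d‖ * (dt * c₀ + dt * (c₁ / lam)) := by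
    calc gam * dt * ‖g₁‖ ≤ gam * dt * (c₀ + dt * c₁) := by
          have : 0 ≤ gam * dt := mul_nonneg (by linarith) hdt
          gcongr
      _ = gam * (dt * c₀) + (gam * lam * dt) * (dt * (c₁ / lam)) := by field_simp
      _ ≤ ‖d‖ * (dt * c₀) + ‖d‖ * (dt * (c₁ / lam)) := by
          gcongr
          linarith
      _ = _ := by ring
  have h7 : ‖d‖ ^ 2 * ‖w'‖ ≤ ‖d‖ ^ 2 * (‖w‖ + dt * ‖g₀‖ + dt * c₀ + dt * (c₁ / lam)) := by
    have : ‖d‖ * (gam * dt * ‖g₁‖) ≤ ‖d‖ * (‖d‖ * (dt * c₀ + dt * (c₁ / lam))) := by gcongr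
    nlinarith
  exact le_of_mul_le_mul_left h7 (by positivity)

end LinearStages

/-! ### Stability of one step and a priori bounds on the discrete velocity -/

section

variable {B K lam dt t : ℝ} {e : ℝ × ℂ → ℂ} {D : ℝ × ℂ → ℝ × ℂ →L[ℝ] ℂ}
  {y w wt yh wh y' w' : ℂ}

theorem norm_I_mul_sub (a b c d : ℂ) :
    ‖(a + Complex.I * b) - (c + Complex.I * d)‖ ≤ ‖a - c‖ + ‖b - d‖ := by
  have : (a + Complex.I * b) - (c + Complex.I * d) = (a - c) + Complex.I * (b - d) := by ring
  rw [this]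
  refine (norm_add_le _ _).trans_eq ?_
  rw [norm_mul, Complex.norm_I, one_mul]

theorem FieldBounds.lip_position (hE : FieldBounds B K e D) (ht : 0 ≤ t) (y w z v : ℂ) :
    ‖e (t, y + Complex.I * w) - e (t, z + Complex.I * v)‖ ≤ K * (‖y - z‖ + ‖w - v‖) :=
  (hE.lip_space ht _ _).trans (mul_le_mul_of_nonneg_left (norm_I_mul_sub _ _ _ _) hE.K_nonneg)

/-- One step of the scheme amplifies perturbations by a factor independent of the stiffness. -/
theorem ImexStep.stability (hE : FieldBounds B K e D) (hlam : 0 < lam) (hdt : 0 ≤ dt)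
    (ht : 0 ≤ t) (h : ImexStep e lam dt t y w wt yh wh y' w')
    {z v vt zh vh z' v' : ℂ} (h₂ : ImexStep e lam dt t z v vt zh vh z' v') :
    ‖y' - z'‖ + ‖w' - v'‖ ≤ Real.exp (35 * (K * dt)) * (‖y - z‖ + ‖w - v‖) := by
  have hγ := gam_bounds
  have hL := h.linearStages.sub h₂.linearStages
  have ht' : 0 ≤ t + (2 - gam) * dt := add_nonneg ht (mul_nonneg (by linarith) hdt)
  have hK := hE.K_nonneg
  set a := K * dt with ha
  have ha0 : 0 ≤ a := mul_nonneg hK hdt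
  set A := Real.exp a with hA
  have hA1 : 1 + a ≤ A := by rw [hA]; linarith [Real.add_one_le_exp a]
  set N := ‖y - z‖ + ‖w - v‖ with hN
  have hy0 := norm_nonneg (y - z)
  have hw0 := norm_nonneg (w - v)
  have hN0 : 0 ≤ N := by positivity
  have g0 : dt * ‖e (t, y + Complex.I * w) - e (t, z + Complex.I * v)‖ ≤ a * N := by
    calc _ ≤ dt * (K * N) := by gcongr; exact hE.lip_position ht _ _ _ _
      _ = a * N := by ring
  have bwt : ‖wt - vt‖ ≤ A * N := by
    have := hL.norm_wt_le hdt
    nlinarith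
  have byh' : ‖yh - zh‖ ≤ ‖y - z‖ + 2 * dt * (K * (‖y - z‖ + ‖wt - vt‖)) := by
    have : yh - zh = (y - z) - Complex.I * (((2 - gam) * dt : ℝ) *
        (e (t, y + Complex.I * wt) - e (t, z + Complex.I * vt))) := by
      rw [h.yh_eq, h₂.yh_eq]; push_cast; ring
    rw [this]
    refine (norm_sub_le _ _).trans ?_
    rw [norm_I_mul_ofReal, abs_of_nonneg (mul_nonneg (by linarith) hdt)]
    gcongr
    · linarith
    · exact hE.lip_position ht _ _ _ _
  have byh : ‖yh - zh‖ ≤ 5 * A ^ 2 * N := by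
    have e1 : 2 * dt * (K * (‖y - z‖ + ‖wt - vt‖)) ≤ 2 * a * (N + A * N) := by
      calc _ = 2 * a * (‖y - z‖ + ‖wt - vt‖) := by ring
        _ ≤ _ := by gcongr; linarith
    have e2 : 2 * a * (N + A * N) ≤ 4 * A * A * N := by
      have : a * (1 + A) ≤ A * (2 * A) := by gcongr <;> linarith
      nlinarith
    have e3 : N ≤ A ^ 2 * N := le_mul_of_one_le_left hN0 (by nlinarith)
    nlinarith
  have bwh : ‖wh - vh‖ ≤ 15 * A * N := by
    have := hL.norm_wh_le hdt
    nlinarith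
  have bg1 : ‖e (t + (2 - gam) * dt, yh + Complex.I * wh) -
      e (t + (2 - gam) * dt, zh + Complex.I * vh)‖ ≤ K * (20 * A ^ 2 * N) := by
    refine (hE.lip_position ht' _ _ _ _).trans ?_
    have : 15 * A * N ≤ 15 * A ^ 2 * N := by
      gcongr
      nlinarith
    gcongr
    linarith
  have bw' : ‖w' - v'‖ ≤ ‖w - v‖ + 21 * a * A ^ 2 * N := by
    have := hL.norm_w'_le hlam hdt (c₀ := K * (20 * A ^ 2 * N)) (c₁ := 0) (by positivity) le_rfl
      (by simpa using bg1)
    have e1 : dt * (K * (20 * A ^ 2 * N)) = 20 * a * A ^ 2 * N := by ring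
    have e2 : a * N ≤ a * A ^ 2 * N := by
      gcongr
      exact le_mul_of_one_le_right ha0 (by nlinarith)
    simp only [zero_div, mul_zero] at this
    linarith
  have by' : ‖y' - z'‖ ≤ ‖y - z‖ + dt * ((1 - gam) * (K * (‖y - z‖ + ‖wt - vt‖)) +
      gam * (K * (‖yh - zh‖ + ‖w' - v'‖))) := by
    have : y' - z' = (y - z) - Complex.I * ((dt : ℝ) *
        ((1 - gam : ℝ) * (e (t, y + Complex.I * wt) - e (t, z + Complex.I * vt)) +
        (gam : ℝ) * (e (t + (2 - gam) * dt, yh + Complex.I * w') -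
          e (t + (2 - gam) * dt, zh + Complex.I * v')))) := by
      rw [h.y'_eq, h₂.y'_eq]; push_cast; ring
    rw [this]
    refine (norm_sub_le _ _).trans ?_
    rw [norm_I_mul_ofReal, abs_of_nonneg hdt]
    gcongr
    refine (norm_add_le _ _).trans ?_
    rw [norm_mul, norm_mul, Complex.norm_of_nonneg (by linarith : (0 : ℝ) ≤ 1 - gam),
      Complex.norm_of_nonneg (by linarith : (0 : ℝ) ≤ gam)]
    have := hE.lip_position ht y wt z vt
    have := hE.lip_position ht' yh w' zh v'
    gcongr <;> linarith
  have hA1' : 1 ≤ A := by linarith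
  have bin : (1 - gam) * (‖y - z‖ + ‖wt - vt‖) + gam * (‖yh - zh‖ + ‖w' - v'‖) ≤
      11 * A ^ 3 * N := by
    have e1 : ‖y - z‖ + ‖wt - vt‖ ≤ 2 * (A ^ 3 * N) := by
      have : N ≤ A ^ 3 * N := le_mul_of_one_le_left hN0 (one_le_pow₀ hA1')
      have : A * N ≤ A ^ 3 * N := by
        gcongr
        exact le_self_pow₀ hA1' (by norm_num)
      linarith
    have e2 : ‖yh - zh‖ + ‖w' - v'‖ ≤ 27 * (A ^ 3 * N) := by
      have : N ≤ A ^ 3 * N := le_mul_of_one_le_left hN0 (one_le_pow₀ hA1')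
      have : A ^ 2 * N ≤ A ^ 3 * N := by
        gcongr
        norm_num
      have : a * A ^ 2 * N ≤ A ^ 3 * N := by
        have : a * A ^ 2 * N ≤ A * A ^ 2 * N := by
          gcongr
          linarith
        nlinarith
      linarith
    have e0 : 0 ≤ A ^ 3 * N := by positivity
    have e3 : (1 - gam) * (‖y - z‖ + ‖wt - vt‖) ≤ 1 * (2 * (A ^ 3 * N)) := by
      gcongr
      linarith
    have e4 : gam * (‖yh - zh‖ + ‖w' - v'‖) ≤ 1 / 3 * (27 * (A ^ 3 * N)) := by
      gcongr
      linarith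
    linarith
  have by2 : ‖y' - z'‖ ≤ ‖y - z‖ + 11 * a * A ^ 3 * N := by
    refine by'.trans ?_
    have : dt * ((1 - gam) * (K * (‖y - z‖ + ‖wt - vt‖)) + gam * (K * (‖yh - zh‖ + ‖w' - v'‖))) =
      a * ((1 - gam) * (‖y - z‖ + ‖wt - vt‖) + gam * (‖yh - zh‖ + ‖w' - v'‖)) := by ring
    rw [this]
    have := mul_le_mul_of_nonneg_left bin ha0
    linarith
  have e5 : a * A ^ 2 * N ≤ a * A ^ 3 * N := by
    gcongr
    norm_num
  -- Here 35 = 3 + 32: three factors `A` come from the nested stages, and 1 + 32a is bounded by an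
  -- exponential.
  calc ‖y' - z'‖ + ‖w' - v'‖ ≤ N + 32 * a * A ^ 3 * N := by linarith
    _ ≤ A ^ 3 * N + 32 * a * A ^ 3 * N := by
        gcongr
        exact le_mul_of_one_le_left hN0 (one_le_pow₀ hA1')
    _ = A ^ 3 * (32 * a + 1) * N := by ring
    _ ≤ A ^ 3 * Real.exp (32 * a) * N := by
        gcongr
        exact Real.add_one_le_exp _
    _ = Real.exp (35 * a) * N := by
        rw [hA, ← Real.exp_nat_mul, ← Real.exp_add]
        push_cast
        ring_nf

theorem FieldBounds.B_nonneg (hE : FieldBounds B K e D) : 0 ≤ B := zero_le_one.trans hE.one_le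

theorem ImexStep.norm_yh_sub_le (hE : FieldBounds B K e D) (hdt : 0 ≤ dt) (ht : 0 ≤ t)
    (h : ImexStep e lam dt t y w wt yh wh y' w') : ‖yh - y‖ ≤ 2 * dt * B := by
  have hγ := gam_bounds
  have : yh - y = -(Complex.I * (((2 - gam) * dt : ℝ) * e (t, y + Complex.I * wt))) := by
    rw [h.yh_eq]; push_cast; ring
  rw [this, norm_neg, norm_I_mul_ofReal, abs_of_nonneg (mul_nonneg (by linarith) hdt)]
  have := hE.norm_le (t, y + Complex.I * wt) ht
  have := hE.B_nonneg
  gcongr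
  linarith

theorem ImexStep.norm_y'_sub_le (hE : FieldBounds B K e D) (hdt : 0 ≤ dt) (ht : 0 ≤ t)
    (h : ImexStep e lam dt t y w wt yh wh y' w') : ‖y' - y‖ ≤ B * dt := by
  have hγ := gam_bounds
  have ht' : 0 ≤ t + (2 - gam) * dt := add_nonneg ht (mul_nonneg (by linarith) hdt)
  have : y' - y = -(Complex.I * ((dt : ℝ) * ((1 - gam : ℝ) * e (t, y + Complex.I * wt) +
      (gam : ℝ) * e (t + (2 - gam) * dt, yh + Complex.I * w')))) := by
    rw [h.y'_eq]; push_cast; ring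
  rw [this, norm_neg, norm_I_mul_ofReal, abs_of_nonneg hdt, mul_comm]
  gcongr
  refine (norm_add_le _ _).trans ?_
  rw [norm_mul, norm_mul, Complex.norm_of_nonneg (by linarith : (0 : ℝ) ≤ 1 - gam),
    Complex.norm_of_nonneg (by linarith : (0 : ℝ) ≤ gam)]
  have := hE.norm_le (t, y + Complex.I * wt) ht
  have := hE.norm_le (t + (2 - gam) * dt, yh + Complex.I * w') ht'
  nlinarith

/-- Growth over one step of the deviation of `w` from the equilibrium `-i e / λ`, and a bound on
the intermediate stage. -/
theorem ImexStep.norm_deviation_le (hE : FieldBounds B K e D) (hlam : 0 < lam) (hdt : 0 ≤ dt)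
    (ht : 0 ≤ t) (h : ImexStep e lam dt t y w wt yh wh y' w') :
    ‖w' + Complex.I * e (t + dt, y') / lam‖ ≤
      Real.exp (16 * (K * dt)) * (‖w + Complex.I * e (t, y) / lam‖ + dt * (8 * B ^ 2 / lam)) ∧
    ‖wt‖ ≤ Real.exp (K * dt) * (‖w + Complex.I * e (t, y) / lam‖ + B / lam) := by
  have hγ := gam_bounds
  have hB := hE.one_le
  have hB0 := hE.B_nonneg
  have hK := hE.K_nonneg
  have ht' : 0 ≤ t + (2 - gam) * dt := add_nonneg ht (mul_nonneg (by linarith) hdt)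
  -- The force is frozen at the guiding center, so that `u` is the deviation from equilibrium at the
  -- start of the step.
  set c := e (t, y) with hc
  set u := w + Complex.I * c / lam with hu
  have hL := h.linearStages.add_equilibrium hlam.ne' c
  rw [← hu] at hL
  have hs : ∀ c : ℂ, ‖c‖ ≤ B → ‖Complex.I * c / lam‖ ≤ B / lam := by
    intro c hc
    rw [norm_div, norm_mul, Complex.norm_I, one_mul, Complex.norm_of_nonneg hlam.le]
    gcongr
  have hcs : ‖Complex.I * c / lam‖ ≤ B / lam := hs c (hE.norm_le _ ht)
  set s := Complex.I * c / lam with hsdef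
  set m := B / lam with hm
  have hm0 : 0 ≤ m := by positivity
  set a := K * dt with ha
  have ha0 : 0 ≤ a := mul_nonneg hK hdt
  set A := Real.exp a with hA
  have hA1 : 1 + a ≤ A := by rw [hA]; linarith [Real.add_one_le_exp a]
  have hun := norm_nonneg u
  have back : ∀ v : ℂ, ‖v‖ ≤ ‖v + s‖ + m := by
    intro v
    calc ‖v‖ = ‖(v + s) - s‖ := by ring_nf
      _ ≤ ‖v + s‖ + ‖s‖ := norm_sub_le _ _
      _ ≤ _ := by gcongr
  have hw : ‖w‖ ≤ ‖u‖ + m := back w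
  have g0 : dt * ‖e (t, y + Complex.I * w) - c‖ ≤ a * (‖u‖ + m) := by
    have h1 : ‖e (t, y + Complex.I * w) - c‖ ≤ K * ‖w‖ := by
      simpa using hE.lip_space ht y (y + Complex.I * w)
    calc _ ≤ dt * (K * (‖u‖ + m)) := by gcongr; exact h1.trans (by gcongr)
      _ = _ := by ring
  constructor
  · have bwh : ‖wh‖ ≤ 15 * ‖u‖ + 7 * (a * (‖u‖ + m)) + m := by
      refine (back wh).trans ?_
      have := hL.norm_wh_le hdt
      linarith
    -- Split as `norm_w'_le` requires. The part in `K` goes into the growth factor; the change of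
    -- time and of `yh` contributes dt · 4B², which damping turns into a source dt · 4B²/λ, of the
    -- order of the equilibrium, instead of dt² · 4B².
    have g1 : ‖e (t + (2 - gam) * dt, yh + Complex.I * wh) - c‖ ≤
        K * (15 * ‖u‖ + 7 * (a * (‖u‖ + m)) + m) + dt * (4 * B ^ 2) := by
      have h1 := hE.lip ht ht' y (yh + Complex.I * wh)
      have h2 : ‖yh + Complex.I * wh - y‖ ≤ 2 * dt * B + ‖wh‖ := by
        have : yh + Complex.I * wh - y = (yh - y) + Complex.I * wh := by ring
        rw [this]
        refine (norm_add_le _ _).trans ?_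
        rw [norm_mul, Complex.norm_I, one_mul]
        have := h.norm_yh_sub_le hE hdt ht
        linarith
      have h3 : |t + (2 - gam) * dt - t| ≤ 2 * dt := by
        rw [add_sub_cancel_left, abs_of_nonneg (mul_nonneg (by linarith) hdt)]
        gcongr
        linarith
      have h4 : K * ‖yh + Complex.I * wh - y‖ ≤
          K * (2 * dt * B) + K * (15 * ‖u‖ + 7 * (a * (‖u‖ + m)) + m) := by
        rw [← mul_add]
        gcongr
        linarith
      have h5 : K * (2 * dt * B) ≤ B * (2 * dt * B) := by
        gcongr
        exact hE.K_le
      have h6 : B * |t + (2 - gam) * dt - t| ≤ B * (2 * dt) := by gcongr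
      have h7 : dt * B ≤ dt * B ^ 2 := by
        gcongr
        nlinarith
      nlinarith
    have h1 := hL.norm_w'_le hlam hdt (by positivity) (by positivity) g1
    have h2 : ‖e (t + dt, y') - c‖ ≤ dt * (2 * B ^ 2) := by
      have h1 := hE.lip ht (add_nonneg ht hdt) y y'
      rw [add_sub_cancel_left, abs_of_nonneg hdt] at h1
      have h2 : K * ‖y' - y‖ ≤ B * (B * dt) := by
        gcongr
        · exact hE.K_le
        · exact h.norm_y'_sub_le hE hdt ht
      have h3 : B * dt ≤ B ^ 2 * dt := by
        gcongr
        nlinarith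
      linarith
    have h3 : w' + Complex.I * e (t + dt, y') / lam =
        (w' + s) + Complex.I * (e (t + dt, y') - c) / lam := by rw [hsdef]; ring
    have h4 : ‖Complex.I * (e (t + dt, y') - c) / lam‖ ≤ dt * (2 * B ^ 2) / lam := by
      rw [norm_div, norm_mul, Complex.norm_I, one_mul, Complex.norm_of_nonneg hlam.le]
      gcongr
    have h5 : ‖w' + Complex.I * e (t + dt, y') / lam‖ ≤
        ‖u‖ * (1 + 16 * a + 7 * a ^ 2) + a * m * (2 + 7 * a) + dt * (6 * B ^ 2 / lam) := by
      rw [h3]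
      refine (norm_add_le _ _).trans ((add_le_add h1 h4).trans ?_)
      have e1 : dt * (K * (15 * ‖u‖ + 7 * (a * (‖u‖ + m)) + m)) =
        a * (15 * ‖u‖ + 7 * (a * (‖u‖ + m)) + m) := by rw [ha]; ring
      have e2 : dt * (4 * B ^ 2 / lam) + dt * (2 * B ^ 2) / lam = dt * (6 * B ^ 2 / lam) := by ring
      linarith
    have h6 : a * m ≤ dt * (B ^ 2 / lam) := by
      have : a * m = dt * (K * B / lam) := by rw [ha, hm]; ring
      rw [this, pow_two]
      gcongr
      exact hE.K_le
    have h7 : 1 + 16 * a + 7 * a ^ 2 ≤ Real.exp (16 * a) := by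
      have := Real.quadratic_le_exp_of_nonneg (by positivity : 0 ≤ 16 * a)
      nlinarith [sq_nonneg a]
    have h8 : 0 ≤ dt * (B ^ 2 / lam) := by positivity
    calc _ ≤ _ := h5
      _ ≤ ‖u‖ * (1 + 16 * a + 7 * a ^ 2) + dt * (B ^ 2 / lam) * (2 + 7 * a) +
          dt * (6 * B ^ 2 / lam) := by gcongr
      _ = ‖u‖ * (1 + 16 * a + 7 * a ^ 2) + dt * (B ^ 2 / lam) * (8 + 7 * a) := by ring
      _ ≤ ‖u‖ * Real.exp (16 * a) + dt * (B ^ 2 / lam) * (8 * Real.exp (16 * a)) := by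
          gcongr
          linarith [sq_nonneg a]
      _ = _ := by ring
  · have h1 := hL.norm_wt_le hdt
    have h2 := back wt
    nlinarith

/-- A bound, of order `ε` for a velocity of order one, for `w = ε v` along the flow and along the
scheme. -/
noncomputable def wBound (B K lam W₀ t : ℝ) : ℝ :=
  Real.exp (17 * K * t) * (W₀ + 8 * B ^ 2 * (1 + t) / lam)

theorem wBound_mono {W₀ s : ℝ} (hK : 0 ≤ K) (hlam : 0 < lam) (hW : 0 ≤ W₀) (hs : 0 ≤ s)
    (hst : s ≤ t) : wBound B K lam W₀ s ≤ wBound B K lam W₀ t := by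
  unfold wBound
  have : 0 ≤ 1 + s := by linarith
  gcongr

/-- A discrete Gronwall argument controls the deviation from equilibrium; passing from w to the
deviation and back costs B/λ each time. The rate 17 in `wBound` is 16 for the full steps plus 1 for
the stage `Wt`, whose bound is therefore taken at the end of its step. -/
theorem norm_discrete_w_le (hE : FieldBounds B K e D) (hlam : 0 < lam) (hdt : 0 ≤ dt)
    {Y W Wt Yh Wh : ℕ → ℂ} (h : ∀ n : ℕ,
      ImexStep e lam dt (n * dt) (Y n) (W n) (Wt n) (Yh n) (Wh n) (Y (n + 1)) (W (n + 1))) (n : ℕ) :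
    ‖W n‖ ≤ wBound B K lam ‖W 0‖ (n * dt) ∧ ‖Wt n‖ ≤ wBound B K lam ‖W 0‖ ((n + 1) * dt) := by
  have hB := hE.one_le
  have hB0 := hE.B_nonneg
  have hK := hE.K_nonneg
  have hnt : ∀ n : ℕ, (0 : ℝ) ≤ n * dt := fun n => by positivity
  have hs : ∀ n : ℕ, ‖Complex.I * e (n * dt, Y n) / lam‖ ≤ B / lam := by
    intro n
    rw [norm_div, norm_mul, Complex.norm_I, one_mul, Complex.norm_of_nonneg hlam.le]
    gcongr
    exact hE.norm_le _ (hnt n)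
  have hg := discrete_gronwall (a := fun n => ‖W n + Complex.I * e (n * dt, Y n) / lam‖)
    (c := 16 * (K * dt)) (r := dt * (8 * B ^ 2 / lam)) (by positivity) (by positivity) (N := n)
    (fun k _ => by
      have := ((h k).norm_deviation_le hE hlam hdt (hnt k)).1
      have e1 : ((k + 1 : ℕ) : ℝ) * dt = k * dt + dt := by push_cast; ring
      rw [e1]
      exact this) n le_rfl
  have h0 : ‖W 0 + Complex.I * e ((0 : ℕ) * dt, Y 0) / lam‖ ≤ ‖W 0‖ + B / lam :=
    (norm_add_le _ _).trans (add_le_add le_rfl (hs 0))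
  set u := ‖W n + Complex.I * e (n * dt, Y n) / lam‖ with hu
  have hBB : B / lam ≤ B ^ 2 / lam := by
    gcongr
    nlinarith
  have hexp : 1 ≤ Real.exp (16 * (K * dt) * n) := Real.one_le_exp (by positivity)
  have key : u + B / lam ≤
      Real.exp (16 * (K * dt) * n) * (‖W 0‖ + 8 * B ^ 2 * (1 + n * dt) / lam) := by
    have h1 : u ≤ Real.exp (16 * (K * dt) * n) * (‖W 0‖ + B / lam + n * (dt * (8 * B ^ 2 / lam))) :=
      hg.trans (by gcongr)
    have h2 : B / lam ≤ Real.exp (16 * (K * dt) * n) * (B / lam) :=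
      le_mul_of_one_le_left (by positivity) hexp
    have h3 : ‖W 0‖ + B / lam + n * (dt * (8 * B ^ 2 / lam)) + B / lam ≤
        ‖W 0‖ + 8 * B ^ 2 * (1 + n * dt) / lam := by
      have : 8 * B ^ 2 * (1 + n * dt) / lam =
        8 * (B ^ 2 / lam) + n * (dt * (8 * B ^ 2 / lam)) := by ring
      have : 0 ≤ B ^ 2 / lam := by positivity
      linarith
    calc u + B / lam ≤ Real.exp (16 * (K * dt) * n) *
          (‖W 0‖ + B / lam + n * (dt * (8 * B ^ 2 / lam)) + B / lam) := by linarith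
      _ ≤ _ := by gcongr
  constructor
  · calc ‖W n‖ = ‖(W n + Complex.I * e (n * dt, Y n) / lam) -
          Complex.I * e (n * dt, Y n) / lam‖ := by ring_nf
      _ ≤ u + B / lam := (norm_sub_le _ _).trans (add_le_add le_rfl (hs n))
      _ ≤ _ := key
      _ ≤ _ := by
        unfold wBound
        have : 0 ≤ n * dt := hnt n
        refine mul_le_mul_of_nonneg_right (Real.exp_le_exp.2 ?_) (by positivity)
        nlinarith [mul_nonneg hK this]
  · have h1 := ((h n).norm_deviation_le hE hlam hdt (hnt n)).2
    calc ‖Wt n‖ ≤ Real.exp (K * dt) * (u + B / lam) := h1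
      _ ≤ Real.exp (K * dt) * (Real.exp (16 * (K * dt) * n) *
          (‖W 0‖ + 8 * B ^ 2 * (1 + n * dt) / lam)) := by gcongr
      _ = Real.exp (K * dt + 16 * (K * dt) * n) * (‖W 0‖ + 8 * B ^ 2 * (1 + n * dt) / lam) := by
        rw [Real.exp_add]; ring
      _ ≤ _ := by
        unfold wBound
        have h2 : 0 ≤ n * dt := hnt n
        refine mul_le_mul (Real.exp_le_exp.2 ?_) ?_ (by positivity) (by positivity)
        · nlinarith [mul_nonneg hK h2, mul_nonneg hK hdt]
        · gcongr
          linarith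

end

/-! ### A priori bounds along the flow -/

section

variable {B K lam t : ℝ} {e : ℝ × ℂ → ℂ} {D : ℝ × ℂ → ℝ × ℂ →L[ℝ] ℂ} {y w : ℝ → ℂ}

/-- Integration of a Taylor estimate for the derivative. -/
theorem norm_taylor_le_of_deriv {f f' : ℝ → ℂ}
    (hf : ∀ s, 0 ≤ s → HasDerivWithinAt f (f' s) (Set.Ici 0) s) {h C : ℝ} (ht : 0 ≤ t)
    (hh : 0 ≤ h) (a b : ℂ) (hC : ∀ s, 0 ≤ s → s ≤ h → ‖f' (t + s) - a - s * b‖ ≤ C) :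
    ‖f (t + h) - f t - h * a - h ^ 2 / 2 * b‖ ≤ h * C := by
  let g : ℝ → ℂ := fun s => f s - ((s - t : ℝ) : ℂ) * a - ((s - t : ℝ) : ℂ) ^ 2 / 2 * b
  have hg : ∀ s ∈ Set.Icc t (t + h),
      HasDerivWithinAt g (f' s - a - (s - t : ℝ) * b) (Set.Icc t (t + h)) s := by
    intro s hs
    have h1 : HasDerivWithinAt f (f' s) (Set.Icc t (t + h)) s :=
      (hf s (ht.trans hs.1)).mono fun r hr => ht.trans hr.1
    have h2 : HasDerivWithinAt (fun s : ℝ => ((s - t : ℝ) : ℂ)) 1 (Set.Icc t (t + h)) s := by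
      have := ((hasDerivAt_id s).sub_const t).ofReal_comp
      simpa using this.hasDerivWithinAt
    refine ((h1.sub (h2.mul_const a)).sub (((h2.pow 2).div_const 2).mul_const b)).congr_deriv ?_
    push_cast
    ring
  have := norm_image_sub_le_of_norm_deriv_le_segment' hg (C := C) (fun s hs => ?_) (t + h)
    ⟨by linarith, le_rfl⟩
  · simp only [g] at this
    rw [add_sub_cancel_left, sub_self] at this
    rw [mul_comm h C]
    have e0 : f (t + h) - f t - h * a - h ^ 2 / 2 * b = f (t + h) - h * a - h ^ 2 / 2 * b -
        (f t - ((0 : ℝ) : ℂ) * a - ((0 : ℝ) : ℂ) ^ 2 / 2 * b) := by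
      push_cast
      ring
    rw [e0]
    exact this
  · have := hC (s - t) (by linarith [hs.1]) (by linarith [hs.2])
    rwa [add_sub_cancel] at this

namespace IsFlow

theorem norm_y_sub_le (hE : FieldBounds B K e D) (h : IsFlow e lam y w) (ht : 0 ≤ t) {s : ℝ}
    (hs : 0 ≤ s) : ‖y (t + s) - y t‖ ≤ B * s := by
  have := norm_taylor_le_of_deriv h.deriv_y ht hs 0 0 (C := B) (fun r hr _ => ?_)
  · simpa [mul_comm] using this
  · have := hE.norm_le (t + r, y (t + r) + Complex.I * w (t + r)) (add_nonneg ht hr)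
    simpa using this

/-- Along the flow `w` stays of the order of its initial value and of the equilibrium. -/
theorem norm_w_le (hE : FieldBounds B K e D) (hlam : 0 < lam) (h : IsFlow e lam y w)
    (ht : 0 ≤ t) : ‖w t‖ ≤ wBound B K lam ‖w 0‖ t := by
  have hB := hE.one_le
  have hB0 := hE.B_nonneg
  have hK := hE.K_nonneg
  have hl : (lam : ℂ) ≠ 0 := Complex.ofReal_ne_zero.2 hlam.ne'
  -- The rotating factor removes the stiff term -iλ u from the equation of the deviation u = w + i
  -- e(s, y)/λ. What is left is e(s, y + i w) - e(s, y), at most K‖w‖, and the motion of the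
  -- equilibrium, of order 1/λ because y is slow.
  let Z : ℝ → ℂ := fun s =>
    Complex.exp (lam * s * Complex.I) * (w s + Complex.I * e (s, y s) / lam)
  let Z' : ℝ → ℂ := fun s => Complex.exp (lam * s * Complex.I) *
    (e (s, y s + Complex.I * w s) - e (s, y s) +
      Complex.I * D (s, y s) (1, -(Complex.I * e (s, y s + Complex.I * w s))) / lam)
  have hder : ∀ s, 0 ≤ s → HasDerivWithinAt Z (Z' s) (Set.Ici 0) s := by
    intro s hs
    have h1 : HasDerivWithinAt (fun s : ℝ => Complex.exp (lam * s * Complex.I))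
        (Complex.exp (lam * s * Complex.I) * (lam * 1 * Complex.I)) (Set.Ici 0) s := by
      have h0 : HasDerivAt (fun s : ℝ => ((s : ℝ) : ℂ)) 1 s := by
        simpa using (hasDerivAt_id s).ofReal_comp
      exact ((h0.const_mul (lam : ℂ)).mul_const Complex.I).cexp.hasDerivWithinAt
    have h2 : HasDerivWithinAt (fun s => e (s, y s))
        (D (s, y s) (1, -(Complex.I * e (s, y s + Complex.I * w s)))) (Set.Ici 0) s :=
      (hE.hasFDerivWithinAt (p := (s, y s)) hs).comp_hasDerivWithinAt s
        ((hasDerivWithinAt_id s _).prodMk (h.deriv_y s hs)) (fun _ hq => hq)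
    refine (h1.mul ((h.deriv_w s hs).add ((h2.const_mul Complex.I).div_const (lam : ℂ)))).congr_deriv
      ?_
    simp only [Z', Pi.add_apply]
    field_simp
    linear_combination (lam * e (s, y s)) * Complex.I_sq
  have hexp : ∀ s : ℝ, ‖Complex.exp (lam * s * Complex.I)‖ = 1 := fun s => by
    rw [← Complex.ofReal_mul, Complex.norm_exp_ofReal_mul_I]
  have hZn : ∀ s, ‖Z s‖ = ‖w s + Complex.I * e (s, y s) / lam‖ := fun s => by
    simp only [Z]
    rw [norm_mul, hexp, one_mul]
  have heq : ∀ s, 0 ≤ s → ‖Complex.I * e (s, y s) / lam‖ ≤ B / lam := by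
    intro s hs
    rw [norm_div, norm_mul, Complex.norm_I, one_mul, Complex.norm_of_nonneg hlam.le]
    gcongr
    exact hE.norm_le _ hs
  have hw : ∀ s, 0 ≤ s → ‖w s‖ ≤ ‖Z s‖ + B / lam := by
    intro s hs
    rw [hZn]
    calc ‖w s‖ = ‖(w s + Complex.I * e (s, y s) / lam) - Complex.I * e (s, y s) / lam‖ := by
          ring_nf
      _ ≤ _ := (norm_sub_le _ _).trans (add_le_add le_rfl (heq s hs))
  have hZ' : ∀ s, 0 ≤ s → ‖Z' s‖ ≤ K * ‖Z s‖ + 2 * B ^ 2 / lam := by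
    intro s hs
    simp only [Z']
    rw [norm_mul, hexp, one_mul]
    have h1 : ‖e (s, y s + Complex.I * w s) - e (s, y s)‖ ≤ K * (‖Z s‖ + B / lam) := by
      have h2 := hE.lip_space hs (y s) (y s + Complex.I * w s)
      simp only [add_sub_cancel_left, norm_mul, Complex.norm_I, one_mul] at h2
      exact h2.trans (by gcongr; exact hw s hs)
    have h2 : ‖D (s, y s) (1, -(Complex.I * e (s, y s + Complex.I * w s)))‖ ≤ B * B := by
      refine (D (s, y s)).le_of_opNorm_le_of_le (hE.norm_deriv_le _ hs) ?_
      rw [Prod.norm_def]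
      have := hE.norm_le (s, y s + Complex.I * w s) hs
      simpa using ⟨hB, this⟩
    have h3 : ‖Complex.I * D (s, y s) (1, -(Complex.I * e (s, y s + Complex.I * w s))) / lam‖ ≤
        B * B / lam := by
      rw [norm_div, norm_mul, Complex.norm_I, one_mul, Complex.norm_of_nonneg hlam.le]
      gcongr
    have h4 : K * (B / lam) ≤ B * (B / lam) := by
      gcongr
      exact hE.K_le
    refine (norm_add_le _ _).trans ((add_le_add h1 h3).trans ?_)
    have : 2 * B ^ 2 / lam = B * (B / lam) + B * B / lam := by ring
    linarith
  have hgr := norm_le_gronwallBound_of_norm_deriv_right_le (f := Z) (f' := Z') (a := 0) (b := t)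
    (δ := ‖w 0‖ + B / lam) (K := K) (ε := 2 * B ^ 2 / lam)
    (fun s hs => (hder s hs.1).continuousWithinAt.mono fun r hr => hr.1)
    (fun s hs => (hder s hs.1).mono fun r hr => hs.1.trans hr)
    (by
      rw [hZn]
      exact (norm_add_le _ _).trans (add_le_add le_rfl (heq 0 le_rfl)))
    (fun s hs => hZ' s hs.1) t ⟨ht, le_rfl⟩
  rw [sub_zero] at hgr
  have hgr2 := hgr.trans (gronwallBound_le hK (by positivity))
  have hexp1 : 1 ≤ Real.exp (K * t) := Real.one_le_exp (by positivity)
  have h2 : B / lam ≤ Real.exp (K * t) * (B / lam) :=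
    le_mul_of_one_le_left (by positivity) hexp1
  have hBB : B / lam ≤ B ^ 2 / lam := by
    gcongr
    nlinarith
  have hBn : 0 ≤ B ^ 2 / lam := by positivity
  calc ‖w t‖ ≤ ‖Z t‖ + B / lam := hw t ht
    _ ≤ Real.exp (K * t) * (‖w 0‖ + B / lam + 2 * B ^ 2 / lam * t + B / lam) := by linarith
    _ ≤ _ := by
      unfold wBound
      refine mul_le_mul (Real.exp_le_exp.2 ?_) ?_ (by positivity) (by positivity)
      · nlinarith [mul_nonneg hK ht]
      · have e1 : 8 * B ^ 2 * (1 + t) / lam = 8 * (B ^ 2 / lam) + 8 * (B ^ 2 / lam) * t := by ring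
        have e2 : 2 * B ^ 2 / lam * t = 2 * (B ^ 2 / lam) * t := by ring
        have e3 : 0 ≤ B ^ 2 / lam * t := by positivity
        rw [e1, e2]
        linarith

end IsFlow

end

/-! ### Comparison of the flow and of the scheme with the limit scheme -/

section

variable {B K lam dt t : ℝ} {e : ℝ × ℂ → ℂ} {D : ℝ × ℂ → ℝ × ℂ →L[ℝ] ℂ}

theorem FieldBounds.taylor_space (hE : FieldBounds B K e D) (ht : 0 ≤ t) (x h : ℂ) :
    ‖e (t, x + h) - e (t, x) - D (t, x) (0, h)‖ ≤ B * ‖h‖ ^ 2 := by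
  have := hE.taylor (t, x) (t, x + h) ht ht
  simpa [Prod.norm_def] using this

/-- The first order effect `w ↦ -i D_x e (i w)` of the gyration on the velocity of the guiding
center. -/
noncomputable def drift (D : ℝ × ℂ → ℝ × ℂ →L[ℝ] ℂ) (p : ℝ × ℂ) : ℂ →L[ℝ] ℂ :=
  (ContinuousLinearMap.mul ℝ ℂ (-Complex.I)).comp ((D p).comp
    ((ContinuousLinearMap.inr ℝ ℝ ℂ).comp (ContinuousLinearMap.mul ℝ ℂ Complex.I)))

theorem drift_apply (p : ℝ × ℂ) (w : ℂ) : drift D p w = -Complex.I * D p (0, Complex.I * w) := rfl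

theorem FieldBounds.norm_drift_le (hE : FieldBounds B K e D) {p : ℝ × ℂ} (hp : 0 ≤ p.1) (w : ℂ) :
    ‖drift D p w‖ ≤ K * ‖w‖ := by
  rw [drift_apply, norm_mul, norm_neg, Complex.norm_I, one_mul]
  simpa using hE.norm_deriv_inr_le p hp (Complex.I * w)

theorem FieldBounds.norm_deriv_sub_le (hE : FieldBounds B K e D) {p q : ℝ × ℂ} (hp : 0 ≤ p.1)
    (hq : 0 ≤ q.1) (h : ℂ) : ‖D q (0, h) - D p (0, h)‖ ≤ B * ‖q - p‖ * ‖h‖ := by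
  rw [← sub_apply]
  have := (D q - D p).le_of_opNorm_le (hE.deriv_lip p q hp hq) (0, h)
  simpa [Prod.norm_def] using this

theorem FieldBounds.norm_drift_sub_le (hE : FieldBounds B K e D) {p q : ℝ × ℂ} (hp : 0 ≤ p.1)
    (hq : 0 ≤ q.1) (w : ℂ) : ‖drift D q w - drift D p w‖ ≤ B * ‖q - p‖ * ‖w‖ := by
  rw [drift_apply, drift_apply, ← mul_sub, norm_mul, norm_neg, Complex.norm_I, one_mul]
  simpa using hE.norm_deriv_sub_le hp hq (Complex.I * w)

/-- The explicit second-order scheme for the limit equation `y' = -i e(t, y)`. -/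
noncomputable def limitStep (e : ℝ × ℂ → ℂ) (dt t : ℝ) (y : ℂ) : ℂ :=
  y - Complex.I * (dt * ((1 - gam) * e (t, y) +
    gam * e (t + (2 - gam) * dt, y - Complex.I * ((2 - gam) * dt * e (t, y)))))

theorem later_nonneg (hdt : 0 ≤ dt) (ht : 0 ≤ t) : 0 ≤ t + (2 - gam) * dt :=
  add_nonneg ht (mul_nonneg (by linarith [gam_bounds.2]) hdt)

theorem norm_convex_gam_le {a b : ℂ} {α β : ℝ} (ha : ‖a‖ ≤ α) (hb : ‖b‖ ≤ β) :
    ‖(1 - gam : ℂ) * a + gam * b‖ ≤ (1 - gam) * α + gam * β := by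
  have hγ := gam_bounds
  refine (norm_add_le _ _).trans ?_
  have e1 : (1 - gam : ℂ) = ((1 - gam : ℝ) : ℂ) := by push_cast; ring
  rw [e1, norm_mul, norm_mul, Complex.norm_of_nonneg (by linarith : (0 : ℝ) ≤ 1 - gam),
    Complex.norm_of_nonneg (by linarith : (0 : ℝ) ≤ gam)]
  gcongr <;> linarith

theorem norm_I_mul_dt_mul (hdt : 0 ≤ dt) (a : ℂ) : ‖Complex.I * (dt * a)‖ = dt * ‖a‖ := by
  rw [norm_I_mul_ofReal, abs_of_nonneg hdt]

theorem limitStep_lip (hE : FieldBounds B K e D) (hdt : 0 ≤ dt) (ht : 0 ≤ t) (y z : ℂ) :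
    ‖limitStep e dt t y - limitStep e dt t z - (y - z)‖ ≤
      K * dt * (1 + K * dt) * ‖y - z‖ := by
  have hγ := gam_bounds
  have hK := hE.K_nonneg
  have h0 := hE.lip_space ht z y
  have h1 := hE.lip_space (later_nonneg hdt ht) (z - Complex.I * ((2 - gam) * dt * e (t, z)))
    (y - Complex.I * ((2 - gam) * dt * e (t, y)))
  have h2 : ‖(y - Complex.I * ((2 - gam) * dt * e (t, y))) -
      (z - Complex.I * ((2 - gam) * dt * e (t, z)))‖ ≤ ‖y - z‖ + 2 * dt * (K * ‖y - z‖) := by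
    have : (y - Complex.I * ((2 - gam) * dt * e (t, y))) -
      (z - Complex.I * ((2 - gam) * dt * e (t, z))) = (y - z) -
        Complex.I * (((2 - gam) * dt : ℝ) * (e (t, y) - e (t, z))) := by push_cast; ring
    rw [this]
    refine (norm_sub_le _ _).trans ?_
    rw [norm_I_mul_ofReal, abs_of_nonneg (mul_nonneg (by linarith) hdt)]
    gcongr
    linarith
  have e1 : limitStep e dt t y - limitStep e dt t z - (y - z) = -(Complex.I * (dt *
      ((1 - gam) * (e (t, y) - e (t, z)) + gam *
        (e (t + (2 - gam) * dt, y - Complex.I * ((2 - gam) * dt * e (t, y))) -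
          e (t + (2 - gam) * dt, z - Complex.I * ((2 - gam) * dt * e (t, z))))))) := by
    rw [limitStep, limitStep]; ring
  rw [e1, norm_neg, norm_I_mul_dt_mul hdt]
  have h3 := norm_convex_gam_le h0 (h1.trans (mul_le_mul_of_nonneg_left h2 hK))
  have h4 : gam * (K * (2 * dt * (K * ‖y - z‖))) ≤ 1 / 2 * (K * (2 * dt * (K * ‖y - z‖))) := by
    gcongr
    linarith
  calc _ ≤ _ := mul_le_mul_of_nonneg_left h3 hdt
    _ = dt * (K * ‖y - z‖ + gam * (K * (2 * dt * (K * ‖y - z‖)))) := by ring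
    _ ≤ dt * (K * ‖y - z‖ + 1 / 2 * (K * (2 * dt * (K * ‖y - z‖)))) := by gcongr
    _ = _ := by ring

/-- A guiding center trajectory `a` perturbed by the drift of a gyration `w` follows, after
correction by a term of size `1 / lam`, the scheme for the limit equation. -/
theorem corrected_step (hE : FieldBounds B K e D) (hlam : 0 < lam) (hdt : 0 ≤ dt) (ht : 0 ≤ t)
    {a₀ a₁ w₀ w₁ G W : ℂ} {S ρ : ℝ}
    (hW : W = lam⁻¹ • (Complex.I * w₁ - Complex.I * w₀ - dt • (Complex.I * G)))
    (hG : ‖G‖ ≤ B) (ha : ‖a₁ - a₀‖ ≤ B * dt) (hw₀ : ‖w₀‖ ≤ S) (hw₁ : ‖w₁‖ ≤ S)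
    (h : ‖a₁ - limitStep e dt t a₀ - drift D (t, a₀) W‖ ≤ dt * ρ) :
    ‖(a₁ - lam⁻¹ • drift D (t + dt, a₁) (Complex.I * w₁)) -
      limitStep e dt t (a₀ - lam⁻¹ • drift D (t, a₀) (Complex.I * w₀))‖ ≤
      dt * (ρ + B ^ 2 * (1 + (2 + K * dt) * S) / lam) := by
  have hB := hE.one_le
  have hB0 := hE.B_nonneg
  have hK := hE.K_nonneg
  have hS : 0 ≤ S := (norm_nonneg _).trans hw₀
  have hKB := hE.K_le
  set A₀ := drift D (t, a₀) with hA₀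
  set A₁ := drift D (t + dt, a₁) with hA₁
  have hl : ∀ z : ℂ, ‖lam⁻¹ • z‖ = ‖z‖ / lam := fun z => by
    rw [norm_smul, Real.norm_of_nonneg (inv_nonneg.2 hlam.le)]; ring
  -- Once `W` is inserted, the increment of i w cancels against the two corrections. Three terms of
  -- order dt/λ remain: the mean force `G`, the change of the drift map between (t, a₀) and (t + dt,
  -- a₁), and `limitStep` minus the identity acting on the correction.
  have e1 : (a₁ - lam⁻¹ • A₁ (Complex.I * w₁)) -
      limitStep e dt t (a₀ - lam⁻¹ • A₀ (Complex.I * w₀)) =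
      (a₁ - limitStep e dt t a₀ - A₀ W) - lam⁻¹ • (dt • A₀ (Complex.I * G)) -
      lam⁻¹ • (A₁ (Complex.I * w₁) - A₀ (Complex.I * w₁)) +
      (limitStep e dt t a₀ - limitStep e dt t (a₀ - lam⁻¹ • A₀ (Complex.I * w₀)) -
        (a₀ - (a₀ - lam⁻¹ • A₀ (Complex.I * w₀)))) := by
    rw [hW, map_smul, map_sub, map_sub, map_smul, smul_sub, smul_sub, smul_sub]
    ring
  have hIn : ∀ z : ℂ, ‖Complex.I * z‖ = ‖z‖ := fun z => by simp
  have n1 : ‖lam⁻¹ • (dt • A₀ (Complex.I * G))‖ ≤ dt * (B ^ 2 / lam) := by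
    rw [hl, norm_smul, Real.norm_of_nonneg hdt]
    have h1 := hE.norm_drift_le (p := (t, a₀)) ht (Complex.I * G)
    rw [hIn] at h1
    have h2 : K * ‖G‖ ≤ B * B := mul_le_mul hKB hG (norm_nonneg _) hB0
    calc dt * ‖A₀ (Complex.I * G)‖ / lam ≤ dt * (B * B) / lam := by
          gcongr
          exact h1.trans h2
      _ = _ := by ring
  have n2 : ‖lam⁻¹ • (A₁ (Complex.I * w₁) - A₀ (Complex.I * w₁))‖ ≤ dt * (B ^ 2 * S / lam) := by
    rw [hl]
    have h1 := hE.norm_drift_sub_le (p := (t, a₀)) (q := (t + dt, a₁)) ht (add_nonneg ht hdt)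
      (Complex.I * w₁)
    rw [hIn] at h1
    have h2 : ‖((t + dt, a₁) : ℝ × ℂ) - (t, a₀)‖ ≤ B * dt := by
      rw [Prod.norm_def]
      refine max_le ?_ ha
      simp only [Prod.fst_sub, add_sub_cancel_left]
      rw [Real.norm_of_nonneg hdt]
      exact le_mul_of_one_le_left hdt hB
    calc _ ≤ B * (B * dt) * S / lam := by
          gcongr
          exact h1.trans (by gcongr)
      _ = _ := by ring
  have n3 : ‖limitStep e dt t a₀ - limitStep e dt t (a₀ - lam⁻¹ • A₀ (Complex.I * w₀)) -
        (a₀ - (a₀ - lam⁻¹ • A₀ (Complex.I * w₀)))‖ ≤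
        dt * (B ^ 2 * ((1 + K * dt) * S) / lam) := by
    refine (limitStep_lip hE hdt ht _ _).trans ?_
    rw [sub_sub_cancel, hl]
    have h1 := hE.norm_drift_le (p := (t, a₀)) ht (Complex.I * w₀)
    rw [hIn] at h1
    have h2 : ‖A₀ (Complex.I * w₀)‖ ≤ B * S := h1.trans (by gcongr)
    calc K * dt * (1 + K * dt) * (‖A₀ (Complex.I * w₀)‖ / lam) ≤
        B * dt * (1 + K * dt) * (B * S / lam) := by gcongr
      _ = _ := by ring
  rw [e1]
  have h1 := norm_add_le (a₁ - limitStep e dt t a₀ - A₀ W - lam⁻¹ • (dt • A₀ (Complex.I * G)) -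
      lam⁻¹ • (A₁ (Complex.I * w₁) - A₀ (Complex.I * w₁)))
      (limitStep e dt t a₀ - limitStep e dt t (a₀ - lam⁻¹ • A₀ (Complex.I * w₀)) -
        (a₀ - (a₀ - lam⁻¹ • A₀ (Complex.I * w₀))))
  have h2 := norm_sub_le (a₁ - limitStep e dt t a₀ - A₀ W - lam⁻¹ • (dt • A₀ (Complex.I * G)))
    (lam⁻¹ • (A₁ (Complex.I * w₁) - A₀ (Complex.I * w₁)))
  have h3 := norm_sub_le (a₁ - limitStep e dt t a₀ - A₀ W) (lam⁻¹ • (dt • A₀ (Complex.I * G)))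
  have h4 : dt * (ρ + B ^ 2 * (1 + (2 + K * dt) * S) / lam) = dt * ρ + dt * (B ^ 2 / lam) +
      dt * (B ^ 2 * S / lam) + dt * (B ^ 2 * ((1 + K * dt) * S) / lam) := by ring
  linarith

/-- In the expansion of both fields around (t, y), the terms without w reproduce the limit step and
those linear in w give the drift of the quadrature of w. The remainders are quadratic in `dt` and
`S`, including the effect of w on `yh`. -/
theorem ImexStep.norm_sub_limitStep_le (hE : FieldBounds B K e D) (hdt : 0 ≤ dt) (ht : 0 ≤ t)
    {y w wt yh wh y' w' : ℂ} (h : ImexStep e lam dt t y w wt yh wh y' w') {S : ℝ}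
    (hwt : ‖wt‖ ≤ S) (hw' : ‖w'‖ ≤ S) :
    ‖y' - limitStep e dt t y - drift D (t, y) (dt • ((1 - gam) • wt + gam • w'))‖ ≤
      dt * (4 * B ^ 3 * (dt + S) ^ 2) := by
  have hγ := gam_bounds
  have hB := hE.one_le
  have hB0 := hE.B_nonneg
  have hK := hE.K_nonneg
  have hS : 0 ≤ S := (norm_nonneg _).trans hwt
  have hKB := hE.K_le
  have ht' := later_nonneg hdt ht
  set t' := t + (2 - gam) * dt with ht'def
  set z := y - Complex.I * ((2 - gam) * dt * e (t, y)) with hz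
  have e1 : y' - limitStep e dt t y - drift D (t, y) (dt • ((1 - gam) • wt + gam • w')) =
      -(Complex.I * (dt * ((1 - gam) * (e (t, y + Complex.I * wt) - e (t, y) -
        D (t, y) (0, Complex.I * wt)) + gam * (e (t', yh + Complex.I * w') - e (t', z) -
        D (t, y) (0, Complex.I * w'))))) := by
    rw [h.y'_eq, limitStep, map_smul, map_add, map_smul, map_smul, drift_apply, drift_apply]
    simp only [Complex.real_smul]
    push_cast
    ring
  have b1 : ‖e (t, y + Complex.I * wt) - e (t, y) - D (t, y) (0, Complex.I * wt)‖ ≤ B * S ^ 2 := by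
    have := hE.taylor_space ht y (Complex.I * wt)
    rw [norm_mul, Complex.norm_I, one_mul] at this
    exact this.trans (by gcongr)
  have b2 : ‖e (t', yh + Complex.I * w') - e (t', yh) - D (t', yh) (0, Complex.I * w')‖ ≤
      B * S ^ 2 := by
    have := hE.taylor_space ht' yh (Complex.I * w')
    rw [norm_mul, Complex.norm_I, one_mul] at this
    exact this.trans (by gcongr)
  have b3 : ‖D (t', yh) (0, Complex.I * w') - D (t, y) (0, Complex.I * w')‖ ≤
      2 * B ^ 2 * dt * S := by
    have h1 := hE.norm_deriv_sub_le (p := (t, y)) (q := (t', yh)) ht ht' (Complex.I * w')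
    rw [norm_mul, Complex.norm_I, one_mul] at h1
    have h2 : ‖((t', yh) : ℝ × ℂ) - (t, y)‖ ≤ 2 * dt * B := by
      rw [Prod.norm_def]
      refine max_le ?_ (h.norm_yh_sub_le hE hdt ht)
      simp only [Prod.fst_sub, ht'def, add_sub_cancel_left]
      rw [Real.norm_of_nonneg (mul_nonneg (by linarith) hdt)]
      nlinarith
    calc _ ≤ _ := h1
      _ ≤ B * (2 * dt * B) * S := by gcongr
      _ = _ := by ring
  have b4 : ‖e (t', yh) - e (t', z)‖ ≤ 2 * B ^ 2 * dt * S := by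
    have h1 := hE.lip_space ht' z yh
    have h2 : yh - z = -(Complex.I * (((2 - gam) * dt : ℝ) *
        (e (t, y + Complex.I * wt) - e (t, y)))) := by
      rw [h.yh_eq, hz]; push_cast; ring
    have h3 := hE.lip_space ht y (y + Complex.I * wt)
    rw [add_sub_cancel_left, norm_mul, Complex.norm_I, one_mul] at h3
    have h4 : ‖yh - z‖ ≤ 2 * dt * (B * S) := by
      rw [h2, norm_neg, norm_I_mul_dt_mul (mul_nonneg (by linarith) hdt)]
      gcongr
      · linarith
      · exact h3.trans (by gcongr)
    calc _ ≤ _ := h1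
      _ ≤ B * (2 * dt * (B * S)) := by gcongr
      _ = _ := by ring
  have b5 : ‖e (t', yh + Complex.I * w') - e (t', z) - D (t, y) (0, Complex.I * w')‖ ≤
      B * S ^ 2 + 4 * B ^ 2 * dt * S := by
    have : e (t', yh + Complex.I * w') - e (t', z) - D (t, y) (0, Complex.I * w') =
      (e (t', yh + Complex.I * w') - e (t', yh) - D (t', yh) (0, Complex.I * w')) +
      (D (t', yh) (0, Complex.I * w') - D (t, y) (0, Complex.I * w')) +
      (e (t', yh) - e (t', z)) := by ring
    rw [this]
    refine norm_add₃_le.trans ?_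
    linarith
  rw [e1, norm_neg, norm_I_mul_dt_mul hdt]
  refine mul_le_mul_of_nonneg_left ((norm_convex_gam_le b1 b5).trans ?_) hdt
  have hB3 : B ≤ B ^ 3 := le_self_pow₀ hB (by norm_num)
  have hB2 : B ^ 2 ≤ B ^ 3 := pow_le_pow_right₀ hB (by norm_num)
  have c1 : B * S ^ 2 ≤ B ^ 3 * S ^ 2 := by gcongr
  have c2 : B ^ 2 * (dt * S) ≤ B ^ 3 * (dt * S) := by gcongr
  have c3 : gam * (4 * B ^ 2 * dt * S) ≤ 1 * (4 * B ^ 2 * dt * S) := by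
    gcongr
    linarith
  have c4 : 0 ≤ B ^ 3 * dt ^ 2 := by positivity
  have c5 : 0 ≤ B ^ 3 * S ^ 2 := by positivity
  have c6 : 0 ≤ B ^ 3 * (dt * S) := by positivity
  nlinarith

/-- Since x' = λ w, the integral of w over the step is exactly λ⁻¹ times the increment of x = y + i
w. Hence the linear effect of the gyration is known in closed form, however fast the oscillation is
compared with `dt`. -/
theorem IsFlow.norm_sub_limitStep_le (hE : FieldBounds B K e D) (hlam : 0 < lam) (hdt : 0 ≤ dt)
    (ht : 0 ≤ t) {y w : ℝ → ℂ} (h : IsFlow e lam y w) {S : ℝ}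
    (hw : ∀ s, t ≤ s → s ≤ t + dt → ‖w s‖ ≤ S) :
    ‖y (t + dt) - limitStep e dt t (y t) - drift D (t, y t)
      (lam⁻¹ • (y (t + dt) + Complex.I * w (t + dt) - (y t + Complex.I * w t)))‖ ≤
      dt * (5 * B ^ 3 * (dt + S) ^ 2) := by
  have hγ := gam_bounds
  have hB := hE.one_le
  have hB0 := hE.B_nonneg
  have hK := hE.K_nonneg
  have hS : 0 ≤ S := (norm_nonneg _).trans (hw t le_rfl (by linarith))
  have hKB := hE.K_le
  have hl : (lam : ℂ) ≠ 0 := Complex.ofReal_ne_zero.2 hlam.ne'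
  set A := drift D (t, y t) with hA
  set g := e (t, y t) with hg
  set a : ℂ := -(Complex.I * g) with ha
  set b : ℂ := -(Complex.I * D (t, y t) (1, -(Complex.I * g))) with hb
  -- As λ⁻¹(y + i w) is a primitive of w, the derivative of `f` is -i(e(s, x) - D(t, y t)(0, i w)):
  -- the term linear in w is removed, with the drift frozen at time t.
  let f : ℝ → ℂ := fun s => y s - A (lam⁻¹ • (y s + Complex.I * w s))
  let f' : ℝ → ℂ := fun s => -(Complex.I * e (s, y s + Complex.I * w s)) - A (w s)
  have hf : ∀ s, 0 ≤ s → HasDerivWithinAt f (f' s) (Set.Ici 0) s := by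
    intro s hs
    have h1 : HasDerivWithinAt (fun s => lam⁻¹ • (y s + Complex.I * w s)) (w s) (Set.Ici 0) s := by
      refine (((h.deriv_y s hs).add ((h.deriv_w s hs).const_mul Complex.I)).const_smul
        lam⁻¹).congr_deriv ?_
      rw [Complex.real_smul]
      push_cast
      field_simp
      linear_combination (-lam * w s) * Complex.I_sq
    exact (h.deriv_y s hs).sub (A.hasFDerivAt.comp_hasDerivWithinAt s h1)
  have hdy : ∀ s, 0 ≤ s → s ≤ dt → ‖y (t + s) - y t - s * a‖ ≤ dt * (2 * B ^ 2 * dt + B * S) := by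
    intro s hs hsdt
    have := norm_taylor_le_of_deriv h.deriv_y ht hs a 0 (C := 2 * B ^ 2 * dt + B * S)
      (fun r hr hrs => ?_)
    · rw [mul_zero, sub_zero] at this
      exact this.trans (by gcongr)
    · have e1 : -(Complex.I * e (t + r, y (t + r) + Complex.I * w (t + r))) - a - r * 0 =
          -(Complex.I * (e (t + r, y (t + r) + Complex.I * w (t + r)) - g)) := by
        rw [ha]; ring
      rw [e1, norm_neg, norm_mul, Complex.norm_I, one_mul]
      have h1 := hE.lip ht (add_nonneg ht hr) (y t) (y (t + r) + Complex.I * w (t + r))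
      rw [add_sub_cancel_left, abs_of_nonneg hr] at h1
      have h2 : ‖y (t + r) + Complex.I * w (t + r) - y t‖ ≤ B * r + S := by
        have : y (t + r) + Complex.I * w (t + r) - y t =
          (y (t + r) - y t) + Complex.I * w (t + r) := by ring
        rw [this]
        refine (norm_add_le _ _).trans (add_le_add (h.norm_y_sub_le hE ht hr) ?_)
        rw [norm_mul, Complex.norm_I, one_mul]
        exact hw _ (by linarith) (by linarith)
      have h3 : K * ‖y (t + r) + Complex.I * w (t + r) - y t‖ ≤ B * (B * r + S) := by gcongr
      have h4 : B * r ≤ B ^ 2 * dt := by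
        gcongr
        · nlinarith
        · linarith
      have h5 : B * (B * r) ≤ B ^ 2 * dt := by
        rw [← mul_assoc, ← pow_two]
        gcongr
        linarith
      linarith
  have key := norm_taylor_le_of_deriv hf ht hdt a b (C := 3 * B ^ 3 * (dt + S) ^ 2)
    (fun s hs hsdt => by
      set x := y (t + s) + Complex.I * w (t + s) with hx
      have e1 : f' (t + s) - a - s * b = -(Complex.I * ((e (t + s, x) - e (t, y t) -
          D (t, y t) ((t + s, x) - (t, y t))) + D (t, y t) (0, y (t + s) - y t - s * a))) := by
        have e2 : D (t, y t) ((t + s, x) - (t, y t)) = D (t, y t) (0, y (t + s) - y t - s * a) +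
            D (t, y t) (0, Complex.I * w (t + s)) + s * D (t, y t) (1, a) := by
          have e3 : (s : ℂ) * D (t, y t) (1, a) = D (t, y t) (s • (1, a)) := by
            rw [map_smul, Complex.real_smul]
          rw [e3, ← map_add, ← map_add]
          congr 1
          ext1
          · simp
          · simp [hx]
            ring
        rw [e2]
        simp only [f', hA, drift_apply, hb, ha, hx, hg]
        ring
      rw [e1, norm_neg, norm_mul, Complex.norm_I, one_mul]
      have h1 := hE.taylor (t, y t) (t + s, x) ht (add_nonneg ht hs)
      have h2 : ‖((t + s, x) : ℝ × ℂ) - (t, y t)‖ ≤ B * (dt + S) := by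
        rw [Prod.norm_def]
        refine max_le ?_ ?_
        · simp only [Prod.fst_sub, add_sub_cancel_left]
          rw [Real.norm_of_nonneg hs]
          nlinarith
        · have : x - y t = (y (t + s) - y t) + Complex.I * w (t + s) := by rw [hx]; ring
          change ‖x - y t‖ ≤ _
          rw [this]
          refine (norm_add_le _ _).trans ?_
          rw [norm_mul, Complex.norm_I, one_mul]
          have i1 := h.norm_y_sub_le hE ht hs
          have i2 := hw (t + s) (by linarith) (by linarith)
          nlinarith
      have h3 := hE.norm_deriv_inr_le (t, y t) ht (y (t + s) - y t - s * a)
      have h4 := hdy s hs hsdt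
      have h5 : B * ‖((t + s, x) : ℝ × ℂ) - (t, y t)‖ ^ 2 ≤ B ^ 3 * (dt + S) ^ 2 := by
        calc _ ≤ B * (B * (dt + S)) ^ 2 := by gcongr
          _ = _ := by ring
      have h6 : K * ‖y (t + s) - y t - s * a‖ ≤ 2 * B ^ 3 * (dt + S) ^ 2 := by
        calc _ ≤ B * (dt * (2 * B ^ 2 * dt + B * S)) := by gcongr
          _ = 2 * B ^ 3 * dt ^ 2 + B ^ 2 * (dt * S) := by ring
          _ ≤ 2 * B ^ 3 * dt ^ 2 + B ^ 3 * (dt * S) := by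
            gcongr
            norm_num
          _ ≤ _ := by
            have : 0 ≤ B ^ 3 * (dt * S) := by positivity
            have : 0 ≤ B ^ 3 * S ^ 2 := by positivity
            nlinarith
      refine (norm_add_le _ _).trans ?_
      linarith)
  -- The limit step has the same second-order expansion dt a + dt²/2 b as the increment of `f`, by
  -- γ(2 - γ) = 1/2.
  have hrk : ‖limitStep e dt t (y t) - y t - dt * a - dt ^ 2 / 2 * b‖ ≤
      dt * (2 * B ^ 3 * (dt + S) ^ 2) := by
    set z := y t - Complex.I * ((2 - gam) * dt * g) with hz
    have e2 : D (t, y t) ((t + (2 - gam) * dt, z) - (t, y t)) =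
        ((2 - gam) * dt : ℝ) * D (t, y t) (1, -(Complex.I * g)) := by
      rw [← Complex.real_smul, ← map_smul]
      congr 1
      ext1
      · simp
      · simp [hz]
        ring
    have hγ2 : (gam : ℂ) * (2 - gam) = 1 / 2 := by
      have := gam_sq
      have h2 : gam * (2 - gam) = 1 / 2 := by linarith
      have h3 := congrArg (fun r : ℝ => (r : ℂ)) h2
      push_cast at h3
      exact h3
    have e1 : limitStep e dt t (y t) - y t - dt * a - dt ^ 2 / 2 * b =
        -(Complex.I * (dt * ((1 - gam) * 0 + gam * (e (t + (2 - gam) * dt, z) - e (t, y t) -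
          D (t, y t) ((t + (2 - gam) * dt, z) - (t, y t)))))) := by
      rw [e2, limitStep, ← hg, ← hz, ha, hb]
      push_cast
      linear_combination (-Complex.I * dt ^ 2 * D (t, y t) (1, -(Complex.I * g))) * hγ2
    rw [e1, norm_neg, norm_I_mul_dt_mul hdt]
    have h1 := hE.taylor (t, y t) (t + (2 - gam) * dt, z) ht (later_nonneg hdt ht)
    have h2 : ‖((t + (2 - gam) * dt, z) : ℝ × ℂ) - (t, y t)‖ ≤ 2 * dt * B := by
      rw [Prod.norm_def]
      refine max_le ?_ ?_
      · simp only [Prod.fst_sub, add_sub_cancel_left]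
        rw [Real.norm_of_nonneg (mul_nonneg (by linarith) hdt)]
        nlinarith
      · have : z - y t = -(Complex.I * (((2 - gam) * dt : ℝ) * g)) := by
          rw [hz]; push_cast; ring
        change ‖z - y t‖ ≤ _
        rw [this, norm_neg, norm_I_mul_dt_mul (mul_nonneg (by linarith) hdt)]
        have := hE.norm_le (t, y t) ht
        gcongr
        linarith
    have h3 : B * ‖((t + (2 - gam) * dt, z) : ℝ × ℂ) - (t, y t)‖ ^ 2 ≤ 4 * B ^ 3 * dt ^ 2 := by
      calc _ ≤ B * (2 * dt * B) ^ 2 := by gcongr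
        _ = _ := by ring
    have h4 := norm_convex_gam_le (a := 0) (α := 0) (by simp) (h1.trans h3)
    refine mul_le_mul_of_nonneg_left (h4.trans ?_) hdt
    have h5 : gam * (4 * B ^ 3 * dt ^ 2) ≤ 1 / 2 * (4 * B ^ 3 * dt ^ 2) := by
      gcongr
      linarith
    have h6 : B ^ 3 * dt ^ 2 ≤ B ^ 3 * (dt + S) ^ 2 := by
      gcongr
      linarith
    linarith
  have e3 : y (t + dt) - limitStep e dt t (y t) - A
      (lam⁻¹ • (y (t + dt) + Complex.I * w (t + dt) - (y t + Complex.I * w t))) =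
      (f (t + dt) - f t - dt * a - dt ^ 2 / 2 * b) -
      (limitStep e dt t (y t) - y t - dt * a - dt ^ 2 / 2 * b) := by
    simp only [f]
    rw [smul_sub, map_sub]
    ring
  rw [e3]
  refine (norm_sub_le _ _).trans ?_
  linarith

end

/-! ### Guiding center error without negative powers of ε -/

section

variable {B K lam dt : ℝ} {e : ℝ × ℂ → ℂ} {D : ℝ × ℂ → ℝ × ℂ →L[ℝ] ℂ}

/-- The error on the guiding center, with no negative power of `ε`: `S` bounds `w = ε v`, and
`1 / lam = ε ^ 2`. -/
theorem uniform_error (hE : FieldBounds B K e D) (hlam : 0 < lam) (hdt : 0 < dt)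
    {Y W Wt Yh Wh : ℕ → ℂ} (h : ∀ n : ℕ,
      ImexStep e lam dt (n * dt) (Y n) (W n) (Wt n) (Yh n) (Wh n) (Y (n + 1)) (W (n + 1)))
    {y w : ℝ → ℂ} (hf : IsFlow e lam y w) (hy : Y 0 = y 0) (hw : W 0 = w 0) (n : ℕ) {S : ℝ}
    (hS : S = wBound B K lam ‖w 0‖ (n * dt)) :
    ‖Y n - y (n * dt)‖ ≤ Real.exp (2 * K * (n * dt)) * (n * dt *
      (9 * B ^ 3 * (dt + S) ^ 2 + 2 * (B ^ 2 * (1 + (2 + K * dt) * S) / lam))) +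
        2 * B * S / lam := by
  have hB := hE.one_le
  have hB0 := hE.B_nonneg
  have hK := hE.K_nonneg
  have hKB := hE.K_le
  have hnt : ∀ k : ℕ, (0 : ℝ) ≤ k * dt := fun k => by positivity
  have hle : ∀ {k : ℕ}, k ≤ n → (k : ℝ) * dt ≤ n * dt := fun hk => by gcongr
  have hsucc : ∀ k : ℕ, ((k + 1 : ℕ) : ℝ) * dt = k * dt + dt := fun k => by push_cast; ring
  have mono : ∀ {s : ℝ}, 0 ≤ s → s ≤ n * dt → wBound B K lam ‖w 0‖ s ≤ S := fun hs hsn => by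
    rw [hS]
    exact wBound_mono hK hlam (norm_nonneg _) hs hsn
  have bw : ∀ s, 0 ≤ s → s ≤ n * dt → ‖w s‖ ≤ S := fun s hs hsn =>
    (hf.norm_w_le hE hlam hs).trans (mono hs hsn)
  have bW : ∀ k ≤ n, ‖W k‖ ≤ S := fun k hk => by
    have := (norm_discrete_w_le hE hlam hdt.le h k).1
    rw [hw] at this
    exact this.trans (mono (hnt k) (hle hk))
  have bWt : ∀ k < n, ‖Wt k‖ ≤ S := fun k hk => by
    have := (norm_discrete_w_le hE hlam hdt.le h k).2
    rw [hw] at this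
    refine this.trans (mono (by positivity) ?_)
    have h1 := hle (Nat.succ_le_of_lt hk)
    push_cast at h1
    exact h1
  have hS0 : 0 ≤ S := (norm_nonneg _).trans (bW n le_rfl)
  have hIn : ∀ z : ℂ, ‖Complex.I * z‖ = ‖z‖ := fun z => by simp
  -- The corrected guiding centers, discrete and continuous. They coincide at k = 0 and differ from
  -- the true ones by at most B S/λ.
  let qd : ℕ → ℂ := fun k => Y k - lam⁻¹ • drift D (k * dt, Y k) (Complex.I * W k)
  let qc : ℕ → ℂ := fun k =>
    y (k * dt) - lam⁻¹ • drift D (k * dt, y (k * dt)) (Complex.I * w (k * dt))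
  set R := B ^ 2 * (1 + (2 + K * dt) * S) / lam with hR
  have hR0 : 0 ≤ R := by positivity
  have hd : ∀ k < n, ‖qd (k + 1) - limitStep e dt (k * dt) (qd k)‖ ≤
      dt * (4 * B ^ 3 * (dt + S) ^ 2 + R) := by
    intro k hk
    have e1 := (h k).linearStages.w'_eq
    -- `G` is the weighted mean of the two forces: the last velocity stage then expresses the
    -- quadrature of w through `G` and the increment of `W`.
    have := corrected_step hE hlam hdt.le (hnt k) (a₀ := Y k) (a₁ := Y (k + 1)) (w₀ := W k)
      (w₁ := W (k + 1)) (W := dt • ((1 - gam) • Wt k + gam • W (k + 1)))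
      (G := (1 - gam) * e (k * dt, Y k + Complex.I * W k) +
        gam * e (k * dt + (2 - gam) * dt, Yh k + Complex.I * Wh k)) (S := S) ?_ ?_
        ((h k).norm_y'_sub_le hE hdt.le (hnt k)) (bW k hk.le) (bW (k + 1) hk)
        ((h k).norm_sub_limitStep_le hE hdt.le (hnt k) (bWt k hk) (bW (k + 1) hk))
    · simp only [qd]
      rw [hsucc]
      exact this
    · have hl : (lam : ℂ) ≠ 0 := Complex.ofReal_ne_zero.2 hlam.ne'
      simp only [Complex.real_smul]
      generalize e (k * dt + (2 - gam) * dt, Yh k + Complex.I * Wh k) = g₁ at e1 ⊢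
      push_cast
      field_simp
      linear_combination (-Complex.I) * e1 +
        lam * dt * ((1 - gam) * Wt k + gam * W (k + 1)) * Complex.I_sq
    · refine (norm_convex_gam_le (hE.norm_le _ (hnt k))
        (hE.norm_le _ (later_nonneg hdt.le (hnt k)))).trans_eq ?_
      ring
  have hc : ∀ k < n, ‖qc (k + 1) - limitStep e dt (k * dt) (qc k)‖ ≤
      dt * (5 * B ^ 3 * (dt + S) ^ 2 + R) := by
    intro k hk
    have hk1 : (k : ℝ) * dt + dt ≤ n * dt := by
      rw [← hsucc]
      exact hle hk
    have hdy := hf.norm_y_sub_le hE (hnt k) hdt.le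
    -- `G` is chosen so that -dt i G is the increment of y, which puts λ⁻¹ times the increment of x
    -- in the required form. It is bounded by `B` because y moves at speed at most `B`.
    have := corrected_step hE hlam hdt.le (hnt k) (a₀ := y (k * dt)) (a₁ := y (k * dt + dt))
      (w₀ := w (k * dt)) (w₁ := w (k * dt + dt))
      (G := Complex.I * ((y (k * dt + dt) - y (k * dt)) / dt)) (S := S) rfl ?_
        hdy (bw _ (hnt k) (hle hk.le)) (bw _ (by positivity) hk1)
        (ρ := 5 * B ^ 3 * (dt + S) ^ 2) ?_
    · simp only [qc]
      rw [hsucc]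
      exact this
    · rw [hIn, norm_div, Complex.norm_of_nonneg hdt.le, div_le_iff₀ hdt]
      exact hdy
    · have := hf.norm_sub_limitStep_le hE hlam hdt.le (hnt k) (S := S)
        (fun s hs hs' => bw s ((hnt k).trans hs) (hs'.trans hk1))
      have hdt' : (dt : ℂ) ≠ 0 := Complex.ofReal_ne_zero.2 hdt.ne'
      have e2 : Complex.I * w (k * dt + dt) - Complex.I * w (k * dt) -
          dt • (Complex.I * (Complex.I * ((y (k * dt + dt) - y (k * dt)) / dt))) =
          y (k * dt + dt) + Complex.I * w (k * dt + dt) -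
            (y (k * dt) + Complex.I * w (k * dt)) := by
        rw [Complex.real_smul]
        have e3 : (dt : ℂ) * ((y (k * dt + dt) - y (k * dt)) / dt) =
          y (k * dt + dt) - y (k * dt) := mul_div_cancel₀ _ hdt'
        linear_combination (-Complex.I ^ 2) * e3 -
          (y (k * dt + dt) - y (k * dt)) * Complex.I_sq
      rw [e2]
      exact this
  set r := 9 * B ^ 3 * (dt + S) ^ 2 + 2 * R with hr
  have hr0 : 0 ≤ r := by positivity
  have hstep : ∀ k < n, ‖qd (k + 1) - qc (k + 1)‖ ≤
      Real.exp (2 * (K * dt)) * (‖qd k - qc k‖ + dt * r) := by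
    intro k hk
    have h1 := limitStep_lip hE hdt.le (hnt k) (qd k) (qc k)
    have h2 := hd k hk
    have h3 := hc k hk
    set δ := ‖qd k - qc k‖ with hδ
    have e1 : qd (k + 1) - qc (k + 1) = (qd (k + 1) - limitStep e dt (k * dt) (qd k)) -
      (qc (k + 1) - limitStep e dt (k * dt) (qc k)) +
      (limitStep e dt (k * dt) (qd k) - limitStep e dt (k * dt) (qc k) - (qd k - qc k)) +
      (qd k - qc k) := by ring
    have h4 : ‖qd (k + 1) - qc (k + 1)‖ ≤ dt * (4 * B ^ 3 * (dt + S) ^ 2 + R) +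
        dt * (5 * B ^ 3 * (dt + S) ^ 2 + R) + K * dt * (1 + K * dt) * δ + δ := by
      rw [e1]
      refine norm_add₃_le.trans ?_
      gcongr
      exact (norm_sub_le _ _).trans (add_le_add h2 h3)
    have h5 : 1 + K * dt * (1 + K * dt) ≤ Real.exp (2 * (K * dt)) := by
      have := Real.quadratic_le_exp_of_nonneg (by positivity : 0 ≤ 2 * (K * dt))
      nlinarith [sq_nonneg (K * dt), mul_nonneg hK hdt.le]
    have h6 : dt * r ≤ Real.exp (2 * (K * dt)) * (dt * r) :=
      le_mul_of_one_le_left (by positivity) (Real.one_le_exp (by positivity))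
    have h7 : (1 + K * dt * (1 + K * dt)) * δ ≤ Real.exp (2 * (K * dt)) * δ := by gcongr
    have e2 : dt * r = dt * (4 * B ^ 3 * (dt + S) ^ 2 + R) +
      dt * (5 * B ^ 3 * (dt + S) ^ 2 + R) := by rw [hr]; ring
    linarith
  have hg := discrete_gronwall (a := fun k => ‖qd k - qc k‖) (c := 2 * (K * dt)) (r := dt * r)
    (by positivity) (by positivity) hstep n le_rfl
  have h0 : ‖qd 0 - qc 0‖ = 0 := by
    simp only [qd, qc]
    rw [hy, hw]
    simp
  simp only [h0, zero_add] at hg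
  have hcorr : ∀ (a v : ℂ), ‖v‖ ≤ S → ‖lam⁻¹ • drift D (n * dt, a) (Complex.I * v)‖ ≤ B * S / lam := by
    intro a v hv
    rw [norm_smul, Real.norm_of_nonneg (inv_nonneg.2 hlam.le), mul_comm, ← div_eq_mul_inv]
    gcongr
    refine (hE.norm_drift_le (hnt n) _).trans ?_
    rw [hIn]
    gcongr
  have c1 := hcorr (Y n) (W n) (bW n le_rfl)
  have c2 := hcorr (y (n * dt)) (w (n * dt)) (bw _ (hnt n) le_rfl)
  have e1 : Y n - y (n * dt) = (qd n - qc n) + lam⁻¹ • drift D (n * dt, Y n) (Complex.I * W n) -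
      lam⁻¹ • drift D (n * dt, y (n * dt)) (Complex.I * w (n * dt)) := by
    simp only [qd, qc]
    ring
  rw [e1]
  refine (norm_sub_le _ _).trans ((add_le_add_left (norm_add_le _ _) _).trans ?_)
  have e2 : Real.exp (2 * (K * dt) * n) * (n * (dt * r)) =
      Real.exp (2 * K * (n * dt)) * (n * dt * r) := by
    congr 1
    · congr 1; ring
    · ring
  have e3 : 2 * B * S / lam = B * S / lam + B * S / lam := by ring
  linarith

end

/-! ### Local truncation error -/

section

variable {B K lam dt t : ℝ} {e : ℝ × ℂ → ℂ} {D : ℝ × ℂ → ℝ × ℂ →L[ℝ] ℂ}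

/-- Taylor estimates along the flow at the time `t`, where `x' = lam w` and `P` bounds the
velocities: for the force, for `w` and `y` at first order, and at second order. -/
theorem IsFlow.taylor (hE : FieldBounds B K e D) (hlam : 0 < lam) (ht : 0 ≤ t) {y w : ℝ → ℂ}
    (hf : IsFlow e lam y w) {H S P Q : ℝ} (hS : ∀ s, t ≤ s → s ≤ t + H → ‖w s‖ ≤ S)
    (hP : P = B * (1 + lam * S)) (hQ : Q = B * (P ^ 2 + 2 * lam * P + lam ^ 2 * P))
    {f₀ f₁ v₀ : ℂ} (hf₀ : f₀ = e (t, y t + Complex.I * w t))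
    (hf₁ : f₁ = D (t, y t + Complex.I * w t) (1, lam * w t))
    (hv₀ : v₀ = f₀ - Complex.I * lam * w t) {h : ℝ} (h0 : 0 ≤ h) (hH : h ≤ H) :
    ‖v₀‖ ≤ P ∧ ‖w (t + h) - w t‖ ≤ h * P ∧
    ‖e (t + h, y (t + h) + Complex.I * w (t + h)) - f₀ - h * f₁‖ ≤
      h ^ 2 * (B * P ^ 2 + B * lam * P) ∧
    ‖w (t + h) - w t - h * v₀‖ ≤ h ^ 2 * (P * (1 + lam)) ∧
    ‖y (t + h) - y t + h * (Complex.I * f₀)‖ ≤ h ^ 2 * P ∧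
    ‖w (t + h) - w t - h * v₀ - h ^ 2 / 2 * (f₁ - Complex.I * lam * v₀)‖ ≤ h ^ 3 * Q ∧
    ‖y (t + h) - y t + h * (Complex.I * f₀) + h ^ 2 / 2 * (Complex.I * f₁)‖ ≤ h ^ 3 * Q := by
  have hB := hE.one_le
  have hB0 := hE.B_nonneg
  have hK := hE.K_nonneg
  have hKB := hE.K_le
  have hS0 : 0 ≤ S := (norm_nonneg _).trans (hS t le_rfl (by linarith))
  have hlS : 0 ≤ lam * S := by positivity
  have hBP : B ≤ P := by rw [hP]; nlinarith
  have hP1 : 1 ≤ P := hB.trans hBP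
  have hP0 : 0 ≤ P := by linarith
  have hlSP : lam * S ≤ P := by rw [hP]; nlinarith
  have hIn : ∀ z : ℂ, ‖Complex.I * z‖ = ‖z‖ := fun z => by simp
  have hln : ∀ z : ℂ, ‖(lam : ℂ) * z‖ = lam * ‖z‖ := fun z => by
    rw [norm_mul, Complex.norm_of_nonneg hlam.le]
  have hxd : ∀ s, 0 ≤ s → HasDerivWithinAt (fun s => y s + Complex.I * w s) (lam * w s)
      (Set.Ici 0) s := by
    intro s hs
    refine ((hf.deriv_y s hs).add ((hf.deriv_w s hs).const_mul Complex.I)).congr_deriv ?_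
    linear_combination (-lam * w s) * Complex.I_sq
  have hv : ∀ s, t ≤ s → s ≤ t + H →
      ‖e (s, y s + Complex.I * w s) - Complex.I * lam * w s‖ ≤ P := by
    intro s hs hs'
    refine (norm_sub_le _ _).trans ?_
    rw [mul_assoc, hIn, hln]
    have h1 := hE.norm_le (s, y s + Complex.I * w s) (ht.trans hs)
    have h2 : lam * ‖w s‖ ≤ lam * S := by gcongr; exact hS s hs hs'
    have h3 : lam * S ≤ B * (lam * S) := le_mul_of_one_le_left hlS hB
    rw [hP]
    linarith
  have dx : ∀ s, 0 ≤ s → s ≤ H →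
      ‖y (t + s) + Complex.I * w (t + s) - (y t + Complex.I * w t)‖ ≤ s * (lam * S) := by
    intro s hs hsH
    have := norm_taylor_le_of_deriv hxd ht hs 0 0 (C := lam * S) (fun r hr hrs => by
      rw [sub_zero, mul_zero, sub_zero, hln]
      gcongr
      exact hS _ (by linarith) (by linarith))
    simpa using this
  have df : ∀ s, 0 ≤ s → s ≤ H →
      ‖e (t + s, y (t + s) + Complex.I * w (t + s)) - f₀‖ ≤ s * P := by
    intro s hs hsH
    rw [hf₀]
    refine (hE.lip ht (add_nonneg ht hs) _ _).trans ?_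
    rw [add_sub_cancel_left, abs_of_nonneg hs]
    have : K * ‖y (t + s) + Complex.I * w (t + s) - (y t + Complex.I * w t)‖ ≤
        B * (s * (lam * S)) := by
      gcongr
      exact dx s hs hsH
    rw [hP]
    linarith
  have dw : ∀ s, 0 ≤ s → s ≤ H → ‖w (t + s) - w t‖ ≤ s * P := by
    intro s hs hsH
    have := norm_taylor_le_of_deriv hf.deriv_w ht hs 0 0 (C := P) (fun r hr hrs => by
      rw [sub_zero, mul_zero, sub_zero]
      exact hv _ (by linarith) (by linarith))
    simpa using this
  have dx1 : ∀ s, 0 ≤ s → s ≤ H → ‖y (t + s) + Complex.I * w (t + s) -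
      (y t + Complex.I * w t) - s * (lam * w t)‖ ≤ s ^ 2 * (lam * P) := by
    intro s hs hsH
    have := norm_taylor_le_of_deriv hxd ht hs (lam * w t) 0 (C := s * (lam * P))
      (fun r hr hrs => by
        rw [mul_zero, sub_zero, ← mul_sub, hln]
        have h1 := dw r hr (hrs.trans hsH)
        calc lam * ‖w (t + r) - w t‖ ≤ lam * (s * P) := by
              gcongr
              exact h1.trans (by gcongr)
          _ = _ := by ring)
    rw [mul_zero, sub_zero] at this
    exact this.trans_eq (by ring)
  have df1 : ∀ s, 0 ≤ s → s ≤ H →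
      ‖e (t + s, y (t + s) + Complex.I * w (t + s)) - f₀ - s * f₁‖ ≤
        s ^ 2 * (B * P ^ 2 + B * lam * P) := by
    intro s hs hsH
    set x := y t + Complex.I * w t with hx
    set x' := y (t + s) + Complex.I * w (t + s) with hx'
    have e1 : e (t + s, x') - f₀ - s * f₁ =
        (e (t + s, x') - e (t, x) - D (t, x) ((t + s, x') - (t, x))) +
          D (t, x) (0, x' - x - s * (lam * w t)) := by
      have e2 : (s : ℂ) * f₁ = D (t, x) (s • (1, lam * w t)) := by
        rw [map_smul, Complex.real_smul, hf₁]
      have e3 : D (t, x) ((t + s, x') - (t, x)) = D (t, x) (s • (1, lam * w t)) +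
          D (t, x) (0, x' - x - s * (lam * w t)) := by
        rw [← map_add]
        congr 1
        ext1
        · simp
        · simp
      rw [e2, e3, hf₀]
      ring
    rw [e1]
    have h1 := hE.taylor (t, x) (t + s, x') ht (add_nonneg ht hs)
    have h2 : ‖((t + s, x') : ℝ × ℂ) - (t, x)‖ ≤ s * P := by
      rw [Prod.norm_def]
      refine max_le ?_ ?_
      · simp only [Prod.fst_sub, add_sub_cancel_left]
        rw [Real.norm_of_nonneg hs]
        exact le_mul_of_one_le_right hs hP1
      · exact (dx s hs hsH).trans (by gcongr)
    have h3 := hE.norm_deriv_inr_le (t, x) ht (x' - x - s * (lam * w t))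
    have h4 := dx1 s hs hsH
    have h5 : B * ‖((t + s, x') : ℝ × ℂ) - (t, x)‖ ^ 2 ≤ B * (s * P) ^ 2 := by gcongr
    have h6 : K * ‖x' - x - s * (lam * w t)‖ ≤ B * (s ^ 2 * (lam * P)) := by gcongr
    refine (norm_add_le _ _).trans ?_
    linarith
  have dw1 : ∀ s, 0 ≤ s → s ≤ H → ‖w (t + s) - w t - s * v₀‖ ≤ s ^ 2 * (P * (1 + lam)) := by
    intro s hs hsH
    have := norm_taylor_le_of_deriv hf.deriv_w ht hs v₀ 0 (C := s * (P * (1 + lam)))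
      (fun r hr hrs => by
        have e1 : e (t + r, y (t + r) + Complex.I * w (t + r)) -
            Complex.I * lam * w (t + r) - v₀ - r * 0 =
            (e (t + r, y (t + r) + Complex.I * w (t + r)) - f₀) -
              Complex.I * (lam * (w (t + r) - w t)) := by rw [hv₀]; ring
        rw [e1]
        refine (norm_sub_le _ _).trans ?_
        rw [hIn, hln]
        have h1 := df r hr (hrs.trans hsH)
        have h2 := dw r hr (hrs.trans hsH)
        calc _ ≤ r * P + lam * (r * P) := by gcongr
          _ = r * (P * (1 + lam)) := by ring
          _ ≤ _ := by gcongr)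
    rw [mul_zero, sub_zero] at this
    exact this.trans_eq (by ring)
  have hQ1 : B * P ^ 2 + B * lam * P ≤ Q := by
    rw [hQ]
    have : 0 ≤ B * lam * P := by positivity
    have : 0 ≤ B * lam ^ 2 * P := by positivity
    linarith
  have hQ2 : B * P ^ 2 + B * lam * P + lam * (P * (1 + lam)) ≤ Q := by
    rw [hQ]
    have h1 : 0 ≤ lam * P := by positivity
    have h2 : 0 ≤ lam ^ 2 * P := by positivity
    have := le_mul_of_one_le_left h1 hB
    have := le_mul_of_one_le_left h2 hB
    linarith
  refine ⟨?_, dw h h0 hH, df1 h h0 hH, dw1 h h0 hH, ?_, ?_, ?_⟩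
  · rw [hv₀, hf₀]
    exact hv t le_rfl (by linarith)
  · have := norm_taylor_le_of_deriv hf.deriv_y ht h0 (-(Complex.I * f₀)) 0 (C := h * P)
      (fun r hr hrs => by
        have e1 : -(Complex.I * e (t + r, y (t + r) + Complex.I * w (t + r))) -
            -(Complex.I * f₀) - r * 0 =
            -(Complex.I * (e (t + r, y (t + r) + Complex.I * w (t + r)) - f₀)) := by ring
        rw [e1, norm_neg, hIn]
        exact (df r hr (hrs.trans hH)).trans (by gcongr))
    rw [mul_zero, sub_zero, mul_neg, sub_neg_eq_add] at this
    exact this.trans_eq (by ring)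
  · have := norm_taylor_le_of_deriv hf.deriv_w ht h0 v₀ (f₁ - Complex.I * lam * v₀)
      (C := h ^ 2 * Q) (fun r hr hrs => by
        have e1 : e (t + r, y (t + r) + Complex.I * w (t + r)) -
            Complex.I * lam * w (t + r) - v₀ - r * (f₁ - Complex.I * lam * v₀) =
            (e (t + r, y (t + r) + Complex.I * w (t + r)) - f₀ - r * f₁) -
              Complex.I * (lam * (w (t + r) - w t - r * v₀)) := by rw [hv₀]; ring
        rw [e1]
        refine (norm_sub_le _ _).trans ?_
        rw [hIn, hln]
        have h1 := df1 r hr (hrs.trans hH)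
        have h2 := dw1 r hr (hrs.trans hH)
        calc _ ≤ r ^ 2 * (B * P ^ 2 + B * lam * P) + lam * (r ^ 2 * (P * (1 + lam))) := by gcongr
          _ = r ^ 2 * (B * P ^ 2 + B * lam * P + lam * (P * (1 + lam))) := by ring
          _ ≤ h ^ 2 * Q := by gcongr)
    exact this.trans_eq (by ring)
  · have := norm_taylor_le_of_deriv hf.deriv_y ht h0 (-(Complex.I * f₀)) (-(Complex.I * f₁))
      (C := h ^ 2 * Q) (fun r hr hrs => by
        have e1 : -(Complex.I * e (t + r, y (t + r) + Complex.I * w (t + r))) -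
            -(Complex.I * f₀) - r * -(Complex.I * f₁) =
            -(Complex.I * (e (t + r, y (t + r) + Complex.I * w (t + r)) - f₀ - r * f₁)) := by ring
        rw [e1, norm_neg, hIn]
        refine (df1 r hr (hrs.trans hH)).trans ?_
        gcongr)
    rw [mul_neg, sub_neg_eq_add, mul_neg, sub_neg_eq_add] at this
    exact this.trans_eq (by ring)

set_option maxHeartbeats 1000000 in
/-- The local truncation error of the scheme. -/
theorem ImexStep.local_error (hE : FieldBounds B K e D) (hlam : 0 < lam) (hdt : 0 ≤ dt)
    (ht : 0 ≤ t) {y w : ℝ → ℂ} (hf : IsFlow e lam y w) {wt yh wh y' w' : ℂ}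
    (h : ImexStep e lam dt t (y t) (w t) wt yh wh y' w') {S P Q : ℝ}
    (hS : ∀ s, t ≤ s → s ≤ t + 2 * dt → ‖w s‖ ≤ S)
    (hP : P = B * (1 + lam * S)) (hQ : Q = B * (P ^ 2 + 2 * lam * P + lam ^ 2 * P)) :
    ‖y' - y (t + dt)‖ + ‖w' - w (t + dt)‖ ≤ 20 * dt ^ 3 * Q * (1 + K * dt) := by
  have hγ := gam_bounds
  have hγ2 : (gam : ℂ) ^ 2 = 2 * gam - 1 / 2 := by
    have := congrArg (fun r : ℝ => (r : ℂ)) gam_sq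
    push_cast at this
    exact this
  have hB := hE.one_le
  have hB0 := hE.B_nonneg
  have hK := hE.K_nonneg
  have hKB := hE.K_le
  have hS0 : 0 ≤ S := (norm_nonneg _).trans (hS t le_rfl (by linarith))
  have hlS : 0 ≤ lam * S := by positivity
  have hBP : B ≤ P := by rw [hP]; nlinarith
  have hP1 : 1 ≤ P := hB.trans hBP
  have hP0 : 0 ≤ P := by linarith
  have hIn : ∀ z : ℂ, ‖Complex.I * z‖ = ‖z‖ := fun z => by simp
  have ht' := later_nonneg hdt ht
  have hκ0 : 0 ≤ (2 - gam) * dt := mul_nonneg (by linarith) hdt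
  have hκ2 : (2 - gam) * dt ≤ 2 * dt := by gcongr; linarith
  set x := y t + Complex.I * w t with hx
  set f₀ := e (t, x) with hf₀
  set f₁ := D (t, x) (1, lam * w t) with hf₁
  set v₀ := f₀ - Complex.I * lam * w t with hv₀
  -- Two sets of expansions are needed: at the end of the step, and at the intermediate time t + (2
  -- - γ)dt, which exceeds t + dt; hence the horizon 2 dt.
  obtain ⟨bv₀, bdw, -, br₂, -, br₃, bry⟩ :=
    hf.taylor hE hlam ht (H := 2 * dt) hS hP hQ hf₀ hf₁ hv₀ hdt (by linarith)
  obtain ⟨-, -, bf, bwκ, byκ, -, -⟩ :=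
    hf.taylor hE hlam ht (H := 2 * dt) hS hP hQ hf₀ hf₁ hv₀ hκ0 hκ2
  have hκsq : ((2 - gam) * dt) ^ 2 ≤ 4 * dt ^ 2 := by
    calc _ ≤ (2 * dt) ^ 2 := by gcongr
      _ = _ := by ring
  set t' := t + (2 - gam) * dt with ht'def
  set M := B * P ^ 2 + B * lam * P with hM
  have hM0 : 0 ≤ M := by positivity
  have hlP : 0 ≤ lam * P := by positivity
  have hl2P : 0 ≤ lam ^ 2 * P := by positivity
  have hBlP : lam * P ≤ B * lam * P := by
    rw [mul_assoc]
    exact le_mul_of_one_le_left hlP hB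
  have hQM : M + (lam * P + lam ^ 2 * P) ≤ Q := by
    rw [hQ, hM]
    have := le_mul_of_one_le_left hl2P hB
    linarith
  have hQ0 : 0 ≤ Q := by linarith
  have hBPP : B * P ≤ B * P ^ 2 := by
    gcongr
    exact le_self_pow₀ hP1 (by norm_num)
  have hKBP : K * (B * P) ≤ B * P ^ 2 := by
    calc K * (B * P) ≤ P * (B * P) := by gcongr; linarith
      _ = _ := by ring
  have hKP : K * P ≤ B * P := by gcongr
  have hKlP : K * (lam * P) ≤ B * lam * P := by
    rw [mul_assoc B]
    gcongr
  set d := implicitFactor lam dt with hd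
  have hd0 : d ≠ 0 := implicitFactor_ne_zero lam dt
  have hd1 : 1 ≤ ‖d‖ := one_le_norm_implicitFactor lam dt
  have hdef : d = 1 + Complex.I * (gam * lam * dt) := by
    rw [hd, implicitFactor]; push_cast; ring
  -- `v` is the slope common to the first two stages: the exact slope `v₀` filtered by the implicit
  -- solve. It differs from `v₀` by order λ dt.
  set v := v₀ / d with hvdef
  have hdv : d * v = v₀ := mul_div_cancel₀ _ hd0
  have bv : ‖v‖ ≤ P := by
    rw [hvdef, norm_div]
    exact (div_le_self (norm_nonneg _) hd1).trans bv₀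
  have hwt : wt = w t + gam * dt * v := by
    refine mul_left_cancel₀ hd0 ?_
    rw [mul_add, h.linearStages.factor_mul_wt]
    linear_combination (-gam * dt) * hdv - w t * hdef
  have hvv : f₀ - Complex.I * lam * wt = v := by
    rw [hwt]
    linear_combination -hdv + v * hdef
  have hvd : v - v₀ = -(Complex.I * ((gam * lam * dt : ℝ) * v)) := by
    push_cast
    linear_combination hdv - v * hdef
  have bvd : ‖v - v₀‖ ≤ dt * (lam * P) := by
    rw [hvd, norm_neg, norm_I_mul_ofReal, abs_of_nonneg (by have := hγ.1; positivity)]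
    calc gam * lam * dt * ‖v‖ ≤ 1 * lam * dt * P := by gcongr; linarith
      _ = _ := by ring
  -- the intermediate stages
  have bwh : ‖wh - w t'‖ ≤ 5 * dt ^ 2 * (P * (1 + lam)) := by
    have e1 : wh - w t' = ((2 - gam) * dt : ℝ) * (v - v₀) -
        (w t' - w t - ((2 - gam) * dt : ℝ) * v₀) := by
      rw [h.wh_eq, hvv]; push_cast; ring
    rw [e1, hvd]
    refine (norm_sub_le _ _).trans ?_
    rw [norm_mul, norm_neg, norm_I_mul_ofReal, Complex.norm_of_nonneg hκ0,
      abs_of_nonneg (by have := hγ.1; positivity)]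
    have e2 : (2 - gam) * dt * (gam * lam * dt * ‖v‖) = dt ^ 2 * (lam * ‖v‖) / 2 := by
      linear_combination (-dt ^ 2 * lam * ‖v‖) * gam_sq
    rw [e2]
    have h1 : dt ^ 2 * (lam * ‖v‖) / 2 ≤ dt ^ 2 * (lam * P) := by
      have : dt ^ 2 * (lam * ‖v‖) ≤ dt ^ 2 * (lam * P) := by gcongr
      have : 0 ≤ dt ^ 2 * (lam * P) := by positivity
      linarith
    have h2 : ((2 - gam) * dt) ^ 2 * (P * (1 + lam)) ≤ 4 * dt ^ 2 * (P * (1 + lam)) := by gcongr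
    have : 0 ≤ dt ^ 2 * P := by positivity
    linarith
  have byh : ‖yh - y t'‖ ≤ 5 * dt ^ 2 * (B * P) := by
    have e1 : yh - y t' = -(Complex.I * (((2 - gam) * dt : ℝ) *
        (e (t, y t + Complex.I * wt) - f₀))) -
        (y t' - y t + ((2 - gam) * dt : ℝ) * (Complex.I * f₀)) := by
      rw [h.yh_eq]; push_cast; ring
    rw [e1]
    refine (norm_sub_le _ _).trans ?_
    rw [norm_neg, norm_I_mul_dt_mul hκ0]
    have h1 := hE.lip_space ht x (y t + Complex.I * wt)
    have e2 : y t + Complex.I * wt - x = Complex.I * ((gam * dt : ℝ) * v) := by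
      rw [hx, hwt]; push_cast; ring
    rw [e2, norm_I_mul_dt_mul (mul_nonneg (by linarith) hdt)] at h1
    have h2 : (2 - gam) * dt * ‖e (t, y t + Complex.I * wt) - f₀‖ ≤ dt ^ 2 * (B * P) := by
      calc _ ≤ (2 - gam) * dt * (K * (gam * dt * ‖v‖)) := by gcongr
        _ = dt ^ 2 * (K * ‖v‖) / 2 := by
          linear_combination (-dt ^ 2 * K * ‖v‖) * gam_sq
        _ ≤ dt ^ 2 * (K * ‖v‖) := half_le_self (by positivity)
        _ ≤ _ := by gcongr
    have h3 : ((2 - gam) * dt) ^ 2 * P ≤ 4 * dt ^ 2 * (B * P) := by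
      have : P ≤ B * P := le_mul_of_one_le_left hP0 hB
      gcongr
    linarith
  set g₁ := e (t', yh + Complex.I * wh) with hg₁
  have bg₁ : ‖g₁ - f₀ - ((2 - gam) * dt : ℝ) * f₁‖ ≤ 14 * dt ^ 2 * M := by
    have h1 := hE.lip_position ht' yh wh (y t') (w t')
    have e1 : g₁ - f₀ - ((2 - gam) * dt : ℝ) * f₁ = (g₁ - e (t', y t' + Complex.I * w t')) +
      (e (t', y t' + Complex.I * w t') - f₀ - ((2 - gam) * dt : ℝ) * f₁) := by ring
    rw [e1]
    refine (norm_add_le _ _).trans ((add_le_add h1 bf).trans ?_)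
    have h2 : K * (‖yh - y t'‖ + ‖wh - w t'‖) ≤
        K * (5 * dt ^ 2 * (B * P) + 5 * dt ^ 2 * (P * (1 + lam))) := by gcongr
    have h3 : ((2 - gam) * dt) ^ 2 * M ≤ 4 * dt ^ 2 * M := by gcongr
    have h4 : dt ^ 2 * (K * (B * P) + K * P + K * (lam * P)) ≤ dt ^ 2 * (2 * M) := by
      gcongr
      linarith
    linarith
  -- the velocity
  have bw' : ‖w' - w (t + dt)‖ ≤ 8 * dt ^ 3 * Q := by
    -- Multiplying by `d`, which only increases the modulus, clears the implicit term. The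
    -- remainders are the defect of the slope, quadratic in γλ dt, the defect of the second force,
    -- and Taylor remainders of w; the dt² terms in `f₁` and λ v₀ cancel by the choice of γ.
    have e1 : d * (w' - w (t + dt)) =
        ((1 - gam : ℝ) * dt : ℝ) * -((gam * lam * dt : ℝ) ^ 2 * v) +
        ((gam * dt : ℝ) * (g₁ - f₀ - ((2 - gam) * dt : ℝ) * f₁)) +
        -(w (t + dt) - w t - dt * v₀ - dt ^ 2 / 2 * (f₁ - Complex.I * lam * v₀)) -
        Complex.I * ((gam * lam * dt : ℝ) * (w (t + dt) - w t - dt * v₀)) := by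
      have e2 := h.w'_eq
      rw [← hx, ← hf₀, hvv] at e2
      have e3 : -((gam * lam * dt : ℝ) ^ 2 * v : ℂ) =
          v - v₀ + Complex.I * ((gam * lam * dt : ℝ) * v₀) := by
        have e4 := hvd
        push_cast at e4 ⊢
        linear_combination -e4 + Complex.I * (gam * lam * dt) * e4 -
          (gam * lam * dt) ^ 2 * v * Complex.I_sq
      rw [e3, hdef]
      push_cast
      linear_combination e2 + dt ^ 2 * (Complex.I * lam * v₀ - f₁) * hγ2 - gam * dt * hv₀
    have n1 : ‖(((1 - gam : ℝ) * dt : ℝ) : ℂ) * -((gam * lam * dt : ℝ) ^ 2 * v)‖ ≤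
        dt ^ 3 * (lam ^ 2 * P) := by
      rw [norm_mul, norm_neg, norm_mul, norm_pow, Complex.norm_of_nonneg
        (mul_nonneg (by linarith) hdt), Complex.norm_of_nonneg (by have := hγ.1; positivity)]
      calc (1 - gam) * dt * ((gam * lam * dt) ^ 2 * ‖v‖) ≤ 1 * dt * ((1 * lam * dt) ^ 2 * P) := by
            have := hγ.1
            gcongr <;> linarith
        _ = _ := by ring
    have n2 : ‖((gam * dt : ℝ) : ℂ) * (g₁ - f₀ - ((2 - gam) * dt : ℝ) * f₁)‖ ≤
        5 * dt ^ 3 * M := by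
      rw [norm_mul, Complex.norm_of_nonneg (mul_nonneg (by linarith) hdt)]
      calc _ ≤ 1 / 3 * dt * (14 * dt ^ 2 * M) := by gcongr; linarith
        _ = 14 / 3 * (dt ^ 3 * M) := by ring
        _ ≤ 5 * (dt ^ 3 * M) := by gcongr; norm_num
        _ = _ := by ring
    have n3 : ‖Complex.I * ((gam * lam * dt : ℝ) * (w (t + dt) - w t - dt * v₀))‖ ≤
        dt ^ 3 * (lam * P + lam ^ 2 * P) := by
      rw [norm_I_mul_ofReal, abs_of_nonneg (by have := hγ.1; positivity)]
      calc _ ≤ 1 * lam * dt * (dt ^ 2 * (P * (1 + lam))) := by gcongr; linarith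
        _ = _ := by ring
    have n4 : ‖w' - w (t + dt)‖ ≤ ‖d * (w' - w (t + dt))‖ := by
      rw [norm_mul]
      exact le_mul_of_one_le_left (norm_nonneg _) hd1
    refine n4.trans ?_
    rw [e1]
    refine (norm_sub_le _ _).trans ((add_le_add norm_add₃_le le_rfl).trans ?_)
    rw [norm_neg]
    have h1 : dt ^ 3 * (7 * (M + (lam * P + lam ^ 2 * P))) ≤ dt ^ 3 * (7 * Q) := by gcongr
    have h2 : 0 ≤ dt ^ 3 * M := by positivity
    have h3 : 0 ≤ dt ^ 3 * (lam * P) := by positivity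
    have h4 : 0 ≤ dt ^ 3 * (lam ^ 2 * P) := by positivity
    linarith
  -- the guiding center
  have hf₁' : f₁ = D (t, x) (1, -(Complex.I * f₀)) + D (t, x) (0, Complex.I * v₀) := by
    rw [hf₁, ← map_add]
    congr 1
    ext1
    · simp
    · simp only [Prod.mk_add_mk, hv₀]
      linear_combination (lam * w t) * Complex.I_sq
  have bT₁ : ‖e (t, y t + Complex.I * wt) - f₀ -
      (gam * dt : ℝ) * D (t, x) (0, Complex.I * v₀)‖ ≤ dt ^ 2 * M := by
    have e2 : y t + Complex.I * wt = x + Complex.I * ((gam * dt : ℝ) * v) := by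
      rw [hx, hwt]; push_cast; ring
    have h1 := hE.taylor_space ht x (Complex.I * ((gam * dt : ℝ) * v))
    rw [norm_I_mul_dt_mul (mul_nonneg (by linarith) hdt)] at h1
    have e1 : e (t, y t + Complex.I * wt) - f₀ - (gam * dt : ℝ) * D (t, x) (0, Complex.I * v₀) =
        (e (t, x + Complex.I * ((gam * dt : ℝ) * v)) - e (t, x) -
          D (t, x) (0, Complex.I * ((gam * dt : ℝ) * v))) +
        D (t, x) (0, Complex.I * ((gam * dt : ℝ) * (v - v₀))) := by
      have e3 : ((gam * dt : ℝ) : ℂ) * D (t, x) (0, Complex.I * v₀) =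
          D (t, x) ((gam * dt) • (0, Complex.I * v₀)) := by
        rw [map_smul, Complex.real_smul]
      have e4 : D (t, x) (0, Complex.I * ((gam * dt : ℝ) * v)) =
          D (t, x) (0, Complex.I * ((gam * dt : ℝ) * (v - v₀))) +
          D (t, x) ((gam * dt) • (0, Complex.I * v₀)) := by
        rw [← map_add]
        congr 1
        ext1
        · simp
        · simp only [Prod.mk_add_mk, Prod.smul_mk, Complex.real_smul]
          ring
      rw [e2, e3, e4]
      ring
    have h2 := hE.norm_deriv_inr_le (t, x) ht (Complex.I * ((gam * dt : ℝ) * (v - v₀)))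
    rw [norm_I_mul_dt_mul (mul_nonneg (by linarith) hdt)] at h2
    rw [e1]
    refine (norm_add_le _ _).trans ((add_le_add h1 h2).trans ?_)
    have h3 : B * (gam * dt * ‖v‖) ^ 2 ≤ B * (1 * dt * P) ^ 2 := by
      have := hγ.1
      gcongr
      linarith
    have h4 : K * (gam * dt * ‖v - v₀‖) ≤ K * (1 * dt * (dt * (lam * P))) := by
      gcongr
      linarith
    have h5 : dt ^ 2 * (K * (lam * P)) ≤ dt ^ 2 * (B * lam * P) := by gcongr
    have e5 : dt ^ 2 * M = B * (1 * dt * P) ^ 2 + dt ^ 2 * (B * lam * P) := by rw [hM]; ring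
    linarith
  have bT₂ : ‖e (t', yh + Complex.I * w') - f₀ -
      (((2 - gam) * dt : ℝ) * D (t, x) (1, -(Complex.I * f₀)) +
        dt * D (t, x) (0, Complex.I * v₀))‖ ≤ 20 * dt ^ 2 * M + 8 * K * dt ^ 3 * Q := by
    -- The last stage pairs a predictor of y at the intermediate time t' with w at t + dt, so the
    -- reference point mixes the two times.
    set z := y t' + Complex.I * w (t + dt) with hz
    have e1 : e (t', yh + Complex.I * w') - f₀ -
        (((2 - gam) * dt : ℝ) * D (t, x) (1, -(Complex.I * f₀)) +
          dt * D (t, x) (0, Complex.I * v₀)) =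
        (e (t', yh + Complex.I * w') - e (t', z)) +
        (e (t', z) - e (t, x) - D (t, x) ((t', z) - (t, x))) +
        D (t, x) (0, (y t' - y t + ((2 - gam) * dt : ℝ) * (Complex.I * f₀)) +
          Complex.I * (w (t + dt) - w t - dt * v₀)) := by
      have e3 : (((2 - gam) * dt : ℝ) : ℂ) * D (t, x) (1, -(Complex.I * f₀)) =
          D (t, x) (((2 - gam) * dt) • (1, -(Complex.I * f₀))) := by
        rw [map_smul, Complex.real_smul]
      have e4 : (dt : ℂ) * D (t, x) (0, Complex.I * v₀) =
          D (t, x) (dt • (0, Complex.I * v₀)) := by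
        rw [map_smul, Complex.real_smul]
      have e5 : D (t, x) ((t', z) - (t, x)) =
          D (t, x) (0, (y t' - y t + ((2 - gam) * dt : ℝ) * (Complex.I * f₀)) +
            Complex.I * (w (t + dt) - w t - dt * v₀)) +
          (D (t, x) (((2 - gam) * dt) • (1, -(Complex.I * f₀))) +
            D (t, x) (dt • (0, Complex.I * v₀))) := by
        rw [← map_add, ← map_add]
        congr 1
        ext1
        · simp [ht'def]
        · simp only [Prod.mk_add_mk, Prod.smul_mk, Complex.real_smul, Prod.mk_sub_mk, hz, hx]
          ring
      rw [e3, e4, e5]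
      ring
    have h1 := hE.lip_position ht' yh w' (y t') (w (t + dt))
    have h2 := hE.taylor (t, x) (t', z) ht ht'
    have h3 := hE.norm_deriv_inr_le (t, x) ht
      ((y t' - y t + ((2 - gam) * dt : ℝ) * (Complex.I * f₀)) +
          Complex.I * (w (t + dt) - w t - dt * v₀))
    have h4 : ‖((t', z) : ℝ × ℂ) - (t, x)‖ ≤ 3 * dt * P := by
      rw [Prod.norm_def]
      refine max_le ?_ ?_
      · simp only [Prod.fst_sub, ht'def, add_sub_cancel_left]
        rw [Real.norm_of_nonneg hκ0]
        nlinarith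
      · change ‖z - x‖ ≤ _
        have := norm_I_mul_sub (y t') (w (t + dt)) (y t) (w t)
        have h5 := hf.norm_y_sub_le hE ht hκ0
        have h6 : B * ((2 - gam) * dt) ≤ P * (2 * dt) := by gcongr
        rw [hz, hx]
        linarith
    have h5 : B * ‖((t', z) : ℝ × ℂ) - (t, x)‖ ^ 2 ≤ B * (3 * dt * P) ^ 2 := by gcongr
    have h6 : ‖(y t' - y t + ((2 - gam) * dt : ℝ) * (Complex.I * f₀)) +
          Complex.I * (w (t + dt) - w t - dt * v₀)‖ ≤ 4 * dt ^ 2 * P + dt ^ 2 * (P * (1 + lam)) := by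
      refine (norm_add_le _ _).trans ?_
      rw [hIn]
      have : ((2 - gam) * dt) ^ 2 * P ≤ 4 * dt ^ 2 * P := by gcongr
      linarith
    have h7 := mul_le_mul_of_nonneg_left h6 hK
    have h8 : K * (‖yh - y t'‖ + ‖w' - w (t + dt)‖) ≤
        K * (5 * dt ^ 2 * (B * P) + 8 * dt ^ 3 * Q) := by gcongr
    rw [e1]
    refine norm_add₃_le.trans ?_
    have h9 : dt ^ 2 * (5 * (K * (B * P)) + 9 * (B * P ^ 2) + 5 * (K * P) + K * (lam * P)) ≤
        dt ^ 2 * (20 * M) := by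
      gcongr
      have : 0 ≤ B * P ^ 2 := by positivity
      have : 0 ≤ B * lam * P := by positivity
      linarith
    linarith
  have by' : ‖y' - y (t + dt)‖ ≤ dt * (8 * dt ^ 2 * Q + 3 * K * dt ^ 3 * Q) + dt ^ 3 * Q := by
    -- Order two requires γ(2 - γ) = 1/2 for the slow part of `f₁` and (1 - γ)γ + γ = 1/2 for the
    -- part due to w. These are the same identity, `hγ2`, and the dt² terms cancel.
    have e1 : y' - y (t + dt) = -(Complex.I * (dt * ((1 - gam) * (e (t, y t + Complex.I * wt) - f₀ -
        (gam * dt : ℝ) * D (t, x) (0, Complex.I * v₀)) + gam * (e (t', yh + Complex.I * w') - f₀ -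
        (((2 - gam) * dt : ℝ) * D (t, x) (1, -(Complex.I * f₀)) +
        dt * D (t, x) (0, Complex.I * v₀)))))) -
        (y (t + dt) - y t + dt * (Complex.I * f₀) + dt ^ 2 / 2 * (Complex.I * f₁)) := by
      rw [h.y'_eq, ← ht'def, hf₁']
      generalize e (t, y t + Complex.I * wt) = E₁
      generalize e (t', yh + Complex.I * w') = E₂
      push_cast
      linear_combination (Complex.I * dt ^ 2 * (D (t, x) (1, -(Complex.I * f₀)) +
        D (t, x) (0, Complex.I * v₀))) * hγ2
    rw [e1]
    refine (norm_sub_le _ _).trans (add_le_add ?_ bry)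
    rw [norm_neg, norm_I_mul_dt_mul hdt]
    refine mul_le_mul_of_nonneg_left ((norm_convex_gam_le bT₁ bT₂).trans ?_) hdt
    have h1 : (1 - gam) * (dt ^ 2 * M) ≤ 1 * (dt ^ 2 * M) := by gcongr; linarith
    have h2 : gam * (20 * dt ^ 2 * M + 8 * K * dt ^ 3 * Q) ≤
        1 / 3 * (20 * dt ^ 2 * M + 8 * K * dt ^ 3 * Q) := by gcongr; linarith
    have h3 : dt ^ 2 * M ≤ dt ^ 2 * Q := by
      gcongr
      linarith
    have h4 : 0 ≤ K * dt ^ 3 * Q := by positivity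
    have h5 : 0 ≤ dt ^ 2 * M := by positivity
    linarith
  have h1 : 0 ≤ dt ^ 3 * Q := by positivity
  have h2 : 0 ≤ K * dt * (dt ^ 3 * Q) := by positivity
  linarith

end

/-! ### Second-order error with a constant depending on the stiffness -/

section

variable {B K lam dt : ℝ} {e : ℝ × ℂ → ℂ} {D : ℝ × ℂ → ℝ × ℂ →L[ℝ] ℂ}

/-- The error of the scheme, of second order in `dt` with a constant that depends on the
stiffness. -/
theorem classical_error (hE : FieldBounds B K e D) (hlam : 0 < lam) (hdt : 0 < dt)
    {Y W Wt Yh Wh : ℕ → ℂ} (h : ∀ n : ℕ,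
      ImexStep e lam dt (n * dt) (Y n) (W n) (Wt n) (Yh n) (Wh n) (Y (n + 1)) (W (n + 1)))
    {y w : ℝ → ℂ} (hf : IsFlow e lam y w) (hy : Y 0 = y 0) (hw : W 0 = w 0) (n : ℕ) {S P Q : ℝ}
    (hS : S = wBound B K lam ‖w 0‖ (2 * (n * dt))) (hP : P = B * (1 + lam * S))
    (hQ : Q = B * (P ^ 2 + 2 * lam * P + lam ^ 2 * P)) :
    ‖Y n - y (n * dt)‖ + ‖W n - w (n * dt)‖ ≤
      Real.exp (36 * K * (n * dt)) * (n * dt * (20 * dt ^ 2 * Q)) := by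
  have hB0 := hE.B_nonneg
  have hK := hE.K_nonneg
  have hnt : ∀ k : ℕ, (0 : ℝ) ≤ k * dt := fun k => by positivity
  have hsucc : ∀ k : ℕ, ((k + 1 : ℕ) : ℝ) * dt = k * dt + dt := fun k => by push_cast; ring
  have bw : ∀ s, 0 ≤ s → s ≤ 2 * (n * dt) → ‖w s‖ ≤ S := fun s hs hsn => by
    rw [hS]
    exact (hf.norm_w_le hE hlam hs).trans (wBound_mono hK hlam (norm_nonneg _) hs hsn)
  have hS0 : 0 ≤ S := (norm_nonneg _).trans (bw 0 le_rfl (by positivity))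
  have hP0 : 0 ≤ P := by rw [hP]; positivity
  have hQ0 : 0 ≤ Q := by rw [hQ]; positivity
  have hstep : ∀ k < n, ‖Y (k + 1) - y ((k + 1 : ℕ) * dt)‖ + ‖W (k + 1) - w ((k + 1 : ℕ) * dt)‖ ≤
      Real.exp (36 * (K * dt)) * (‖Y k - y (k * dt)‖ + ‖W k - w (k * dt)‖ + 20 * dt ^ 3 * Q) := by
    intro k hk
    have hk1 : (k : ℝ) + 1 ≤ n := by exact_mod_cast hk
    -- The local error looks ahead to t + 2 dt, past the final time at the last step; taking `S` at
    -- 2 n dt covers this for every k < n.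
    have hk2 : (k : ℝ) * dt + 2 * dt ≤ 2 * (n * dt) := by
      have h1 : (k : ℝ) + 2 ≤ 2 * n := by
        have := k.cast_nonneg (α := ℝ)
        linarith
      nlinarith
    -- A step of the scheme started on the flow: stability compares the computed step with it, and
    -- the local error compares it with the flow.
    obtain ⟨wt, yh, wh, y', w', hex⟩ := exists_imexStep e lam dt (k * dt) (y (k * dt)) (w (k * dt))
    have h1 := hex.local_error hE hlam hdt.le (hnt k) hf
      (fun s hs hs' => bw s ((hnt k).trans hs) (hs'.trans hk2)) hP hQ
    have h2 := (h k).stability hE hlam hdt.le (hnt k) hex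
    rw [hsucc]
    have h3 := norm_sub_le_norm_sub_add_norm_sub (Y (k + 1)) y' (y (k * dt + dt))
    have h4 := norm_sub_le_norm_sub_add_norm_sub (W (k + 1)) w' (w (k * dt + dt))
    set N := ‖Y k - y (k * dt)‖ + ‖W k - w (k * dt)‖ with hN
    have hN0 : 0 ≤ N := by positivity
    have h5 : Real.exp (35 * (K * dt)) * N ≤ Real.exp (36 * (K * dt)) * N := by
      gcongr
      norm_num
    have h6 : 1 + K * dt ≤ Real.exp (36 * (K * dt)) := by
      have := Real.add_one_le_exp (36 * (K * dt))
      have : 0 ≤ K * dt := by positivity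
      linarith
    have h7 : 20 * dt ^ 3 * Q * (1 + K * dt) ≤
        20 * dt ^ 3 * Q * Real.exp (36 * (K * dt)) := by gcongr
    linarith
  have hg := discrete_gronwall (a := fun k => ‖Y k - y (k * dt)‖ + ‖W k - w (k * dt)‖)
    (c := 36 * (K * dt)) (r := 20 * dt ^ 3 * Q) (by positivity) (by positivity) hstep n le_rfl
  refine hg.trans_eq ?_
  simp only [hy, hw, Nat.cast_zero, zero_mul, sub_self, norm_zero, zero_add]
  congr 1
  · congr 1; ring
  · ring

end

/-! ### From λ, S, P, Q to powers of ε -/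

theorem wBound_le {B K ε V s : ℝ} (hB : 1 ≤ B) (hε : 0 < ε) (hV : 0 ≤ V) (hs : 0 ≤ s) :
    wBound B K (1 / ε ^ 2) (ε * V) s ≤
      8 * B ^ 2 * (Real.exp (17 * K * s) * (1 + s)) * (ε * (V + ε)) := by
  unfold wBound
  have h1 : 8 * B ^ 2 * (1 + s) / (1 / ε ^ 2) = 8 * B ^ 2 * (1 + s) * ε ^ 2 := by field_simp
  have h2 : (1 : ℝ) ≤ 8 * B ^ 2 * (1 + s) := by nlinarith
  have h3 : ε * V ≤ 8 * B ^ 2 * (1 + s) * (ε * V) := le_mul_of_one_le_left (by positivity) h2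
  rw [h1]
  calc _ ≤ Real.exp (17 * K * s) *
        (8 * B ^ 2 * (1 + s) * (ε * V) + 8 * B ^ 2 * (1 + s) * ε ^ 2) := by gcongr
    _ = _ := by ring

/-- Numerical form of the stiff bound: `L` stands for `exp (K t)` and `τ` for `1 + t`. -/
theorem stiff_constant_le {B L τ ε V S P Q : ℝ} (hB : 1 ≤ B) (hL : 1 ≤ L) (hτ : 1 ≤ τ)
    (hε : 0 < ε) (hV : 0 ≤ V) (hS0 : 0 ≤ S) (hS : S ≤ 16 * B ^ 2 * (L ^ 34 * τ) * (ε * (V + ε)))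
    (hP : P = B * (1 + 1 / ε ^ 2 * S))
    (hQ : Q = B * (P ^ 2 + 2 * (1 / ε ^ 2) * P + (1 / ε ^ 2) ^ 2 * P)) :
    Q ≤ 1156 * B ^ 7 * (L ^ 68 * τ ^ 2) *
      ((1 + ε ^ 2 + V ^ 2) * (1 / ε ^ 5 * (1 + ε ^ 3))) := by
  have hB0 : 0 ≤ B := by linarith
  have hL0 : 0 ≤ L := by linarith
  set U := (V + ε) / ε with hU
  have hU1 : 1 ≤ U := by rw [hU, le_div_iff₀ hε]; linarith
  set Z := L ^ 34 * τ with hZ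
  have hZ1 : 1 ≤ Z := one_le_mul_of_one_le_of_one_le (one_le_pow₀ hL) hτ
  set l := 1 / ε ^ 2 with hl
  have hl0 : 0 ≤ l := by positivity
  have hlS : l * S ≤ 16 * B ^ 2 * (Z * U) := by
    calc l * S ≤ l * (16 * B ^ 2 * Z * (ε * (V + ε))) := by gcongr
      _ = _ := by rw [hl, hU]; field_simp
  have hZU : 1 ≤ B ^ 2 * (Z * U) :=
    one_le_mul_of_one_le_of_one_le (one_le_pow₀ hB) (one_le_mul_of_one_le_of_one_le hZ1 hU1)
  have hP0 : 0 ≤ P := by rw [hP]; positivity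
  have hP1 : 1 ≤ P := by
    rw [hP]
    have : 0 ≤ l * S := by positivity
    nlinarith
  have hPle : P ≤ 17 * B ^ 3 * (Z * U) := by
    calc P = B * (1 + l * S) := hP
      _ ≤ B * (B ^ 2 * (Z * U) + 16 * B ^ 2 * (Z * U)) := by gcongr
      _ = _ := by ring
  have h1 : Q ≤ 2 * B * (P ^ 2 + l ^ 2 * P) := by
    -- From 2l ≤ 1 + l² and P ≤ P², the mixed term is absorbed by the other two.
    have h2 : 2 * l * P ≤ P ^ 2 + l ^ 2 * P := by nlinarith [sq_nonneg (l - 1)]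
    have := mul_le_mul_of_nonneg_left h2 hB0
    rw [hQ]
    linarith
  have hZZ : Z ≤ Z ^ 2 := le_self_pow₀ hZ1 (by norm_num)
  have hBB : B ^ 3 ≤ B ^ 6 := pow_le_pow_right₀ hB (by norm_num)
  have h2 : P ^ 2 + l ^ 2 * P ≤ 289 * B ^ 6 * Z ^ 2 * (U ^ 2 + l ^ 2 * U) := by
    have h3 : P ^ 2 ≤ 289 * B ^ 6 * Z ^ 2 * U ^ 2 := by
      calc P ^ 2 ≤ (17 * B ^ 3 * (Z * U)) ^ 2 := by gcongr
        _ = _ := by ring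
    have h4 : l ^ 2 * P ≤ 289 * B ^ 6 * Z ^ 2 * (l ^ 2 * U) := by
      calc l ^ 2 * P ≤ l ^ 2 * (17 * B ^ 3 * (Z * U)) := by gcongr
        _ = 17 * B ^ 3 * Z * (l ^ 2 * U) := by ring
        _ ≤ 289 * B ^ 6 * Z ^ 2 * (l ^ 2 * U) := by
          gcongr
          norm_num
    linarith
  -- U² carries 1/ε² and l² U carries 1/ε⁵, the two terms of (1 + ε³)/ε⁵.
  have h5 : U ^ 2 + l ^ 2 * U ≤ 2 * ((1 + ε ^ 2 + V ^ 2) * (1 / ε ^ 5 * (1 + ε ^ 3))) := by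
    have e1 : U ^ 2 = (V + ε) ^ 2 * (1 / ε ^ 2) := by rw [hU]; field_simp
    have e2 : l ^ 2 * U = (V + ε) * (1 / ε ^ 5) := by rw [hU, hl]; field_simp
    have e3 : 1 / ε ^ 5 * (1 + ε ^ 3) = 1 / ε ^ 5 + 1 / ε ^ 2 := by field_simp
    have h6 : (V + ε) ^ 2 * (1 / ε ^ 2) ≤ 2 * (1 + ε ^ 2 + V ^ 2) * (1 / ε ^ 2) := by
      gcongr
      nlinarith [sq_nonneg (V - ε)]
    have h7 : (V + ε) * (1 / ε ^ 5) ≤ 2 * (1 + ε ^ 2 + V ^ 2) * (1 / ε ^ 5) := by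
      gcongr
      nlinarith [sq_nonneg (V - 1), sq_nonneg (ε - 1)]
    rw [e1, e2, e3]
    linarith
  calc Q ≤ 2 * B * (P ^ 2 + l ^ 2 * P) := h1
    _ ≤ 2 * B * (289 * B ^ 6 * Z ^ 2 * (2 * ((1 + ε ^ 2 + V ^ 2) * (1 / ε ^ 5 * (1 + ε ^ 3))))) := by
      gcongr
      exact h2.trans (by gcongr)
    _ = _ := by rw [hZ]; ring

/-- Numerical form of the uniform bound: `L` stands for `exp (K t)` and `τ` for `1 + t`. -/
theorem uniform_constant_le {B L τ ε V S a t dt : ℝ} (hB : 1 ≤ B) (hL : 1 ≤ L)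
    (hε : 0 < ε) (ht : t ≤ τ) (hτ : 1 ≤ τ)
    (ha0 : 0 ≤ a) (ha : 2 + a ≤ 2 * L) (hS0 : 0 ≤ S)
    (hS : S ≤ 8 * B ^ 2 * (L ^ 17 * τ) * (ε * (V + ε))) :
    L ^ 2 * (t * (9 * B ^ 3 * (dt + S) ^ 2 +
      2 * (B ^ 2 * (1 + (2 + a) * S) / (1 / ε ^ 2)))) + 2 * B * S / (1 / ε ^ 2) ≤
      2402 * B ^ 7 * (L ^ 36 * τ ^ 3 * (1 + ε ^ 2 + V ^ 2) * (ε ^ 2 + dt ^ 2)) := by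
  have hB0 : 0 ≤ B := by linarith
  have hL0 : 0 ≤ L := by linarith
  have hτ0 : 0 ≤ τ := by linarith
  set m := 1 + ε ^ 2 + V ^ 2 with hm
  have hm1 : 1 ≤ m := by rw [hm]; nlinarith [sq_nonneg ε, sq_nonneg V]
  set X := L ^ 17 * τ with hX
  have hX1 : 1 ≤ X := one_le_mul_of_one_le_of_one_le (one_le_pow₀ hL) hτ
  have hBX : 1 ≤ B ^ 4 * X ^ 2 := one_le_mul_of_one_le_of_one_le (one_le_pow₀ hB) (one_le_pow₀ hX1)
  have hVε : (V + ε) ^ 2 ≤ 2 * m := by rw [hm]; nlinarith [sq_nonneg (V - ε)]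
  have hVε' : ε * (V + ε) ≤ 2 * m := by rw [hm]; nlinarith [sq_nonneg (V - ε)]
  have hS1 : S ≤ 16 * B ^ 2 * X * m := by
    calc S ≤ 8 * B ^ 2 * X * (2 * m) := hS.trans (by gcongr)
      _ = _ := by ring
  have hS2 : S ^ 2 ≤ 128 * (B ^ 4 * X ^ 2 * m) * ε ^ 2 := by
    calc S ^ 2 ≤ (8 * B ^ 2 * X * (ε * (V + ε))) ^ 2 := by gcongr
      _ = 64 * B ^ 4 * X ^ 2 * ε ^ 2 * (V + ε) ^ 2 := by ring
      _ ≤ 64 * B ^ 4 * X ^ 2 * ε ^ 2 * (2 * m) := by gcongr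
      _ = _ := by ring
  have h1 : (dt + S) ^ 2 ≤ 256 * (B ^ 4 * X ^ 2 * m) * (ε ^ 2 + dt ^ 2) := by
    have h2 : (dt + S) ^ 2 ≤ 2 * dt ^ 2 + 2 * S ^ 2 := by nlinarith [sq_nonneg (dt - S)]
    have h3 : dt ^ 2 ≤ B ^ 4 * X ^ 2 * m * dt ^ 2 :=
      le_mul_of_one_le_left (by positivity) (one_le_mul_of_one_le_of_one_le hBX hm1)
    have : 0 ≤ B ^ 4 * X ^ 2 * m * dt ^ 2 := by positivity
    linarith
  have h2 : 1 + (2 + a) * S ≤ 33 * (B ^ 2 * L * X * m) := by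
    have h3 : (2 + a) * S ≤ 2 * L * (16 * B ^ 2 * X * m) := by gcongr
    have h4 : 1 ≤ B ^ 2 * L * X * m :=
      one_le_mul_of_one_le_of_one_le (one_le_mul_of_one_le_of_one_le
        (one_le_mul_of_one_le_of_one_le (one_le_pow₀ hB) hL) hX1) hm1
    linarith
  have e1 : ∀ z : ℝ, z / (1 / ε ^ 2) = z * ε ^ 2 := fun z => by field_simp
  rw [e1, e1]
  have hε2 : ε ^ 2 ≤ ε ^ 2 + dt ^ 2 := by nlinarith [sq_nonneg dt]
  set r := ε ^ 2 + dt ^ 2 with hr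
  have hr0 : 0 ≤ r := by positivity
  have hX2 : L * X ≤ L ^ 34 * τ ^ 2 := by
    rw [hX]
    calc L * (L ^ 17 * τ) = L ^ 18 * τ := by ring
      _ ≤ L ^ 34 * τ ^ 2 := by
        gcongr
        · norm_num
        · exact le_self_pow₀ hτ (by norm_num)
  have t1 : 9 * B ^ 3 * (dt + S) ^ 2 ≤ 2304 * B ^ 7 * (L ^ 34 * τ ^ 2 * m * r) := by
    calc _ ≤ 9 * B ^ 3 * (256 * (B ^ 4 * X ^ 2 * m) * r) := by gcongr
      _ = _ := by rw [hX]; ring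
  have t2 : 2 * (B ^ 2 * (1 + (2 + a) * S) * ε ^ 2) ≤ 66 * B ^ 7 * (L ^ 34 * τ ^ 2 * m * r) := by
    calc _ ≤ 2 * (B ^ 2 * (33 * (B ^ 2 * L * X * m)) * r) := by gcongr
      _ = 66 * B ^ 4 * (L * X * m * r) := by ring
      _ ≤ 66 * B ^ 7 * (L ^ 34 * τ ^ 2 * m * r) := by
        gcongr
        norm_num
  have t3 : 2 * B * S * ε ^ 2 ≤ 32 * B ^ 7 * (L ^ 36 * τ ^ 3 * m * r) := by
    calc _ ≤ 2 * B * (16 * B ^ 2 * X * m) * r := by gcongr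
      _ = 32 * B ^ 3 * (X * m * r) := by ring
      _ ≤ 32 * B ^ 7 * (L ^ 36 * τ ^ 3 * m * r) := by
        rw [hX]
        gcongr
        · norm_num
        · norm_num
        · exact le_self_pow₀ hτ (by norm_num)
  calc _ ≤ L ^ 2 * (τ * (2304 * B ^ 7 * (L ^ 34 * τ ^ 2 * m * r) +
        66 * B ^ 7 * (L ^ 34 * τ ^ 2 * m * r))) + 32 * B ^ 7 * (L ^ 36 * τ ^ 3 * m * r) := by
        have : 0 ≤ 9 * B ^ 3 * (dt + S) ^ 2 + 2 * (B ^ 2 * (1 + (2 + a) * S) * ε ^ 2) := by positivity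
        gcongr
    _ = _ := by ring

/-! ### Error bounds with explicit constants -/

section

variable {B K ε V dt : ℝ} {e : ℝ × ℂ → ℂ} {D : ℝ × ℂ → ℝ × ℂ →L[ℝ] ℂ}
  {Y W Wt Yh Wh : ℕ → ℂ} {y w : ℝ → ℂ}

/-- The second-order bound, with negative powers of `ε`. -/
theorem classical_error_le (hE : FieldBounds B K e D) (hε : 0 < ε) (hdt : 0 < dt)
    (h : ∀ n : ℕ, ImexStep e (1 / ε ^ 2) dt (n * dt) (Y n) (W n) (Wt n) (Yh n) (Wh n)
      (Y (n + 1)) (W (n + 1)))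
    (hf : IsFlow e (1 / ε ^ 2) y w) (hy : Y 0 = y 0) (hw : W 0 = w 0) (hV : ‖w 0‖ = ε * V)
    (hV0 : 0 ≤ V) (n : ℕ) :
    ‖Y n - y (n * dt)‖ + ‖W n - w (n * dt)‖ ≤ 23120 * B ^ 7 *
      (Real.exp (104 * K * (n * dt)) * (1 + n * dt) ^ 3 * (1 + ε ^ 2 + V ^ 2) *
        (dt ^ 2 / ε ^ 5 * (1 + ε ^ 3))) := by
  have hB := hE.one_le
  have hB0 := hE.B_nonneg
  have hK := hE.K_nonneg
  have hlam : 0 < 1 / ε ^ 2 := by positivity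
  have ht : (0 : ℝ) ≤ n * dt := by positivity
  have key := classical_error hE hlam hdt h hf hy hw n rfl rfl rfl
  rw [hV] at key
  set t : ℝ := n * dt
  set S := wBound B K (1 / ε ^ 2) (ε * V) (2 * t) with hS
  set L := Real.exp (K * t) with hL
  have hexp : ∀ (k : ℕ) (c : ℝ), c = k * (K * t) → Real.exp c = L ^ k := fun k c hc => by
    rw [hc, Real.exp_nat_mul]
  have hL1 : 1 ≤ L := Real.one_le_exp (by positivity)
  have hτ : 1 ≤ 1 + t := by linarith
  have hS0 : 0 ≤ S := by
    rw [hS, wBound]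
    positivity
  have hSle : S ≤ 16 * B ^ 2 * (L ^ 34 * (1 + t)) * (ε * (V + ε)) := by
    refine (wBound_le hB hε hV0 (by positivity)).trans ?_
    rw [hexp 34 _ (by push_cast; ring)]
    calc 8 * B ^ 2 * (L ^ 34 * (1 + 2 * t)) * (ε * (V + ε)) ≤
        8 * B ^ 2 * (L ^ 34 * (2 * (1 + t))) * (ε * (V + ε)) := by
          gcongr
          linarith
      _ = _ := by ring
  have hQ := stiff_constant_le hB hL1 hτ hε hV0 hS0 hSle rfl rfl
  rw [hexp 104 _ (by push_cast; ring)]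
  rw [hexp 36 _ (by push_cast; ring)] at key
  refine key.trans ?_
  calc _ ≤ L ^ 36 * ((1 + t) * (20 * dt ^ 2 * (1156 * B ^ 7 * (L ^ 68 * (1 + t) ^ 2) *
        ((1 + ε ^ 2 + V ^ 2) * (1 / ε ^ 5 * (1 + ε ^ 3)))))) := by
        gcongr
        linarith
    _ = _ := by ring

/-- The guiding center error, uniformly in `ε`. -/
theorem uniform_error_le (hE : FieldBounds B K e D) (hε : 0 < ε) (hdt : 0 < dt)
    (h : ∀ n : ℕ, ImexStep e (1 / ε ^ 2) dt (n * dt) (Y n) (W n) (Wt n) (Yh n) (Wh n)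
      (Y (n + 1)) (W (n + 1)))
    (hf : IsFlow e (1 / ε ^ 2) y w) (hy : Y 0 = y 0) (hw : W 0 = w 0) (hV : ‖w 0‖ = ε * V)
    (hV0 : 0 ≤ V) (n : ℕ) :
    ‖Y n - y (n * dt)‖ ≤ 2402 * B ^ 7 *
      (Real.exp (36 * K * (n * dt)) * (1 + n * dt) ^ 3 * (1 + ε ^ 2 + V ^ 2) *
        (ε ^ 2 + dt ^ 2)) := by
  have hB := hE.one_le
  have hB0 := hE.B_nonneg
  have hK := hE.K_nonneg
  have hlam : 0 < 1 / ε ^ 2 := by positivity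
  -- For n ≥ 1 one has dt ≤ n dt, which allows K dt to be absorbed in exp(K n dt); n = 0 has no
  -- error.
  rcases Nat.eq_zero_or_pos n with rfl | hn
  · simp only [Nat.cast_zero, zero_mul, hy, sub_self, norm_zero]
    positivity
  have ht : (0 : ℝ) ≤ n * dt := by positivity
  have key := uniform_error hE hlam hdt h hf hy hw n rfl
  have hdt' : dt ≤ n * dt := le_mul_of_one_le_left hdt.le (by exact_mod_cast hn)
  rw [hV] at key
  set t : ℝ := n * dt
  set S := wBound B K (1 / ε ^ 2) (ε * V) t with hS
  set L := Real.exp (K * t) with hL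
  have hexp : ∀ (k : ℕ) (c : ℝ), c = k * (K * t) → Real.exp c = L ^ k := fun k c hc => by
    rw [hc, Real.exp_nat_mul]
  have hL1 : 1 ≤ L := Real.one_le_exp (by positivity)
  have hS0 : 0 ≤ S := by
    rw [hS, wBound]
    positivity
  have hSle := wBound_le (K := K) hB hε hV0 ht
  rw [hexp 17 _ (by push_cast; ring), ← hS] at hSle
  have ha : 2 + K * dt ≤ 2 * L := by
    have h1 : K * dt ≤ K * t := by gcongr
    have h2 := Real.add_one_le_exp (K * t)
    have h3 : 0 ≤ K * t := by positivity
    linarith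
  rw [hexp 36 _ (by push_cast; ring)]
  rw [hexp 2 _ (by push_cast; ring)] at key
  exact key.trans (uniform_constant_le hB hL1 hε (by linarith) (by linarith) (by positivity) ha
    hS0 hSle)

theorem norm_discrete_y_sub_le (hE : FieldBounds B K e D) (hdt : 0 ≤ dt) {lam : ℝ}
    (h : ∀ n : ℕ, ImexStep e lam dt (n * dt) (Y n) (W n) (Wt n) (Yh n) (Wh n)
      (Y (n + 1)) (W (n + 1))) (n : ℕ) : ‖Y n - Y 0‖ ≤ B * (n * dt) := by
  induction n with
  | zero => simp
  | succ n ih =>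
    have h1 := (h n).norm_y'_sub_le hE hdt (by positivity)
    have h2 := norm_sub_le_norm_sub_add_norm_sub (Y (n + 1)) (Y n) (Y 0)
    push_cast
    linarith

/-- The error on position and velocity, uniformly in `ε`. -/
theorem uniform_error_add_le (hE : FieldBounds B K e D) (hε : 0 < ε) (hdt : 0 < dt)
    (h : ∀ n : ℕ, ImexStep e (1 / ε ^ 2) dt (n * dt) (Y n) (W n) (Wt n) (Yh n) (Wh n)
      (Y (n + 1)) (W (n + 1)))
    (hf : IsFlow e (1 / ε ^ 2) y w) (hy : Y 0 = y 0) (hw : W 0 = w 0) (hV : ‖w 0‖ = ε * V)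
    (hV0 : 0 ≤ V) (n : ℕ) :
    ‖Y n - y (n * dt)‖ + ‖W n - w (n * dt)‖ ≤ 2434 * B ^ 7 *
      (Real.exp (36 * K * (n * dt)) * (1 + n * dt) ^ 3 * (1 + ε ^ 2 + V ^ 2) *
        (ε + dt ^ 2)) := by
  have hB := hE.one_le
  have hB0 := hE.B_nonneg
  have hK := hE.K_nonneg
  have hlam : 0 < 1 / ε ^ 2 := by positivity
  have ht : (0 : ℝ) ≤ n * dt := by positivity
  have h1 := uniform_error_le hE hε hdt h hf hy hw hV hV0 n
  have h2 := (norm_discrete_w_le hE hlam hdt.le h n).1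
  have h3 := hf.norm_w_le hE hlam ht
  have h4 := norm_discrete_y_sub_le hE hdt.le h n
  have h5 := hf.norm_y_sub_le hE le_rfl ht
  have hSle := wBound_le (K := K) hB hε hV0 ht
  rw [zero_add] at h5
  rw [hw] at h2
  rw [hV] at h2 h3
  set t : ℝ := n * dt
  set m := 1 + ε ^ 2 + V ^ 2 with hm
  have hm1 : 1 ≤ m := by rw [hm]; nlinarith [sq_nonneg ε, sq_nonneg V]
  have hVm : V + ε ≤ m := by
    rw [hm]
    nlinarith [sq_nonneg (V - 1 / 2), sq_nonneg (ε - 1 / 2)]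
  have hτ : 1 ≤ 1 + t := by linarith
  set N := Real.exp (36 * K * t) * (1 + t) ^ 3 * m with hN
  have hexp : Real.exp (17 * K * t) ≤ Real.exp (36 * K * t) := by
    gcongr
    norm_num
  have hexp1 : 1 ≤ Real.exp (36 * K * t) := Real.one_le_exp (by positivity)
  -- No cancellation between the two velocities is sought: each is small by itself, and this is the
  -- term of order ε.
  have hW : ‖W n - w t‖ ≤ 16 * B ^ 7 * (N * ε) := by
    calc ‖W n - w t‖ ≤ 2 * (8 * B ^ 2 * (Real.exp (17 * K * t) * (1 + t)) * (ε * (V + ε))) := by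
          have := norm_sub_le (W n) (w t)
          linarith
      _ ≤ 2 * (8 * B ^ 7 * (Real.exp (36 * K * t) * (1 + t) ^ 3) * (ε * m)) := by
          gcongr
          · norm_num
          · exact le_self_pow₀ hτ (by norm_num)
      _ = _ := by rw [hN]; ring
  have hN0 : 0 ≤ N := by positivity
  have hB7 : 0 ≤ B ^ 7 := by positivity
  have hY : ‖Y n - y t‖ ≤ 2402 * B ^ 7 * (N * (ε + dt ^ 2)) := by
    rcases le_total ε 1 with hε1 | hε1
    · refine h1.trans ?_
      gcongr
      nlinarith
    -- For ε ≥ 1 the bound in ε² no longer gives one in ε. Instead, both guiding centers move at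
    -- speed at most `B`, and 2 B t suffices because ε + dt² ≥ 1.
    · have h6 : ‖Y n - y t‖ ≤ 2 * B * t := by
        have := norm_sub_le_norm_sub_add_norm_sub (Y n) (Y 0) (y t)
        rw [norm_sub_rev (Y 0), hy] at this
        rw [hy] at h4
        linarith
      have h7 : t ≤ N * (ε + dt ^ 2) := by
        have a1 : t ≤ (1 + t) ^ 3 := (by linarith : t ≤ 1 + t).trans
          (le_self_pow₀ hτ (by norm_num))
        have a2 : (1 + t) ^ 3 ≤ N := by
          rw [hN, mul_right_comm]
          exact le_mul_of_one_le_left (by positivity)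
            (one_le_mul_of_one_le_of_one_le hexp1 hm1)
        have a3 : N ≤ N * (ε + dt ^ 2) :=
          le_mul_of_one_le_right hN0 (by nlinarith [sq_nonneg dt])
        linarith
      calc ‖Y n - y t‖ ≤ 2 * B * t := h6
        _ ≤ 2402 * B ^ 7 * (N * (ε + dt ^ 2)) := by
          gcongr
          · norm_num
          · exact le_self_pow₀ hB (by norm_num)
  have hdt2 : 0 ≤ 16 * B ^ 7 * (N * dt ^ 2) := by positivity
  have hpos : 0 ≤ 16 * B ^ 7 * (N * (ε + dt ^ 2)) := by positivity
  linarith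

end

/-! ### Return to the plane and conclusion -/

/-- The data of a characteristic and of a trajectory of the scheme, and their errors, in complex
notation. -/
theorem error_bounds {E : ℝ × Plane → Plane} {B : ℝ} {D : ℝ × ℂ → ℝ × ℂ →L[ℝ] ℂ}
    (hE : FieldBounds B (Kx E) (complexField E) D) {ε dt : ℝ} (hε : 0 < ε) (hdt : 0 < dt)
    {x₀ v₀ : Plane} {x v : ℝ → Plane} {T : Trajectory} (hx : IsCharacteristic E ε x₀ v₀ x v)
    (hT : SolvesScheme E ε dt x₀ v₀ T) (n : ℕ) :
    ‖T.x ε n - x (n * dt)‖ ≤ 23120 * B ^ 7 *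
      (Real.exp (104 * Kx E * (n * dt)) * (1 + n * dt) ^ 3 * (1 + ε ^ 2 + ‖v₀‖ ^ 2) *
        min (dt ^ 2 / ε ^ 5 * (1 + ε ^ 3)) (ε + dt ^ 2)) ∧
    ‖T.y n - guidingCenter ε (x (n * dt)) (v (n * dt))‖ ≤ 23120 * B ^ 7 *
      (Real.exp (104 * Kx E * (n * dt)) * (1 + n * dt) ^ 3 * (1 + ε ^ 2 + ‖v₀‖ ^ 2) *
        min (dt ^ 2 / ε ^ 5 * (1 + ε ^ 3)) (ε ^ 2 + dt ^ 2)) := by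
  obtain ⟨hy0, hv0, h⟩ := (solvesScheme_iff hdt).1 hT
  have hf := hx.isFlow hε
  have hB0 := hE.B_nonneg
  have hK := hE.K_nonneg
  have hy : toComplex (T.y 0) = toComplex (guidingCenter ε (x 0) (v 0)) := by
    rw [hy0, hx.x_zero, hx.v_zero]
  have hw : (ε : ℂ) * toComplex (T.v 0) = ε * toComplex (v 0) := by rw [hv0, hx.v_zero]
  have hV : ‖(ε : ℂ) * toComplex (v 0)‖ = ε * ‖v₀‖ := by
    rw [norm_mul, Complex.norm_of_nonneg hε.le, LinearIsometryEquiv.norm_map, hx.v_zero]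
  have h1 := classical_error_le hE hε hdt (W := fun n => ε * toComplex (T.v n)) h hf hy hw hV
    (norm_nonneg v₀) n
  have h2 := uniform_error_le hE hε hdt (W := fun n => ε * toComplex (T.v n)) h hf hy hw hV
    (norm_nonneg v₀) n
  have h3 := uniform_error_add_le hE hε hdt (W := fun n => ε * toComplex (T.v n)) h hf hy hw hV
    (norm_nonneg v₀) n
  have hdy : ‖T.y n - guidingCenter ε (x (n * dt)) (v (n * dt))‖ =
      ‖toComplex (T.y n) - toComplex (guidingCenter ε (x (n * dt)) (v (n * dt)))‖ := by
    rw [← map_sub, LinearIsometryEquiv.norm_map]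
  have hdx : ‖T.x ε n - x (n * dt)‖ ≤
      ‖toComplex (T.y n) - toComplex (guidingCenter ε (x (n * dt)) (v (n * dt)))‖ +
        ‖(ε : ℂ) * toComplex (T.v n) - ε * toComplex (v (n * dt))‖ := by
    have : T.x ε n - x (n * dt) = (T.y n - guidingCenter ε (x (n * dt)) (v (n * dt))) +
        (ε • perp (T.v n) - ε • perp (v (n * dt))) := by
      rw [Trajectory.x, guidingCenter]
      abel
    rw [this, ← toComplex.norm_map, map_add, map_sub, map_sub, map_smul, map_smul, toComplex_perp,
      toComplex_perp, Complex.real_smul, Complex.real_smul]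
    refine (norm_add_le _ _).trans_eq ?_
    congr 1
    rw [mul_left_comm, mul_left_comm (ε : ℂ) Complex.I, ← mul_sub, norm_mul, Complex.norm_I,
      one_mul]
  have hexp : Real.exp (36 * Kx E * (n * dt)) ≤ Real.exp (104 * Kx E * (n * dt)) := by
    gcongr
    norm_num
  rw [hdy]
  constructor
  · refine hdx.trans ?_
    rcases min_choice (dt ^ 2 / ε ^ 5 * (1 + ε ^ 3)) (ε + dt ^ 2) with hmin | hmin <;> rw [hmin]
    · exact h1
    · refine h3.trans ?_
      gcongr
      norm_num
  · rcases min_choice (dt ^ 2 / ε ^ 5 * (1 + ε ^ 3)) (ε ^ 2 + dt ^ 2) with hmin | hmin <;> rw [hmin]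
    · exact le_trans (le_add_of_nonneg_right (norm_nonneg _)) h1
    · refine h2.trans ?_
      gcongr
      norm_num

end GuidingCenter

end

open GuidingCenter in
theorem theorem5p1 :
    -- the scheme has a unique solution
    (∀ (E : ℝ × Plane → Plane) (ε dt : ℝ), 0 < ε → 0 < dt → ∀ x₀ v₀ : Plane,
      ∃! T : Trajectory, SolvesScheme E ε dt x₀ v₀ T) ∧
    -- error estimate on the space variable
    (∃ C₀ : ℝ, ∀ E : ℝ × Plane → Plane, FieldW2Infty E → ∃ C : ℝ,
      ∀ (ε dt : ℝ), 0 < ε → 0 < dt → ∀ (x₀ v₀ : Plane) (x v : ℝ → Plane) (T : Trajectory),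
        IsCharacteristic E ε x₀ v₀ x v → SolvesScheme E ε dt x₀ v₀ T → ∀ n : ℕ,
          ‖T.x ε n - x (n * dt)‖ ≤
            C * (Real.exp (C₀ * Kx E * (n * dt)) * (1 + n * dt) ^ 3 * (1 + ε ^ 2 + ‖v₀‖ ^ 2) *
              min (dt ^ 2 / ε ^ 5 * (1 + ε ^ 3)) (ε + dt ^ 2))) ∧
    -- error estimate on the guiding center variable
    (∃ C₀ : ℝ, ∀ E : ℝ × Plane → Plane, FieldW2Infty E → ∃ C : ℝ,
      ∀ (ε dt : ℝ), 0 < ε → 0 < dt → ∀ (x₀ v₀ : Plane) (x v : ℝ → Plane) (T : Trajectory),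
        IsCharacteristic E ε x₀ v₀ x v → SolvesScheme E ε dt x₀ v₀ T → ∀ n : ℕ,
          ‖T.y n - guidingCenter ε (x (n * dt)) (v (n * dt))‖ ≤
            C * (Real.exp (C₀ * Kx E * (n * dt)) * (1 + n * dt) ^ 4 * (1 + ε ^ 2 + ‖v₀‖ ^ 2) *
              min (dt ^ 2 / ε ^ 5 * (1 + ε ^ 3)) (ε ^ 2 + dt ^ 2))) := by
  -- The rate 104 is 36 + 2 · 34: 36 from stability and local error, and 34 = 17 · 2 from `wBound`
  -- at twice the final time, squared in `Q`. The uniform bound needs only 36.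
  refine ⟨fun E ε dt hε hdt x₀ v₀ => existsUnique_solvesScheme E hε hdt x₀ v₀,
    ⟨104, fun E hE => ?_⟩, ⟨104, fun E hE => ?_⟩⟩
  · obtain ⟨B, D, hB⟩ := hE.exists_fieldBounds
    exact ⟨23120 * B ^ 7, fun ε dt hε hdt x₀ v₀ x v T hx hT n =>
      (error_bounds hB hε hdt hx hT n).1⟩
  · obtain ⟨B, D, hB⟩ := hE.exists_fieldBounds
    -- The argument gives the power 3 of 1 + t for the guiding center too; it is only weakened to 4
    -- here.
    refine ⟨23120 * B ^ 7, fun ε dt hε hdt x₀ v₀ x v T hx hT n =>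
      (error_bounds hB hε hdt hx hT n).2.trans ?_⟩
    have := hB.B_nonneg
    have : (0 : ℝ) ≤ n * dt := by positivity
    gcongr
    · linarith
    · norm_num
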